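/- **Setting.** Let $\Omega=\prod_{i=1}^d(\alpha_i,\beta_i)$ be a bounded box with periodic boundary conditions, $\varepsilon>0$, $F\in C^\infty(\mathbb R)$, $C_0\in\mathbb R$, and let $\mathcal G=-I$ (Allen–Cahn) or $\mathcal G=\Delta$ (Cahn–Hilliard). Write $\langle v,w\rangle=\int_\Omega vw$, $\|\nabla v\|^2=\int_\Omega|\nabla v|^2$, $Q(u)=\int_\Omega F(u)\,dx+C_0$, and $$L(u)=\mathcal G(-\varepsilon^2\Delta u),\qquad N(u,r)=\mathcal G\Big(\tfrac{r}{\sqrt{Q(u)}}F'(u)\Big),\qquad \tilde N(u,r)=\tfrac{1}{2\sqrt{Q(u)}}\langle F'(u),L(u)+N(u,r)\rangle ,$$ $$E[u,r]=\tfrac{\varepsilon^2}{2}\|\nabla u\|^2+r^2-C_0,\qquad g(u,r)=\tfrac{\varepsilon^2}{2}\|\nabla(L(u)+N(u,r))\|^2+\tilde N(u,r)^2 .$$ Let $(A,b),(\bar A,\bar b)$ be the tableaux of an $s$-stage diagonally implicit-explicit (IMEX) Runge–Kutta method ($a_{ij}=0$ for $j>i$, $\bar a_{ij}=0$ for $j\ge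 i$) with $a_{ii}\ge 0$. It has order $p$ if for all smooth $f,h:\mathbb R^m\to\mathbb R^m$ (all $m$), applied to $y'=f(y)+h(y)$ with $f$ implicit and $h$ explicit, and for stages tending to $y(0)$ as $\tau\to0^+$, the error after one step of size $\tau$ from $y(0)$ is $\mathcal O(\tau^{p+1})$. For a step of size $\tau>0$ from $(u,r)$, with $u$ smooth and periodic, the stages $(U_i,R_i)_{i=1}^s$, with $U_i$ smooth and periodic, solve $$U_i=u+\tau\sum_{j\le i}a_{ij}L_j+\tau\sum_{j<i}\bar a_{ij}N_j,\qquad R_i=r+\tau\sum_{j<i}\bar a_{ij}\tilde N_j,$$ where $L_j=L(U_j)$, $N_j=N(U_j,R_j)$, $\tilde N_j=\tilde N(U_j,R_j)$. For $\gamma\in\mathbb R$ put $u_\gamma=u+\gamma\tau\sum_i(b_iL_i+\bar b_iN_i)$, $r_\gamma=r+\gamma\tau\sum_i\bar b_i\tilde N_i$, and $$G(\gamma)=E[u_\gamma,r_\gamma]-E[u,r]-\gamma\tau\sum_i\big(-\varepsilon^2\langle U_i,\Delta(b_iL_i+\bar b_iN_i)\rangle+2R_i\bar b_i\tilde N_i\big).$$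 With $D=\tfrac{\varepsilon^2}{2}\|\nabla\sum_i(b_iL_i+\bar b_iN_i)\|^2+(\sum_i\bar b_i\tilde N_i)^2$, the relaxation coefficient is $$\gamma_n=\frac{\sum_i\big(\varepsilon^2\langle u-U_i,\Delta(b_iL_i+\bar b_iN_i)\rangle-2(r-R_i)\bar b_i\tilde N_i\big)}{\tau D}\ \text{ if } D\neq0,\qquad \gamma_n=1\ \text{ if } D=0 .$$ **Theorem.** Suppose the IMEX Runge–Kutta method has order $p\ge2$. Let $K$ be a set of pairs $(u,r)$ of a smooth periodic function $u$ and a real number $r$ (for instance a single pair) such that over $K$ each derivative order of $u$ is uniformly bounded, $r$ is bounded, and $Q(u)$ is bounded below by a positive constant. Let $g_0>0$. Then there are $\tau_0>0$ and $C$ such that for all $\tau\in(0,\tau_0)$ and $(u,r)\in K$ the stages of the step of size $\tau$ from $(u,r)$ exist, are unique, and satisfy $Q(U_i)>0$; $G$ is differentiable with $$|G(1)|\le C\tau^{p+1},\qquad |G'(0)+g(u,r)\tau^2|\le C\tau^3,\qquad |G'(1)-g(u,r)\tau^2|\le C\tau^3 ;$$ and if $g(u,r)\ge g_0$ or $D=0$,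 then $$|\gamma_n-1|\le C\,\tau^{p-1}.$$ -/

import Mathlib

open Filter Topology Asymptotics MeasureTheory
open scoped ContDiff

/-- A double Butcher tableau of an `s`-stage diagonally implicit-explicit Runge-Kutta method:
`(A, b)` is the (diagonally) implicit part and `(Abar, bbar)` the explicit part. -/
structure IMEXTableau (s : ℕ) where
  A : Matrix (Fin s) (Fin s) ℝ
  Abar : Matrix (Fin s) (Fin s) ℝ
  b : Fin s → ℝ
  bbar : Fin s → ℝ
  A_lower : ∀ i j, i < j → A i j = 0
  Abar_strictLower : ∀ i j, i ≤ j → Abar i j = 0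

namespace IMEXTableau

variable {s : ℕ}

/-- The stage equations of one step of size `τ` from `y₀` for the split system
`y' = f y + g y`, where `f` is treated implicitly and `g` explicitly. -/
def IsODEStages (T : IMEXTableau s) {m : ℕ}
    (f g : EuclideanSpace ℝ (Fin m) → EuclideanSpace ℝ (Fin m))
    (y₀ : EuclideanSpace ℝ (Fin m)) (τ : ℝ) (Y : Fin s → EuclideanSpace ℝ (Fin m)) : Prop :=
  ∀ i, Y i = y₀ + τ • ∑ j, T.A i j • f (Y j) + τ • ∑ j, T.Abar i j • g (Y j)

/-- The update of one step of size `τ` from `y₀` with stages `Y`. -/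
noncomputable def odeUpdate (T : IMEXTableau s) {m : ℕ}
    (f g : EuclideanSpace ℝ (Fin m) → EuclideanSpace ℝ (Fin m))
    (y₀ : EuclideanSpace ℝ (Fin m)) (τ : ℝ) (Y : Fin s → EuclideanSpace ℝ (Fin m)) :
    EuclideanSpace ℝ (Fin m) :=
  y₀ + τ • ∑ i, T.b i • f (Y i) + τ • ∑ i, T.bbar i • g (Y i)

/-- The method has order `p`: for every smooth additively split system of ordinary differential
equations `y' = f y + g y`, every solution `y` near `t = 0` and every family of stages that solve
the stage equations for small step sizes `τ` and tend to `y 0` as `τ → 0⁺`, the local error of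
one step is `O(τ ^ (p + 1))`. -/
def HasOrder (T : IMEXTableau s) (p : ℕ) : Prop :=
  ∀ (m : ℕ) (f g : EuclideanSpace ℝ (Fin m) → EuclideanSpace ℝ (Fin m)),
    ContDiff ℝ ∞ f → ContDiff ℝ ∞ g →
    ∀ y : ℝ → EuclideanSpace ℝ (Fin m),
      (∀ᶠ t in 𝓝 0, HasDerivAt y (f (y t) + g (y t)) t) →
      ∀ Y : ℝ → Fin s → EuclideanSpace ℝ (Fin m),
        (∀ᶠ τ in 𝓝[>] 0, T.IsODEStages f g (y 0) τ (Y τ)) →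
        (∀ i, Tendsto (fun τ => Y τ i) (𝓝[>] 0) (𝓝 (y 0))) →
        (fun τ => T.odeUpdate f g (y 0) τ (Y τ) - y τ) =O[𝓝[>] 0] fun τ : ℝ => τ ^ (p + 1)

end IMEXTableau

/-- The two gradient flows: Allen-Cahn (`𝒢 = -I`) and Cahn-Hilliard (`𝒢 = Δ`). -/
inductive FlowType where
  | allenCahn
  | cahnHilliard

/-- Data of a phase-field gradient flow with a scalar auxiliary variable on the box
`∏ᵢ (lo i, hi i)` in dimension `d` with periodic boundary conditions: interface parameter `ε`,
potential `F`, and the constant `C₀` of the auxiliary variable. -/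
structure PhaseField (d : ℕ) where
  flow : FlowType
  lo : Fin d → ℝ
  hi : Fin d → ℝ
  lo_lt_hi : ∀ i, lo i < hi i
  ε : ℝ
  ε_pos : 0 < ε
  F : ℝ → ℝ
  F_smooth : ContDiff ℝ ∞ F
  C₀ : ℝ

namespace PhaseField

variable {d s : ℕ}

/-- The domain. -/
def Ω (P : PhaseField d) : Set (EuclideanSpace ℝ (Fin d)) :=
  {x | ∀ i, P.lo i < x i ∧ x i < P.hi i}

/-- Smooth functions satisfying the periodic boundary conditions, extended periodically. -/
def SmoothPeriodic (P : PhaseField d) (u : EuclideanSpace ℝ (Fin d) → ℝ) : Prop :=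
  ContDiff ℝ ∞ u ∧ ∀ i x, u (x + EuclideanSpace.single i (P.hi i - P.lo i)) = u x

/-- The `L²(Ω)` inner product. -/
noncomputable def inner2 (P : PhaseField d) (v w : EuclideanSpace ℝ (Fin d) → ℝ) : ℝ :=
  ∫ x in P.Ω, v x * w x

/-- The squared `L²(Ω)` norm of the gradient. -/
noncomputable def gradSq (P : PhaseField d) (v : EuclideanSpace ℝ (Fin d) → ℝ) : ℝ :=
  ∫ x in P.Ω, ‖gradient v x‖ ^ 2

/-- The Laplacian. -/
noncomputable def lap (v : EuclideanSpace ℝ (Fin d) → ℝ) : EuclideanSpace ℝ (Fin d) → ℝ :=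
  Laplacian.laplacian v

/-- The operator `𝒢`. -/
noncomputable def G (P : PhaseField d) (v : EuclideanSpace ℝ (Fin d) → ℝ) :
    EuclideanSpace ℝ (Fin d) → ℝ :=
  match P.flow with
  | FlowType.allenCahn => -v
  | FlowType.cahnHilliard => lap v

/-- `∫_Ω F(u) dx + C₀`. -/
noncomputable def potential (P : PhaseField d) (u : EuclideanSpace ℝ (Fin d) → ℝ) : ℝ :=
  (∫ x in P.Ω, P.F (u x)) + P.C₀

/-- `L(u) = 𝒢(-ε² Δ u)`. -/
noncomputable def L (P : PhaseField d) (u : EuclideanSpace ℝ (Fin d) → ℝ) :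
    EuclideanSpace ℝ (Fin d) → ℝ :=
  P.G (-(P.ε ^ 2 • lap u))

/-- `N(u, r) = 𝒢(r / √(∫ F(u) + C₀) • F'(u))`. -/
noncomputable def N (P : PhaseField d) (u : EuclideanSpace ℝ (Fin d) → ℝ) (r : ℝ) :
    EuclideanSpace ℝ (Fin d) → ℝ :=
  P.G ((r / √(P.potential u)) • fun x => deriv P.F (u x))

/-- `Ñ(u, r) = ⟨F'(u), u_t⟩ / (2 √(∫ F(u) + C₀))`, with `u_t = L(u) + N(u, r)`. -/
noncomputable def Ntilde (P : PhaseField d) (u : EuclideanSpace ℝ (Fin d) → ℝ) (r : ℝ) : ℝ :=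
  1 / (2 * √(P.potential u)) * P.inner2 (fun x => deriv P.F (u x)) (P.L u + P.N u r)

/-- The modified energy `E[u, r]`. -/
noncomputable def energy (P : PhaseField d) (u : EuclideanSpace ℝ (Fin d) → ℝ) (r : ℝ) : ℝ :=
  P.ε ^ 2 / 2 * P.gradSq u + r ^ 2 - P.C₀

/-- `(U, R)` are internal stages of one step of size `τ` from `(u, r)`. -/
structure IsStages (P : PhaseField d) (T : IMEXTableau s) (τ : ℝ)
    (u : EuclideanSpace ℝ (Fin d) → ℝ) (r : ℝ)
    (U : Fin s → EuclideanSpace ℝ (Fin d) → ℝ) (R : Fin s → ℝ) : Prop where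
  smooth : ∀ i, P.SmoothPeriodic (U i)
  U_eq : ∀ i, U i = u + τ • ∑ j, T.A i j • P.L (U j) + τ • ∑ j, T.Abar i j • P.N (U j) (R j)
  R_eq : ∀ i, R i = r + τ * ∑ j, T.Abar i j * P.Ntilde (U j) (R j)

/-- `bᵢ Lᵢ + b̄ᵢ Nᵢ` at the stage `i`. -/
noncomputable def slope (P : PhaseField d) (T : IMEXTableau s)
    (U : Fin s → EuclideanSpace ℝ (Fin d) → ℝ) (R : Fin s → ℝ) (i : Fin s) :
    EuclideanSpace ℝ (Fin d) → ℝ :=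
  T.b i • P.L (U i) + T.bbar i • P.N (U i) (R i)

/-- `b̄ᵢ Ñᵢ` at the stage `i`. -/
noncomputable def slopeR (P : PhaseField d) (T : IMEXTableau s)
    (U : Fin s → EuclideanSpace ℝ (Fin d) → ℝ) (R : Fin s → ℝ) (i : Fin s) : ℝ :=
  T.bbar i * P.Ntilde (U i) (R i)

/-- The relaxed update of `u`, with relaxation coefficient `γ`. -/
noncomputable def updateU (P : PhaseField d) (T : IMEXTableau s) (τ γ : ℝ)
    (u : EuclideanSpace ℝ (Fin d) → ℝ)
    (U : Fin s → EuclideanSpace ℝ (Fin d) → ℝ) (R : Fin s → ℝ) :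
    EuclideanSpace ℝ (Fin d) → ℝ :=
  u + (γ * τ) • ∑ i, P.slope T U R i

/-- The relaxed update of `r`, with relaxation coefficient `γ`. -/
noncomputable def updateR (P : PhaseField d) (T : IMEXTableau s) (τ γ : ℝ) (r : ℝ)
    (U : Fin s → EuclideanSpace ℝ (Fin d) → ℝ) (R : Fin s → ℝ) : ℝ :=
  r + γ * τ * ∑ i, P.slopeR T U R i

/-- The quantity whose non-vanishing decides how the relaxation coefficient is defined. -/
noncomputable def relaxDenom (P : PhaseField d) (T : IMEXTableau s)
    (U : Fin s → EuclideanSpace ℝ (Fin d) → ℝ) (R : Fin s → ℝ) : ℝ :=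
  P.ε ^ 2 / 2 * P.gradSq (∑ i, P.slope T U R i) + (∑ i, P.slopeR T U R i) ^ 2

/-- The relaxation coefficient of a step of size `τ` from `(u, r)` with stages `(U, R)`. -/
noncomputable def relaxCoeff (P : PhaseField d) (T : IMEXTableau s) (τ : ℝ)
    (u : EuclideanSpace ℝ (Fin d) → ℝ) (r : ℝ)
    (U : Fin s → EuclideanSpace ℝ (Fin d) → ℝ) (R : Fin s → ℝ) : ℝ :=
  if P.relaxDenom T U R ≠ 0 then
    (∑ i, (P.ε ^ 2 * P.inner2 (u - U i) (lap (P.slope T U R i))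
      - 2 * (r - R i) * P.slopeR T U R i)) / (τ * P.relaxDenom T U R)
  else 1

/-- The function `γ ↦ Gₙ(γ)`: the energy increment of the relaxed step minus the dissipation
term. -/
noncomputable def relaxFun (P : PhaseField d) (T : IMEXTableau s) (τ : ℝ)
    (u : EuclideanSpace ℝ (Fin d) → ℝ) (r : ℝ)
    (U : Fin s → EuclideanSpace ℝ (Fin d) → ℝ) (R : Fin s → ℝ) (γ : ℝ) : ℝ :=
  P.energy (P.updateU T τ γ u U R) (P.updateR T τ γ r U R) - P.energy u r
    - (-(P.ε ^ 2 * γ * τ * ∑ i, P.inner2 (U i) (lap (P.slope T U R i)))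
        + γ * τ * ∑ i, 2 * R i * P.slopeR T U R i)

/-- The leading coefficient `g = ε²/2 ‖∇(L(u) + N(u, r))‖² + Ñ(u, r)²`. -/
noncomputable def leading (P : PhaseField d) (u : EuclideanSpace ℝ (Fin d) → ℝ) (r : ℝ) : ℝ :=
  P.ε ^ 2 / 2 * P.gradSq (P.L u + P.N u r) + P.Ntilde u r ^ 2

end PhaseField

/-! Write ℰ for `energyDefect` and D for `relaxDenom`. The energy is quadratic, so G is the
polynomial G(γ) = γ(τℰ - τ²D) + γ²τ²D (`relaxFun_eq`). Hence G(1) = τℰ, G'(0) = τℰ - τ²D, G'(1) = τℰ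
+ τ²D, and γₙ - 1 = -τℰ/(τ²D) when D ≠ 0. Everything follows from two estimates that hold uniformly
over K: D = g(u, r) + O(τ) and τℰ = O(τ^(p+1)). The first one holds because the stages are within
O(τ) of (u, r) and both weight vectors sum to one (`isBigO_relaxDenom`, `sum_b`).

For an ordinary differential equation y' = f(y) + h(y) and a symmetric form B, the second estimate
is an order condition in disguise (`isBigO_balanceDefect`). Adjoin a scalar q with q' = B(y, f(y) +
h(y)), so that q = B(y, y)/2 along the exact solution. By the order of the method for the enlarged
system, both the numerical q and half the form at the numerical y agree with B(y(τ), y(τ))/2 up to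
O(τ^(p+1)), and τℰ is their difference.

The phase-field step is reduced to this case as follows. The resolvent of L is a Fourier multiplier
of modulus at most one whatever the step size, so all derivatives of the stages are bounded
(`stage_bounds`). Each substitution of these bounds into the stage equations gains a factor τ, so
the stages have expansions in τ of every length, uniformly over K (`BoundedStages.expansion`). For
one fixed (u, r), the Taylor coefficients of the stages and of their slopes span a
finite-dimensional space of functions. Interpolation in that space yields a smooth system of
ordinary differential equations whose stage equations are solved by the nodal values up to
O(τ^(p+1)), and whose energy defect differs from the true one by as little
(`isBigO_energyDefect_of_interpolation`).

The order assumption gives constants that depend on the system, hence on (u, r). Uniformity is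
recovered at the end: τℰ itself has a uniform expansion of length p + 1, the pointwise estimate
forces its coefficients to vanish, and the remainder is uniformly bounded (`isBigO_of_pointwise`).
-/

/-! ### Order conditions and quadratic energies for ordinary differential equations -/

/-- A fixed-point equation `Z = z₀ + τ Ψ(Z)` solved up to `O(τ ^ q)` has an exact solution
within `O(τ ^ q)`. -/
theorem exists_fixedPoint_near_approx {E : Type*} [NormedAddCommGroup E] [NormedSpace ℝ E]
    [CompleteSpace E] {Ψ : E → E} {z₀ : E} (hΨ : ContDiffAt ℝ 1 Ψ z₀) {Z : ℝ → E}
    (hZ : Tendsto Z (𝓝[>] 0) (𝓝 z₀)) {q : ℕ}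
    (hres : (fun τ => Z τ - (z₀ + τ • Ψ (Z τ))) =O[𝓝[>] 0] fun τ : ℝ => τ ^ q) :
    ∃ W : ℝ → E, (∀ᶠ τ in 𝓝[>] 0, W τ = z₀ + τ • Ψ (W τ)) ∧
      Tendsto W (𝓝[>] 0) (𝓝 z₀) ∧ (fun τ => W τ - Z τ) =O[𝓝[>] 0] fun τ : ℝ => τ ^ q := by
  obtain ⟨K, t, ht, hL⟩ := hΨ.exists_lipschitzOnWith
  obtain ⟨r, hr, hrt⟩ := Metric.nhds_basis_closedBall.mem_iff.1 ht
  have hLr : ∀ x ∈ Metric.closedBall z₀ r, ∀ y ∈ Metric.closedBall z₀ r,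
      ‖Ψ x - Ψ y‖ ≤ K * ‖x - y‖ := fun x hx y hy => by
    simpa [dist_eq_norm] using hL.dist_le_mul x (hrt hx) y (hrt hy)
  have hτ0 : Tendsto (fun τ : ℝ => τ) (𝓝[>] 0) (𝓝 0) := nhdsWithin_le_nhds
  -- The first smallness condition makes z ↦ z₀ + τ Ψ(z) map the ball of radius r into itself, the
  -- second makes it a contraction with constant 1/2.
  have h1 : ∀ᶠ τ : ℝ in 𝓝[>] 0, τ * (‖Ψ z₀‖ + K * r) ≤ r := by
    have : Tendsto (fun τ : ℝ => τ * (‖Ψ z₀‖ + K * r)) (𝓝[>] 0) (𝓝 0) := by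
      simpa using hτ0.mul_const (‖Ψ z₀‖ + K * r)
    exact this.eventually_le_const hr
  have h2 : ∀ᶠ τ : ℝ in 𝓝[>] 0, τ * K ≤ 1 / 2 := by
    have : Tendsto (fun τ : ℝ => τ * (K : ℝ)) (𝓝[>] 0) (𝓝 0) := by
      simpa using hτ0.mul_const (K : ℝ)
    exact this.eventually_le_const (by norm_num)
  have hz₀ : z₀ ∈ Metric.closedBall z₀ r := Metric.mem_closedBall_self hr.le
  have hbound : ∀ τ : ℝ, 0 < τ → τ * (‖Ψ z₀‖ + K * r) ≤ r →
      ∀ z ∈ Metric.closedBall z₀ r, ‖τ • Ψ z‖ ≤ τ * (‖Ψ z₀‖ + K * r) := by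
    intro τ hτ _ z hz
    have h3 := hLr z hz z₀ hz₀
    have h4 : ‖z - z₀‖ ≤ r := by simpa [dist_eq_norm] using hz
    have h5 : ‖Ψ z‖ ≤ ‖Ψ z₀‖ + K * r := by
      calc ‖Ψ z‖ = ‖Ψ z₀ + (Ψ z - Ψ z₀)‖ := by rw [add_sub_cancel]
        _ ≤ ‖Ψ z₀‖ + K * ‖z - z₀‖ := (norm_add_le _ _).trans (by gcongr)
        _ ≤ ‖Ψ z₀‖ + K * r := by gcongr
    rw [norm_smul, Real.norm_of_nonneg hτ.le]
    gcongr
  have hex : ∀ᶠ τ : ℝ in 𝓝[>] 0, ∃ w ∈ Metric.closedBall z₀ r, w = z₀ + τ • Ψ w := by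
    filter_upwards [h1, h2, self_mem_nhdsWithin] with τ h1 h2 hτ
    have hτ' : (0 : ℝ) < τ := hτ
    have hmaps : Set.MapsTo (fun z => z₀ + τ • Ψ z) (Metric.closedBall z₀ r)
        (Metric.closedBall z₀ r) := fun z hz => by
      simpa [dist_eq_norm] using (hbound τ hτ' h1 z hz).trans h1
    have hcon : ContractingWith (1 / 2) (hmaps.restrict _ _ _) := by
      refine ⟨by rw [← NNReal.coe_lt_coe]; norm_num, LipschitzWith.of_dist_le_mul ?_⟩
      rintro ⟨x, hx⟩ ⟨y, hy⟩
      have h6 : dist (z₀ + τ • Ψ x) (z₀ + τ • Ψ y) ≤ 1 / 2 * dist x y := by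
        rw [dist_add_left, dist_eq_norm, ← smul_sub, norm_smul, Real.norm_of_nonneg hτ'.le,
          dist_eq_norm]
        calc τ * ‖Ψ x - Ψ y‖ ≤ τ * (K * ‖x - y‖) := by gcongr; exact hLr x hx y hy
          _ = (τ * K) * ‖x - y‖ := by ring
          _ ≤ 1 / 2 * ‖x - y‖ := by gcongr
      simpa [Subtype.dist_eq] using h6
    obtain ⟨w, hw, hfix, -⟩ := hcon.exists_fixedPoint' Metric.isClosed_closedBall.isComplete
      hmaps hz₀ (edist_ne_top _ _)
    exact ⟨w, hw, hfix.symm⟩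
  classical
  let W : ℝ → E := fun τ => if h : ∃ w ∈ Metric.closedBall z₀ r, w = z₀ + τ • Ψ w then
    h.choose else z₀
  have hW : ∀ᶠ τ : ℝ in 𝓝[>] 0, W τ ∈ Metric.closedBall z₀ r ∧ W τ = z₀ + τ • Ψ (W τ) := by
    filter_upwards [hex] with τ h
    have : W τ = h.choose := dif_pos h
    rw [this]
    exact h.choose_spec
  refine ⟨W, hW.mono fun τ h => h.2, ?_, ?_⟩
  · rw [tendsto_iff_norm_sub_tendsto_zero]
    have hlim : Tendsto (fun τ : ℝ => τ * (‖Ψ z₀‖ + K * r)) (𝓝[>] 0) (𝓝 0) := by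
      simpa using hτ0.mul_const (‖Ψ z₀‖ + K * r)
    refine squeeze_zero' (Eventually.of_forall fun _ => norm_nonneg _) ?_ hlim
    filter_upwards [hW, h1, self_mem_nhdsWithin] with τ hw h1 hτ
    have : W τ - z₀ = τ • Ψ (W τ) := by
      nth_rewrite 1 [hw.2]; exact add_sub_cancel_left _ _
    rw [this]
    exact hbound τ hτ h1 _ hw.1
  -- The constant 2 comes from absorption: W - Z is the residual of Z plus a term of norm at most
  -- half of ‖W - Z‖.
  · refine IsBigO.trans (IsBigO.of_bound 2 ?_) hres
    have hZr : ∀ᶠ τ : ℝ in 𝓝[>] 0, Z τ ∈ Metric.closedBall z₀ r :=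
      hZ.eventually (Metric.closedBall_mem_nhds z₀ hr)
    filter_upwards [hW, h2, hZr, self_mem_nhdsWithin] with τ hw h2 hz hτ
    have hτ' : (0 : ℝ) < τ := hτ
    have h3 : W τ - Z τ = -(Z τ - (z₀ + τ • Ψ (Z τ))) + τ • (Ψ (W τ) - Ψ (Z τ)) := by
      nth_rewrite 1 [hw.2]; rw [smul_sub]; abel
    have h4 : ‖τ • (Ψ (W τ) - Ψ (Z τ))‖ ≤ 1 / 2 * ‖W τ - Z τ‖ := by
      rw [norm_smul, Real.norm_of_nonneg hτ'.le]
      calc τ * ‖Ψ (W τ) - Ψ (Z τ)‖ ≤ τ * (K * ‖W τ - Z τ‖) := by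
            gcongr; exact hLr _ hw.1 _ hz
        _ = (τ * K) * ‖W τ - Z τ‖ := by ring
        _ ≤ 1 / 2 * ‖W τ - Z τ‖ := by gcongr
    have h5 := norm_add_le (-(Z τ - (z₀ + τ • Ψ (Z τ)))) (τ • (Ψ (W τ) - Ψ (Z τ)))
    rw [← h3, norm_neg] at h5
    linarith

theorem ContDiff.isBigO_sub_of_tendsto {E F ι : Type*} [NormedAddCommGroup E] [NormedSpace ℝ E]
    [NormedAddCommGroup F] [NormedSpace ℝ F] {f : E → F} (hf : ContDiff ℝ ∞ f) {l : Filter ι}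
    {x : E} {a b : ι → E} (ha : Tendsto a l (𝓝 x)) (hb : Tendsto b l (𝓝 x)) :
    (fun i => f (a i) - f (b i)) =O[l] fun i => a i - b i :=
  ((hf.contDiffAt.hasStrictFDerivAt (x := x) (by simp)).isBigO_sub).comp_tendsto
    (ha.prodMk_nhds hb)

namespace IMEXTableau

variable {s : ℕ} {T : IMEXTableau s} {p : ℕ}

/-- The order of the method in an arbitrary finite-dimensional space. -/
theorem HasOrder.of_finiteDimensional (hT : T.HasOrder p) {W : Type*} [NormedAddCommGroup W]
    [NormedSpace ℝ W] [FiniteDimensional ℝ W] {f g : W → W} (hf : ContDiff ℝ ∞ f)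
    (hg : ContDiff ℝ ∞ g) {y : ℝ → W} (hy : ∀ᶠ t in 𝓝 0, HasDerivAt y (f (y t) + g (y t)) t)
    {Y : ℝ → Fin s → W}
    (hY : ∀ᶠ τ in 𝓝[>] 0, ∀ i, Y τ i = y 0 + τ • ∑ j, T.A i j • f (Y τ j)
      + τ • ∑ j, T.Abar i j • g (Y τ j))
    (hlim : ∀ i, Tendsto (fun τ => Y τ i) (𝓝[>] 0) (𝓝 (y 0))) :
    (fun τ => y 0 + τ • ∑ i, T.b i • f (Y τ i) + τ • ∑ i, T.bbar i • g (Y τ i) - y τ)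
      =O[𝓝[>] 0] fun τ : ℝ => τ ^ (p + 1) := by
  let e := toEuclidean (E := W)
  have key := hT _ (fun z => e (f (e.symm z))) (fun z => e (g (e.symm z)))
    (by exact e.contDiff.comp (hf.comp e.symm.contDiff))
    (by exact e.contDiff.comp (hg.comp e.symm.contDiff)) (fun t => e (y t)) ?_
    (fun τ i => e (Y τ i)) ?_ ?_
  · have h2 := (e.symm : _ →L[ℝ] W).isBigO_comp
      (fun τ => T.odeUpdate (fun z => e (f (e.symm z))) (fun z => e (g (e.symm z)))
        (e (y 0)) τ (fun i => e (Y τ i)) - e (y τ)) (𝓝[>] 0)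
    refine (h2.trans key).congr_left fun τ => ?_
    simp [odeUpdate]
  · filter_upwards [hy] with t ht
    have h := e.toContinuousLinearMap.hasFDerivAt.comp_hasDerivAt t ht
    refine HasDerivAt.congr_deriv (f' := e (f (y t) + g (y t))) h ?_
    simp
  · filter_upwards [hY] with τ h i
    have := congrArg e (h i)
    simpa using this
  · exact fun i => (e.continuous.tendsto _).comp (hlim i)

section Quadratic

variable {W : Type*} [NormedAddCommGroup W] [NormedSpace ℝ W]

/-- The increment of the vector field at a stage. -/
noncomputable def increment (T : IMEXTableau s) (f g : W → W) (Z : Fin s → W) (i : Fin s) : W :=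
  T.b i • f (Z i) + T.bbar i • g (Z i)

/-- The defect of the energy balance of one step of the method for a quadratic energy, divided by
the step size. -/
noncomputable def balanceDefect (T : IMEXTableau s) (f g : W → W) (B : W →L[ℝ] W →L[ℝ] ℝ) (y₀ : W) (τ : ℝ)
    (Z : Fin s → W) : ℝ :=
  ∑ i, B (y₀ - Z i) (T.increment f g Z i)
    + τ / 2 * B (∑ i, T.increment f g Z i) (∑ i, T.increment f g Z i)

/-- The order conditions imply that quadratic energies are balanced up to the order of the
method. -/
theorem HasOrder.isBigO_balanceDefect [FiniteDimensional ℝ W] (hT : T.HasOrder p) {f g : W → W}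
    (hf : ContDiff ℝ ∞ f) (hg : ContDiff ℝ ∞ g) {B : W →L[ℝ] W →L[ℝ] ℝ}
    (hB : ∀ v w, B v w = B w v) {y₀ : W} {Y : ℝ → Fin s → W}
    (hY : ∀ᶠ τ in 𝓝[>] 0, ∀ i, Y τ i = y₀ + τ • ∑ j, T.A i j • f (Y τ j)
      + τ • ∑ j, T.Abar i j • g (Y τ j))
    (hlim : ∀ i, Tendsto (fun τ => Y τ i) (𝓝[>] 0) (𝓝 y₀)) :
    (fun τ => τ * T.balanceDefect f g B y₀ τ (Y τ)) =O[𝓝[>] 0] fun τ : ℝ => τ ^ (p + 1) := by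
  have : CompleteSpace W := FiniteDimensional.complete ℝ W
  obtain ⟨y, hy0, ε, hε, hy⟩ :=
    ((hf.add hg).of_le (by simp : (1 : ℕ∞ω) ≤ ∞)).contDiffAt (x := y₀)
      |>.exists_forall_mem_closedBall_exists_eq_forall_mem_Ioo_hasDerivAt₀ 0
  have hy' : ∀ᶠ t in 𝓝 (0 : ℝ), HasDerivAt y (f (y t) + g (y t)) t := by
    filter_upwards [Ioo_mem_nhds (show 0 - ε < 0 by linarith) (show 0 < 0 + ε by linarith)]
      with t ht using hy t ht
  -- The system is enlarged by a scalar that integrates the power B(y, y'). Along the exact solution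
  -- this scalar is B(y, y)/2 by the symmetry of B.
  let F : W × ℝ → W × ℝ := fun z => (f z.1, B z.1 (f z.1))
  let G : W × ℝ → W × ℝ := fun z => (g z.1, B z.1 (g z.1))
  have hF : ContDiff ℝ ∞ F := by
    have h1 : ContDiff ℝ ∞ fun z : W × ℝ => f z.1 := hf.comp contDiff_fst
    exact h1.prodMk ((B.contDiff.comp contDiff_fst).clm_apply h1)
  have hG : ContDiff ℝ ∞ G := by
    have h1 : ContDiff ℝ ∞ fun z : W × ℝ => g z.1 := hg.comp contDiff_fst
    exact h1.prodMk ((B.contDiff.comp contDiff_fst).clm_apply h1)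
  let x : ℝ → W × ℝ := fun t => (y t, B (y t) (y t) / 2)
  have hx : ∀ᶠ t in 𝓝 (0 : ℝ), HasDerivAt x (F (x t) + G (x t)) t := by
    filter_upwards [hy'] with t ht
    refine ht.prodMk ?_
    have h1 : HasDerivAt (fun t => B (y t)) (B (f (y t) + g (y t))) t :=
      B.hasFDerivAt.comp_hasDerivAt t ht
    have h2 := (h1.clm_apply ht).div_const 2
    refine h2.congr_deriv ?_
    rw [hB (f (y t) + g (y t)) (y t)]
    simp only [x, map_add, F, G]
    ring
  have hlimY : ∀ (i : Fin s) {φ : W → ℝ} (hφ : Continuous φ),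
      Tendsto (fun τ => φ (Y τ i)) (𝓝[>] 0) (𝓝 (φ y₀)) := fun i φ hφ =>
    (hφ.tendsto _).comp (hlim i)
  have hτ0 : Tendsto (fun τ : ℝ => τ) (𝓝[>] 0) (𝓝 0) := nhdsWithin_le_nhds
  -- The enlarged vector fields do not depend on the scalar, so its stage values are explicit in the
  -- stages Y and no further equation has to be solved.
  let X : ℝ → Fin s → W × ℝ := fun τ i => (Y τ i, B y₀ y₀ / 2
    + τ * ∑ j, T.A i j * B (Y τ j) (f (Y τ j)) + τ * ∑ j, T.Abar i j * B (Y τ j) (g (Y τ j)))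
  have hcf : Continuous fun v => B v (f v) := B.continuous.clm_apply hf.continuous
  have hcg : Continuous fun v => B v (g v) := B.continuous.clm_apply hg.continuous
  have key := hT.of_finiteDimensional hF hG hx (Y := X) ?_ ?_
  · have h1 : (fun τ => y₀ + τ • ∑ i, T.increment f g (Y τ) i - y τ)
        =O[𝓝[>] 0] fun τ : ℝ => τ ^ (p + 1) := by
      refine ((ContinuousLinearMap.fst ℝ W ℝ).isBigO_comp _ _ |>.trans key).congr_left fun τ => ?_
      simp [x, X, F, G, hy0, increment, Finset.sum_add_distrib, Prod.fst_sum, add_assoc]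
    have h2 : (fun τ => B y₀ y₀ / 2 + τ * ∑ i, B (Y τ i) (T.increment f g (Y τ) i)
        - B (y τ) (y τ) / 2) =O[𝓝[>] 0] fun τ : ℝ => τ ^ (p + 1) := by
      refine ((ContinuousLinearMap.snd ℝ W ℝ).isBigO_comp _ _ |>.trans key).congr_left fun τ => ?_
      simp [x, X, F, G, hy0, increment, Finset.sum_add_distrib, Prod.snd_sum, mul_add, add_assoc]
    have hyO : y =O[𝓝[>] 0] fun _ => (1 : ℝ) := by
      have : Tendsto y (𝓝[>] 0) (𝓝 (y 0)) :=
        (hy 0 (by constructor <;> linarith)).continuousAt.tendsto.mono_left nhdsWithin_le_nhds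
      exact this.isBigO_one ℝ
    have hpO : (fun τ : ℝ => τ ^ (p + 1)) =O[𝓝[>] 0] fun _ => (1 : ℝ) :=
      (hτ0.pow (p + 1)).isBigO_one ℝ
    have hy1O : (fun τ => y₀ + τ • ∑ i, T.increment f g (Y τ) i) =O[𝓝[>] 0]
        fun _ => (1 : ℝ) := by
      refine ((h1.trans hpO).add hyO).congr_left fun τ => by abel
    have hBb : ∀ a b : ℝ → W, ∀ u v : ℝ → ℝ, a =O[𝓝[>] 0] u → b =O[𝓝[>] 0] v →
        (fun τ => B (a τ) (b τ)) =O[𝓝[>] 0] fun τ => u τ * v τ := by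
      intro a b u v ha hb
      refine IsBigO.trans (IsBigO.of_bound ‖B‖ (Eventually.of_forall fun τ => ?_))
        (ha.norm_left.mul hb.norm_left)
      simpa [mul_assoc] using B.le_opNorm₂ (a τ) (b τ)
    -- With y₁ the numerical update, B(y₁, y₁) - B(y, y) = B(y₁ - y, y₁) + B(y, y₁ - y), and each
    -- summand contains the local error as a factor.
    have h3 := (hBb _ _ _ _ h1 hy1O).add ((hBb _ _ _ _ hyO h1).congr_right fun τ => mul_comm _ _)
    refine ((h3.const_mul_left (1 / 2)).congr_right fun τ => mul_one _).sub h2 |>.congr_left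
      fun τ => ?_
    simp only [balanceDefect, map_sub, map_add, map_smul, add_apply,
      sub_apply, smul_apply, smul_eq_mul,
      Finset.sum_sub_distrib]
    rw [hB (∑ i, T.increment f g (Y τ) i) y₀, ← map_sum (B y₀)]
    ring
  · filter_upwards [hY] with τ h i
    refine Prod.ext ?_ ?_
    · simpa [x, X, F, G, hy0, Prod.fst_sum] using h i
    · simp [x, X, F, G, hy0, Prod.snd_sum]
  · intro i
    have h0 : x 0 = (y₀, B y₀ y₀ / 2 + 0 * ∑ j, T.A i j * B y₀ (f y₀)
        + 0 * ∑ j, T.Abar i j * B y₀ (g y₀)) := by simp [x, hy0]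
    rw [h0]
    refine (hlim i).prodMk_nhds ?_
    refine (tendsto_const_nhds.add (hτ0.mul (tendsto_finsetSum _ fun j _ =>
      (hlimY j hcf).const_mul _))).add (hτ0.mul (tendsto_finsetSum _ fun j _ =>
      (hlimY j hcg).const_mul _))

/-- The energy balance for approximate stages. -/
theorem HasOrder.isBigO_balanceDefect_of_approx [FiniteDimensional ℝ W] (hT : T.HasOrder p)
    {f g : W → W}
    (hf : ContDiff ℝ ∞ f) (hg : ContDiff ℝ ∞ g) {B : W →L[ℝ] W →L[ℝ] ℝ}
    (hB : ∀ v w, B v w = B w v) {y₀ : W} {Y : ℝ → Fin s → W}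
    (hY : ∀ i, (fun τ => Y τ i - (y₀ + τ • ∑ j, T.A i j • f (Y τ j)
      + τ • ∑ j, T.Abar i j • g (Y τ j))) =O[𝓝[>] 0] fun τ : ℝ => τ ^ (p + 1))
    (hlim : ∀ i, Tendsto (fun τ => Y τ i) (𝓝[>] 0) (𝓝 y₀)) :
    (fun τ => τ * T.balanceDefect f g B y₀ τ (Y τ)) =O[𝓝[>] 0] fun τ : ℝ => τ ^ (p + 1) := by
  have : CompleteSpace W := FiniteDimensional.complete ℝ W
  let Ψ : (Fin s → W) → (Fin s → W) := fun Z i =>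
    ∑ j, T.A i j • f (Z j) + ∑ j, T.Abar i j • g (Z j)
  have hpr : ∀ j, ContDiff ℝ ∞ fun Z : Fin s → W => Z j := fun j => contDiff_apply ℝ W j
  have hΨ : ContDiff ℝ ∞ Ψ := by
    refine contDiff_pi.2 fun i => ?_
    refine (ContDiff.sum fun j _ => ?_).add (ContDiff.sum fun j _ => ?_)
    · exact (hf.comp (hpr j)).const_smul _
    · exact (hg.comp (hpr j)).const_smul _
  have hlim' : Tendsto Y (𝓝[>] 0) (𝓝 fun _ => y₀) := tendsto_pi_nhds.2 hlim
  -- The order assumption speaks only of exact stages. Exact ones lie within O(τ^(p+1)) of the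
  -- approximate ones, and the defect depends smoothly on the step size and the stages.
  obtain ⟨Z, hZ, hZlim, hZY⟩ := exists_fixedPoint_near_approx (Ψ := Ψ)
    (hΨ.of_le (by simp)).contDiffAt hlim' (q := p + 1) (by
      refine isBigO_pi.2 fun i => (hY i).congr_left fun τ => ?_
      simp [Ψ, add_assoc])
  have h1 := hT.isBigO_balanceDefect hf hg hB (y₀ := y₀) (Y := Z) (by
    filter_upwards [hZ] with τ h i
    nth_rewrite 1 [h]
    simp [Ψ, add_assoc]) (fun i => tendsto_pi_nhds.1 hZlim i)
  have hinc : ∀ i, ContDiff ℝ ∞ fun Z : Fin s → W => T.increment f g Z i := fun i =>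
    ((hf.comp (hpr i)).const_smul (T.b i)).add ((hg.comp (hpr i)).const_smul (T.bbar i))
  have hsm : ContDiff ℝ ∞ fun z : ℝ × (Fin s → W) => T.balanceDefect f g B y₀ z.1 z.2 := by
    have hinc' : ∀ i, ContDiff ℝ ∞ fun z : ℝ × (Fin s → W) => T.increment f g z.2 i :=
      fun i => (hinc i).comp contDiff_snd
    have hsum : ContDiff ℝ ∞ fun z : ℝ × (Fin s → W) => ∑ i, T.increment f g z.2 i :=
      ContDiff.sum fun i _ => hinc' i
    refine (ContDiff.sum fun i _ => ?_).add ((contDiff_fst.div_const 2).mul ?_)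
    · exact (B.contDiff.comp (contDiff_const.sub ((hpr i).comp contDiff_snd))).clm_apply
        (hinc' i)
    · exact (B.contDiff.comp hsum).clm_apply hsum
  have hτ0 : Tendsto (fun τ : ℝ => τ) (𝓝[>] 0) (𝓝 0) := nhdsWithin_le_nhds
  have h2 := hsm.isBigO_sub_of_tendsto (l := 𝓝[>] (0 : ℝ)) (x := (0, fun _ => y₀))
    (a := fun τ => (τ, Y τ)) (b := fun τ => (τ, Z τ)) (hτ0.prodMk_nhds hlim')
    (hτ0.prodMk_nhds hZlim)
  have h3 : (fun τ : ℝ => ((τ, Y τ) : ℝ × (Fin s → W)) - (τ, Z τ)) =O[𝓝[>] 0]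
      fun τ : ℝ => τ ^ (p + 1) := by
    refine IsBigO.trans (IsBigO.of_bound 1 (Eventually.of_forall fun τ => ?_)) hZY
    simp [norm_sub_rev]
  have h4 : (fun τ : ℝ => τ) =O[𝓝[>] 0] fun _ => (1 : ℝ) := hτ0.isBigO_one ℝ
  refine (((h4.mul (h2.trans h3)).congr_right fun τ => one_mul _).add h1).congr_left fun τ => ?_
  ring

end Quadratic

/-- On y' = 1, with the constant placed in the implicit or in the explicit part, the local error is
exactly τ(∑b - 1) or τ(∑b̄ - 1). This is O(τ^(p+1)) with p ≥ 1 only if the bracket vanishes. -/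
theorem HasOrder.sum_b (hT : T.HasOrder p) (hp : 1 ≤ p) : ∑ i, T.b i = 1 ∧ ∑ i, T.bbar i = 1 := by
  have aux : ∀ c : ℝ, (fun τ : ℝ => τ * c) =O[𝓝[>] 0] (fun τ : ℝ => τ ^ (p + 1)) → c = 0 := by
    intro c h
    have h1 : (fun τ : ℝ => c) =O[𝓝[>] 0] fun τ : ℝ => τ ^ p := by
      have h2 := ((isBigO_refl (fun τ : ℝ => τ⁻¹) (𝓝[>] 0)).mul h)
      refine h2.congr' ?_ ?_ <;> filter_upwards [self_mem_nhdsWithin] with τ hτ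
      · have : τ ≠ 0 := ne_of_gt hτ
        field_simp
      · have : τ ≠ 0 := ne_of_gt hτ
        field_simp
        ring
    have h3 : Tendsto (fun τ : ℝ => τ ^ p) (𝓝[>] 0) (𝓝 0) := by
      have : Tendsto (fun τ : ℝ => τ ^ p) (𝓝 0) (𝓝 (0 ^ p)) := (continuous_pow p).tendsto 0
      rw [zero_pow (by omega)] at this
      exact this.mono_left nhdsWithin_le_nhds
    exact tendsto_nhds_unique tendsto_const_nhds (h1.trans_tendsto h3)
  have hτ0 : Tendsto (fun τ : ℝ => τ) (𝓝[>] 0) (𝓝 0) := nhdsWithin_le_nhds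
  have hid : ∀ t : ℝ, HasDerivAt (fun t : ℝ => t) (1 : ℝ) t := fun t => hasDerivAt_id t
  constructor
  · have := hT.of_finiteDimensional (W := ℝ) (f := fun _ => 1) (g := fun _ => 0)
      contDiff_const contDiff_const (y := fun t => t)
      (Eventually.of_forall fun t => by simpa using hid t)
      (Y := fun τ i => τ * ∑ j, T.A i j) (Eventually.of_forall fun τ i => by simp)
      (fun i => by simpa using hτ0.mul_const (∑ j, T.A i j))
    have h := aux (∑ i, T.b i - 1) (this.congr_left fun τ => by simp; ring)
    linarith
  · have := hT.of_finiteDimensional (W := ℝ) (f := fun _ => 0) (g := fun _ => 1)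
      contDiff_const contDiff_const (y := fun t => t)
      (Eventually.of_forall fun t => by simpa using hid t)
      (Y := fun τ i => τ * ∑ j, T.Abar i j) (Eventually.of_forall fun τ i => by simp)
      (fun i => by simpa using hτ0.mul_const (∑ j, T.Abar i j))
    have h := aux (∑ i, T.bbar i - 1) (this.congr_left fun τ => by simp; ring)
    linarith

end IMEXTableau

/-! ### Smooth dependence of integrals on parameters, and Hadamard's lemma -/

section ParametricIntegral

universe u

/-- Differentiation under the integral sign for jointly smooth integrands over a bounded set. -/
theorem contDiff_nat_setIntegral {Y X : Type u} [NormedAddCommGroup Y] [NormedSpace ℝ Y]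
    [ProperSpace Y] [NormedAddCommGroup X] [NormedSpace ℝ X] [ProperSpace X] [MeasurableSpace X]
    [BorelSpace X] (μ : Measure X) [IsFiniteMeasureOnCompacts μ] {t : Set X}
    (ht : Bornology.IsBounded t) (n : ℕ) :
    ∀ {W : Type u} [NormedAddCommGroup W] [NormedSpace ℝ W] {φ : Y × X → W},
      ContDiff ℝ ∞ φ → ContDiff ℝ n fun y => ∫ x in t, φ (y, x) ∂μ := by
  have hK : IsCompact (closure t) := ht.isCompact_closure
  have hμ : μ t < ⊤ := (measure_mono subset_closure).trans_lt hK.measure_lt_top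
  have hae : ∀ᵐ x ∂μ.restrict t, x ∈ closure t :=
    ae_restrict_of_ae_restrict_of_subset subset_closure (ae_restrict_mem isClosed_closure.measurableSet)
  have : IsFiniteMeasure (μ.restrict t) := ⟨by simpa using hμ⟩
  have hder : ∀ {W : Type u} [NormedAddCommGroup W] [NormedSpace ℝ W] {φ : Y × X → W},
      ContDiff ℝ ∞ φ → ∃ φ' : Y × X → (Y →L[ℝ] W), ContDiff ℝ ∞ φ' ∧
        ∀ y, HasFDerivAt (fun y => ∫ x in t, φ (y, x) ∂μ) (∫ x in t, φ' (y, x) ∂μ) y := by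
    intro W _ _ φ hφ
    refine ⟨fun p => fderiv ℝ (fun y => φ (y, p.2)) p.1, ?_, fun y₀ => ?_⟩
    · refine ContDiff.fderiv (m := ∞) (f := fun (p : Y × X) y => φ (y, p.2)) ?_ contDiff_fst
        (by simp)
      exact hφ.comp (contDiff_snd.prodMk (contDiff_snd.comp contDiff_fst))
    · have hc : ContDiff ℝ ∞ fun p : Y × X => fderiv ℝ (fun y => φ (y, p.2)) p.1 := by
        refine ContDiff.fderiv (m := ∞) (f := fun (p : Y × X) y => φ (y, p.2)) ?_ contDiff_fst
          (by simp)
        exact hφ.comp (contDiff_snd.prodMk (contDiff_snd.comp contDiff_fst))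
      obtain ⟨C, hC⟩ := ((isCompact_closedBall y₀ 1).prod hK).exists_bound_of_continuousOn
        hc.continuous.continuousOn
      have hcont : ∀ y, Continuous fun x => φ (y, x) := fun y =>
        hφ.continuous.comp (Continuous.prodMk_right y)
      obtain ⟨C', hC'⟩ := hK.exists_bound_of_continuousOn (hcont y₀).continuousOn
      refine hasFDerivAt_integral_of_dominated_of_fderiv_le (bound := fun _ => C)
        (F' := fun y x => fderiv ℝ (fun y => φ (y, x)) y)
        (Metric.closedBall_mem_nhds y₀ one_pos)
        (Eventually.of_forall fun y => (hcont y).aestronglyMeasurable)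
        ?_ (hc.continuous.comp (Continuous.prodMk_right y₀)).aestronglyMeasurable ?_
        (integrable_const _) ?_
      · refine Integrable.of_bound (hcont y₀).aestronglyMeasurable C' ?_
        filter_upwards [hae] with x hx using hC' x hx
      · filter_upwards [hae] with x hx y hy using hC (y, x) ⟨hy, hx⟩
      · refine Eventually.of_forall fun x y _ => ?_
        have : ContDiff ℝ ∞ fun y => φ (y, x) := hφ.comp (contDiff_id.prodMk contDiff_const)
        exact ((this.differentiable (by simp)) y).hasFDerivAt
  -- Differentiating replaces the target W by Y →L[ℝ] W. This is why the statement quantifies over W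
  -- after n and keeps all the spaces in one universe.
  induction n with
  | zero =>
    intro W _ _ φ hφ
    obtain ⟨φ', -, h⟩ := hder hφ
    simpa using continuous_iff_continuousAt.2 fun y => (h y).continuousAt
  | succ n ih =>
    intro W _ _ φ hφ
    obtain ⟨φ', hφ', h⟩ := hder hφ
    push_cast
    exact contDiff_succ_iff_hasFDerivAt.2 ⟨_, ih hφ', h⟩

theorem ContDiff.setIntegral_param {Y X W : Type u} [NormedAddCommGroup Y] [NormedSpace ℝ Y]
    [ProperSpace Y] [NormedAddCommGroup X] [NormedSpace ℝ X] [ProperSpace X] [MeasurableSpace X]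
    [BorelSpace X] (μ : Measure X) [IsFiniteMeasureOnCompacts μ] {t : Set X}
    (ht : Bornology.IsBounded t) [NormedAddCommGroup W] [NormedSpace ℝ W] {φ : Y × X → W}
    (hφ : ContDiff ℝ ∞ φ) : ContDiff ℝ ∞ fun y => ∫ x in t, φ (y, x) ∂μ :=
  contDiff_infty.2 fun n => contDiff_nat_setIntegral μ ht n hφ

end ParametricIntegral

/-- Hadamard's lemma in the second variable. -/
theorem ContDiff.exists_hadamard {Φ : ℝ × ℝ → ℝ} (hΦ : ContDiff ℝ ∞ Φ) :
    ∃ H : ℝ × ℝ → ℝ, ContDiff ℝ ∞ H ∧ ∀ x y, Φ (x, y) = Φ (x, x) + (y - x) * H (x, y) := by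
  -- The quotient H is the integral over t in [0, 1] of the second partial derivative of Φ along the
  -- segment from (x, x) to (x, y). It is smooth by differentiation under the integral sign.
  let φ : (ℝ × ℝ) × ℝ → ℝ := fun q =>
    fderiv ℝ Φ (q.1.1, q.1.1 + q.2 * (q.1.2 - q.1.1)) (0, 1)
  have hφ : ContDiff ℝ ∞ φ := by
    have h1 : ContDiff ℝ ∞ (fderiv ℝ Φ) := hΦ.fderiv_right (by simp)
    have h2 : ContDiff ℝ ∞ fun q : (ℝ × ℝ) × ℝ => (q.1.1, q.1.1 + q.2 * (q.1.2 - q.1.1)) := by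
      fun_prop
    exact (h1.comp h2).clm_apply contDiff_const
  refine ⟨fun z => ∫ t in Set.Ioc (0 : ℝ) 1, φ (z, t),
    ContDiff.setIntegral_param volume (Metric.isBounded_Ioc 0 1) hφ, fun x y => ?_⟩
  have hd : ∀ t ∈ Set.uIcc (0 : ℝ) 1, HasDerivAt (fun t => Φ (x, x + t * (y - x)))
      ((y - x) * φ ((x, y), t)) t := by
    intro t _
    have h1 : HasDerivAt (fun t : ℝ => (x, x + t * (y - x))) (0, y - x) t := by
      refine (hasDerivAt_const t x).prodMk ?_
      simpa using ((hasDerivAt_id t).mul_const (y - x)).const_add x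
    have h2 := ((hΦ.differentiable (by simp)) (x, x + t * (y - x))).hasFDerivAt.comp_hasDerivAt t h1
    refine h2.congr_deriv ?_
    have : ((0 : ℝ), y - x) = (y - x) • ((0 : ℝ), (1 : ℝ)) := by simp
    rw [this, map_smul, smul_eq_mul]
  have hc : Continuous fun t => φ ((x, y), t) := hφ.continuous.comp (Continuous.prodMk_right _)
  have := intervalIntegral.integral_eq_sub_of_hasDerivAt hd
    ((continuous_const.mul hc).intervalIntegrable _ _)
  rw [intervalIntegral.integral_const_mul, intervalIntegral.integral_of_le zero_le_one] at this
  simp only [zero_mul, add_zero, one_mul, add_sub_cancel] at this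
  linarith

/-! ### Calculus of smooth periodic functions -/

namespace PhaseField

variable {d : ℕ} {P : PhaseField d} {v w : EuclideanSpace ℝ (Fin d) → ℝ}

/-- The partial derivative in the `i`-th coordinate. -/
noncomputable def pd (i : Fin d) (v : EuclideanSpace ℝ (Fin d) → ℝ) :
    EuclideanSpace ℝ (Fin d) → ℝ :=
  fun x => fderiv ℝ v x (EuclideanSpace.single i 1)

theorem contDiff_pd (hv : ContDiff ℝ ∞ v) (i : Fin d) : ContDiff ℝ ∞ (pd i v) :=
  (hv.fderiv_right (by simp)).clm_apply contDiff_const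

theorem lap_eq_sum (hv : ContDiff ℝ ∞ v) : lap v = ∑ i, pd i (pd i v) := by
  unfold lap
  rw [InnerProductSpace.laplacian_eq_iteratedFDeriv_orthonormalBasis v
    (EuclideanSpace.basisFun (Fin d) ℝ)]
  ext x
  rw [Finset.sum_apply]
  refine Finset.sum_congr rfl fun i _ => ?_
  have hd : DifferentiableAt ℝ (fderiv ℝ v) x :=
    (hv.fderiv_right (m := ∞) (by simp)).differentiable (by simp) x
  unfold pd
  rw [iteratedFDeriv_two_apply, fderiv_clm_apply hd (differentiableAt_const _)]
  simp [EuclideanSpace.basisFun_apply]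

theorem sum_pd_sq (v : EuclideanSpace ℝ (Fin d) → ℝ) (x : EuclideanSpace ℝ (Fin d)) :
    ‖gradient v x‖ ^ 2 = ∑ i, pd i v x ^ 2 := by
  rw [EuclideanSpace.norm_sq_eq]
  refine Finset.sum_congr rfl fun i _ => ?_
  have h1 : (gradient v x).ofLp i = inner ℝ (gradient v x) (EuclideanSpace.single i (1 : ℝ)) := by
    rw [EuclideanSpace.inner_single_right]; simp
  have h2 : inner ℝ (gradient v x) (EuclideanSpace.single i (1 : ℝ)) = pd i v x := by
    unfold gradient pd
    rw [InnerProductSpace.toDual_symm_apply]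
  rw [h1, h2, Real.norm_eq_abs, sq_abs]

theorem pd_mul (hv : ContDiff ℝ ∞ v) (hw : ContDiff ℝ ∞ w) (i : Fin d) :
    pd i (v * w) = pd i v * w + v * pd i w := by
  ext x
  have h := ((hv.differentiable (by simp) x).hasFDerivAt.mul
    (hw.differentiable (by simp) x).hasFDerivAt).fderiv
  simp only [pd, h, Pi.add_apply, Pi.mul_apply, add_apply,
    smul_apply, smul_eq_mul]
  ring

theorem contDiff_lap (hv : ContDiff ℝ ∞ v) : ContDiff ℝ ∞ (lap v) := by
  rw [lap_eq_sum hv]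
  have : (∑ i, pd i (pd i v)) = fun x => ∑ i, pd i (pd i v) x := by ext; simp
  rw [this]
  exact ContDiff.sum fun i _ => contDiff_pd (contDiff_pd hv i) i

theorem lap_add (hv : ContDiff ℝ ∞ v) (hw : ContDiff ℝ ∞ w) : lap (v + w) = lap v + lap w := by
  ext x
  exact (hv.of_le (by norm_cast)).contDiffAt.laplacian_add
    (hw.of_le (by norm_cast)).contDiffAt

theorem lap_smul (c : ℝ) (hv : ContDiff ℝ ∞ v) : lap (c • v) = c • lap v := by
  ext x
  exact InnerProductSpace.laplacian_smul c (hv.of_le (by norm_cast)).contDiffAt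

namespace SmoothPeriodic

theorem const (c : ℝ) : P.SmoothPeriodic fun _ => c := ⟨contDiff_const, fun _ _ => rfl⟩

theorem add (hv : P.SmoothPeriodic v) (hw : P.SmoothPeriodic w) : P.SmoothPeriodic (v + w) :=
  ⟨hv.1.add hw.1, fun i x => by simp [hv.2 i x, hw.2 i x]⟩

theorem mul (hv : P.SmoothPeriodic v) (hw : P.SmoothPeriodic w) : P.SmoothPeriodic (v * w) :=
  ⟨hv.1.mul hw.1, fun i x => by simp [hv.2 i x, hw.2 i x]⟩

theorem smul (c : ℝ) (hv : P.SmoothPeriodic v) : P.SmoothPeriodic (c • v) :=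
  ⟨hv.1.const_smul c, fun i x => by simp [hv.2 i x]⟩

theorem neg (hv : P.SmoothPeriodic v) : P.SmoothPeriodic (-v) :=
  ⟨hv.1.neg, fun i x => by simp [hv.2 i x]⟩

theorem sub (hv : P.SmoothPeriodic v) (hw : P.SmoothPeriodic w) : P.SmoothPeriodic (v - w) :=
  ⟨hv.1.sub hw.1, fun i x => by simp [hv.2 i x, hw.2 i x]⟩

theorem sum {ι : Type*} {t : Finset ι} {f : ι → EuclideanSpace ℝ (Fin d) → ℝ}
    (h : ∀ i ∈ t, P.SmoothPeriodic (f i)) : P.SmoothPeriodic (∑ i ∈ t, f i) := by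
  classical
  induction t using Finset.induction_on with
  | empty => exact const (P := P) 0
  | insert a t ha ih =>
    rw [Finset.sum_insert ha]
    exact (h a (by simp)).add (ih fun i hi => h i (by simp [hi]))

theorem comp {Φ : ℝ → ℝ} (hΦ : ContDiff ℝ ∞ Φ) (hv : P.SmoothPeriodic v) :
    P.SmoothPeriodic fun x => Φ (v x) :=
  ⟨hΦ.comp hv.1, fun i x => by simp [hv.2 i x]⟩

theorem pd (hv : P.SmoothPeriodic v) (i : Fin d) : P.SmoothPeriodic (pd i v) := by
  refine ⟨contDiff_pd hv.1 i, fun j x => ?_⟩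
  have h : (fun y => v (y + EuclideanSpace.single j (P.hi j - P.lo j))) = v :=
    funext fun y => hv.2 j y
  unfold PhaseField.pd
  rw [← fderiv_comp_add_right, h]

theorem lap (hv : P.SmoothPeriodic v) : P.SmoothPeriodic (lap v) := by
  rw [lap_eq_sum hv.1]
  exact sum fun i _ => (hv.pd i).pd i

theorem G (hv : P.SmoothPeriodic v) : P.SmoothPeriodic (P.G v) := by
  unfold PhaseField.G
  split
  · exact hv.neg
  · exact hv.lap

theorem L (hv : P.SmoothPeriodic v) : P.SmoothPeriodic (P.L v) :=
  ((hv.lap.smul _).neg).G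

end SmoothPeriodic

theorem contDiff_deriv_F (P : PhaseField d) : ContDiff ℝ ∞ (deriv P.F) :=
  (contDiff_infty_iff_deriv.1 P.F_smooth).2

theorem SmoothPeriodic.N (hv : P.SmoothPeriodic v) (r : ℝ) : P.SmoothPeriodic (P.N v r) :=
  ((SmoothPeriodic.comp P.contDiff_deriv_F hv).smul _).G

theorem G_smul (c : ℝ) (hv : ContDiff ℝ ∞ v) : P.G (c • v) = c • P.G v := by
  unfold PhaseField.G
  cases P.flow
  · simp only [smul_neg]
  · exact lap_smul c hv

/-! ### Integration over the box -/

theorem Ω_eq_preimage (P : PhaseField d) :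
    P.Ω = (fun x : EuclideanSpace ℝ (Fin d) => x.ofLp) ⁻¹'
      Set.univ.pi fun i => Set.Ioo (P.lo i) (P.hi i) := by
  ext x; simp [Ω]

theorem isBounded_Ω (P : PhaseField d) : Bornology.IsBounded P.Ω := by
  have h : Bornology.IsBounded (Set.Icc P.lo P.hi) := Metric.isBounded_Icc _ _
  have h2 := (EuclideanSpace.equiv (Fin d) ℝ).symm.lipschitz.isBounded_image h
  refine h2.subset fun x hx => ⟨x.ofLp, ⟨fun i => (hx i).1.le, fun i => (hx i).2.le⟩, by simp⟩

theorem volume_Ω_lt_top (P : PhaseField d) : volume P.Ω < ⊤ := P.isBounded_Ω.measure_lt_top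

theorem integrableOn_Ω (P : PhaseField d) (hv : Continuous v) : IntegrableOn v P.Ω :=
  (hv.continuousOn.integrableOn_compact P.isBounded_Ω.isCompact_closure).mono_set subset_closure

theorem integral_Ω_eq_pi (P : PhaseField d) (v : EuclideanSpace ℝ (Fin d) → ℝ) :
    ∫ x in P.Ω, v x = ∫ y in Set.Icc P.lo P.hi, v (WithLp.toLp 2 y) := by
  have h := (PiLp.volume_preserving_toLp (Fin d)).setIntegral_preimage_emb
    (MeasurableEquiv.toLp 2 (Fin d → ℝ)).measurableEmbedding v P.Ω
  rw [← h, volume_pi, ← setIntegral_congr_set (Measure.univ_pi_Ioo_ae_eq_Icc)]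
  congr 2
  rw [Ω_eq_preimage]
  ext y; simp

/-- The divergence theorem is applied to the field whose only nonzero component is v in direction i.
Its integrals over the two faces orthogonal to that direction cancel by periodicity. -/
theorem integral_pd_eq_zero (hv : P.SmoothPeriodic v) (i : Fin d) : ∫ x in P.Ω, pd i v x = 0 := by
  rw [integral_Ω_eq_pi]
  obtain _ | n := d
  · exact i.elim0
  let e := (EuclideanSpace.equiv (Fin (n + 1)) ℝ).symm
  have hder : ∀ y, HasFDerivAt (fun y : Fin (n + 1) → ℝ => v (e y))
      ((fderiv ℝ v (e y)).comp (e : (Fin (n + 1) → ℝ) →L[ℝ] _)) y := fun y =>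
    ((hv.1.differentiable (by simp)) (e y)).hasFDerivAt.comp y e.hasFDerivAt
  have hcont : Continuous fun y : Fin (n + 1) → ℝ => v (e y) := hv.1.continuous.comp e.continuous
  have hsum : ∀ y, ∑ j, (if j = i then (fderiv ℝ v (e y)).comp (e : (Fin (n + 1) → ℝ) →L[ℝ] _)
      else 0) (Pi.single j 1) = pd i v (WithLp.toLp 2 y) := fun y => by
    rw [Finset.sum_eq_single i (fun j _ hj => by simp [hj]) (by simp)]
    simp [pd, e]
  have key := integral_divergence_of_hasFDerivAt_off_countable' P.lo P.hi
    (fun i => (P.lo_lt_hi i).le) (fun j y => if j = i then v (e y) else 0)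
    (fun j y => if j = i then (fderiv ℝ v (e y)).comp (e : (Fin (n + 1) → ℝ) →L[ℝ] _) else 0)
    ∅ Set.countable_empty (fun j => by
      by_cases h : j = i
      · simpa [h] using hcont.continuousOn
      · simpa [h] using continuousOn_const) (fun y _ j => by
      by_cases h : j = i
      · simpa [h] using hder y
      · simpa [h] using hasFDerivAt_const (0 : ℝ) y) (by
      simp_rw [hsum]
      exact ((contDiff_pd hv.1 i).continuous.comp e.continuous).continuousOn.integrableOn_compact
        isCompact_Icc)
  simp_rw [hsum] at key
  rw [key]
  refine Finset.sum_eq_zero fun j _ => ?_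
  by_cases h : j = i
  · subst h
    simp only [if_true]
    rw [sub_eq_zero]
    congr 1
    ext y
    rw [← hv.2 j (e (j.insertNth (P.lo j) y))]
    congr 1
    ext k
    refine Fin.succAboveCases j ?_ (fun k => ?_) k
    · simp [e]
    · simp [e]
  · simp [h]

theorem SmoothPeriodic.integrable_mul (hv : P.SmoothPeriodic v) (hw : P.SmoothPeriodic w) :
    Integrable (fun x => v x * w x) (volume.restrict P.Ω) :=
  P.integrableOn_Ω (hv.mul hw).1.continuous

theorem inner2_add_left (hv : P.SmoothPeriodic v) (hw : P.SmoothPeriodic w)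
    {z : EuclideanSpace ℝ (Fin d) → ℝ} (hz : P.SmoothPeriodic z) :
    P.inner2 (v + w) z = P.inner2 v z + P.inner2 w z := by
  unfold inner2
  rw [← integral_add (hv.integrable_mul hz) (hw.integrable_mul hz)]
  simp [add_mul]

theorem inner2_comm (P : PhaseField d) (v w : EuclideanSpace ℝ (Fin d) → ℝ) :
    P.inner2 v w = P.inner2 w v := by
  simp [inner2, mul_comm]

theorem inner2_smul_left (P : PhaseField d) (c : ℝ) (v w : EuclideanSpace ℝ (Fin d) → ℝ) :
    P.inner2 (c • v) w = c * P.inner2 v w := by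
  unfold inner2
  rw [← integral_const_mul]
  simp [mul_assoc]

/-- Green's identity without boundary terms: each ∂ᵢ(v ∂ᵢw) is the derivative of a periodic function
and integrates to zero. The symmetry of the energy form rests on this. -/
theorem inner2_lap (hv : P.SmoothPeriodic v) (hw : P.SmoothPeriodic w) :
    P.inner2 v (lap w) = -∫ x in P.Ω, ∑ i, pd i v x * pd i w x := by
  have h0 : ∀ i, ∫ x in P.Ω, (pd i v x * pd i w x + v x * pd i (pd i w) x) = 0 := fun i => by
    have := integral_pd_eq_zero (hv.mul (hw.pd i)) i
    rw [pd_mul hv.1 (hw.pd i).1] at this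
    simpa using this
  have h1 : ∀ i, ∫ x in P.Ω, v x * pd i (pd i w) x = -∫ x in P.Ω, pd i v x * pd i w x := fun i => by
    have := h0 i
    rw [integral_add ((hv.pd i).integrable_mul (hw.pd i))
      (hv.integrable_mul ((hw.pd i).pd i))] at this
    linarith
  unfold inner2
  rw [lap_eq_sum hw.1]
  simp only [Finset.sum_apply, Finset.mul_sum]
  rw [integral_finsetSum _ fun i _ => hv.integrable_mul ((hw.pd i).pd i),
    integral_finsetSum _ fun i _ => (hv.pd i).integrable_mul (hw.pd i),
    ← Finset.sum_neg_distrib]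
  exact Finset.sum_congr rfl fun i _ => h1 i

theorem gradSq_eq (hv : P.SmoothPeriodic v) : P.gradSq v = -P.inner2 v (lap v) := by
  rw [inner2_lap hv hv, neg_neg]
  unfold gradSq
  simp_rw [sum_pd_sq v, sq]

theorem inner2_lap_comm (hv : P.SmoothPeriodic v) (hw : P.SmoothPeriodic w) :
    P.inner2 v (lap w) = P.inner2 w (lap v) := by
  rw [inner2_lap hv hw, inner2_lap hw hv]
  simp_rw [mul_comm]

end PhaseField

/-! ### Plane waves and their superpositions -/

section Waves

variable {d : ℕ}

/-- The real part of `c * exp (i θ)`. -/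
noncomputable def phase (c : ℂ) (θ : ℝ) : ℝ := (c * Complex.exp (Complex.I * θ)).re

theorem hasDerivAt_phase (c : ℂ) (θ : ℝ) : HasDerivAt (phase c) (phase (c * Complex.I) θ) θ := by
  have h1 : HasDerivAt (fun t : ℝ => Complex.I * (t : ℂ)) (Complex.I * 1) θ :=
    (Complex.ofRealCLM.hasDerivAt (x := θ)).const_mul Complex.I
  have h2 := (h1.cexp).const_mul c
  have h3 := Complex.reCLM.hasFDerivAt.comp_hasDerivAt θ h2
  refine h3.congr_deriv ?_
  simp only [phase, Complex.reCLM_apply]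
  congr 1
  ring

theorem deriv_phase (c : ℂ) : deriv (phase c) = phase (c * Complex.I) :=
  funext fun θ => (hasDerivAt_phase c θ).deriv

theorem contDiff_phase (c : ℂ) : ContDiff ℝ ∞ (phase c) := by
  refine Complex.reCLM.contDiff.comp (contDiff_const.mul ?_)
  exact Complex.contDiff_exp.comp (contDiff_const.mul Complex.ofRealCLM.contDiff)

theorem iteratedDeriv_phase (n : ℕ) (c : ℂ) :
    iteratedDeriv n (phase c) = phase (c * Complex.I ^ n) := by
  induction n with
  | zero => simp
  | succ n ih => rw [iteratedDeriv_succ, ih, deriv_phase, pow_succ, mul_assoc]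

theorem abs_phase_le (c : ℂ) (θ : ℝ) : |phase c θ| ≤ ‖c‖ := by
  refine (Complex.abs_re_le_norm _).trans ?_
  rw [norm_mul, mul_comm Complex.I, Complex.norm_exp_ofReal_mul_I, mul_one]

/-- The real plane wave with amplitude `c` and wave vector `k`. -/
noncomputable def wave (c : ℂ) (k : EuclideanSpace ℝ (Fin d)) : EuclideanSpace ℝ (Fin d) → ℝ :=
  fun x => phase c (inner ℝ k x)

theorem wave_eq_comp (c : ℂ) (k : EuclideanSpace ℝ (Fin d)) :
    wave c k = phase c ∘ (innerSL ℝ k) := by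
  ext x; simp [wave]

theorem contDiff_wave (c : ℂ) (k : EuclideanSpace ℝ (Fin d)) : ContDiff ℝ ∞ (wave c k) := by
  rw [wave_eq_comp]
  exact (contDiff_phase c).comp (innerSL ℝ k).contDiff

/-- A plane wave is a function of one variable composed with the functional ⟨k, ·⟩. Each derivative
thus costs a factor ‖k‖, while the amplitude changes only by a factor of modulus one. -/
theorem norm_iteratedFDeriv_wave_le (c : ℂ) (k : EuclideanSpace ℝ (Fin d)) (n : ℕ)
    (x : EuclideanSpace ℝ (Fin d)) : ‖iteratedFDeriv ℝ n (wave c k) x‖ ≤ ‖c‖ * ‖k‖ ^ n := by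
  rw [wave_eq_comp, (innerSL ℝ k).iteratedFDeriv_comp_right (contDiff_phase c) x
    (by exact_mod_cast le_top)]
  refine (ContinuousMultilinearMap.norm_compContinuousLinearMap_le _ _).trans ?_
  rw [norm_iteratedFDeriv_eq_norm_iteratedDeriv, iteratedDeriv_phase]
  simp only [innerSL_apply_norm, Finset.prod_const, Finset.card_univ, Fintype.card_fin]
  gcongr
  refine (abs_phase_le _ _).trans ?_
  simp

theorem pd_wave (i : Fin d) (c : ℂ) (k : EuclideanSpace ℝ (Fin d)) :
    PhaseField.pd i (wave c k) = wave (c * Complex.I * k i) k := by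
  ext x
  have h := (hasDerivAt_phase c (innerSL ℝ k x)).comp_hasFDerivAt x (innerSL ℝ k).hasFDerivAt
  have h2 : HasFDerivAt (wave c k) (phase (c * Complex.I) (innerSL ℝ k x) • innerSL ℝ k) x := by
    rw [wave_eq_comp]; exact h
  unfold PhaseField.pd
  rw [h2.fderiv]
  simp only [smul_apply, innerSL_apply_apply, EuclideanSpace.inner_single_right, smul_eq_mul,
    wave, phase, one_mul]
  rw [show c * Complex.I * (k i : ℂ) * Complex.exp (Complex.I * (inner ℝ k x : ℝ)) =
    (c * Complex.I * Complex.exp (Complex.I * (inner ℝ k x : ℝ))) * (k i : ℝ) by ring,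
    Complex.re_mul_ofReal]
  simp

theorem wave_add (a b : ℂ) (k x : EuclideanSpace ℝ (Fin d)) :
    wave (a + b) k x = wave a k x + wave b k x := by
  simp [wave, phase, add_mul]

theorem wave_ofReal_mul (r : ℝ) (a : ℂ) (k x : EuclideanSpace ℝ (Fin d)) :
    wave (r * a) k x = r * wave a k x := by
  simp [wave, phase, mul_assoc]

theorem abs_wave_le (c : ℂ) (k x : EuclideanSpace ℝ (Fin d)) : |wave c k x| ≤ ‖c‖ :=
  abs_phase_le _ _

theorem lap_wave (c : ℂ) (k : EuclideanSpace ℝ (Fin d)) :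
    PhaseField.lap (wave c k) = wave (((-‖k‖ ^ 2 : ℝ) : ℂ) * c) k := by
  rw [PhaseField.lap_eq_sum (contDiff_wave c k)]
  ext x
  simp_rw [pd_wave, Finset.sum_apply]
  have h : ∀ i, c * Complex.I * (k i : ℂ) * Complex.I * (k i : ℂ) = ((-(k i) ^ 2 : ℝ) : ℂ) * c := by
    intro i
    push_cast
    linear_combination (c * (k i : ℂ) ^ 2) * Complex.I_sq
  simp_rw [h, wave_ofReal_mul, ← Finset.sum_mul, EuclideanSpace.norm_sq_eq, Real.norm_eq_abs,
    sq_abs]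
  simp

variable {α : Type*} {c : α → ℂ} {k : α → EuclideanSpace ℝ (Fin d)}

theorem contDiff_tsum_wave (h : ∀ n : ℕ, Summable fun a => ‖c a‖ * ‖k a‖ ^ n) :
    ContDiff ℝ ∞ fun x => ∑' a, wave (c a) (k a) x :=
  contDiff_tsum (N := ⊤) (fun a => contDiff_wave (c a) (k a)) (fun n _ => h n)
    fun n a x _ => norm_iteratedFDeriv_wave_le (c a) (k a) n x

theorem iteratedFDeriv_tsum_wave (h : ∀ n : ℕ, Summable fun a => ‖c a‖ * ‖k a‖ ^ n) (n : ℕ)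
    (x : EuclideanSpace ℝ (Fin d)) :
    iteratedFDeriv ℝ n (fun x => ∑' a, wave (c a) (k a) x) x =
      ∑' a, iteratedFDeriv ℝ n (wave (c a) (k a)) x :=
  iteratedFDeriv_tsum_apply (N := ⊤) (fun a => contDiff_wave (c a) (k a)) (fun n _ => h n)
    (fun n a x _ => norm_iteratedFDeriv_wave_le (c a) (k a) n x) le_top x

theorem norm_iteratedFDeriv_tsum_wave_le (h : ∀ n : ℕ, Summable fun a => ‖c a‖ * ‖k a‖ ^ n)
    (n : ℕ) (x : EuclideanSpace ℝ (Fin d)) :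
    ‖iteratedFDeriv ℝ n (fun x => ∑' a, wave (c a) (k a) x) x‖ ≤ ∑' a, ‖c a‖ * ‖k a‖ ^ n := by
  rw [iteratedFDeriv_tsum_wave h]
  exact tsum_of_norm_bounded (h n).hasSum fun a => norm_iteratedFDeriv_wave_le (c a) (k a) n x

theorem lap_tsum_wave (h : ∀ n : ℕ, Summable fun a => ‖c a‖ * ‖k a‖ ^ n) :
    PhaseField.lap (fun x => ∑' a, wave (c a) (k a) x) =
      fun x => ∑' a, wave (((-‖k a‖ ^ 2 : ℝ) : ℂ) * c a) (k a) x := by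
  ext x
  unfold PhaseField.lap
  rw [InnerProductSpace.laplacian_eq_iteratedFDeriv_orthonormalBasis _
    (EuclideanSpace.basisFun (Fin d) ℝ)]
  have hs : Summable fun a => iteratedFDeriv ℝ 2 (wave (c a) (k a)) x :=
    Summable.of_norm_bounded (h 2) fun a => norm_iteratedFDeriv_wave_le (c a) (k a) 2 x
  simp_rw [iteratedFDeriv_tsum_wave h, ContinuousMultilinearMap.tsum_eval hs]
  rw [← Summable.tsum_finsetSum fun i _ => (ContinuousMultilinearMap.hasSum_eval hs.hasSum _).summable]
  refine tsum_congr fun a => ?_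
  rw [← lap_wave]
  unfold PhaseField.lap
  rw [InnerProductSpace.laplacian_eq_iteratedFDeriv_orthonormalBasis _
    (EuclideanSpace.basisFun (Fin d) ℝ)]

end Waves

/-! ### Fourier series on the box -/

theorem summable_prod_apply {d : ℕ} {f : Fin d → ℤ → ℝ} (h0 : ∀ i n, 0 ≤ f i n)
    (hf : ∀ i, Summable (f i)) : Summable fun n : Fin d → ℤ => ∏ i, f i (n i) := by
  induction d with
  | zero => exact .of_finite
  | succ d ih =>
    rw [← (Fin.consEquiv fun _ => ℤ).summable_iff]
    have := (hf 0).mul_of_nonneg (ih (f := fun i => f i.succ) (fun i => h0 _) fun i => hf _) (h0 0)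
      fun n => Finset.prod_nonneg fun i _ => h0 _ _
    refine this.congr fun n => ?_
    simp [Fin.prod_univ_succ, Fin.consEquiv]

theorem summable_inv_one_add_sq {a : ℝ} (ha : a ≠ 0) :
    Summable fun n : ℤ => (1 + (a * n) ^ 2)⁻¹ := by
  have h : Summable fun n : ℤ => (a ^ 2)⁻¹ * (1 / (n : ℝ) ^ 2) :=
    (Real.summable_one_div_int_pow.2 one_lt_two).mul_left _
  -- The comparison fails only at n = 0, where the majorant is zero because 1 / 0 = 0.
  refine Summable.of_norm_bounded_eventually h ?_
  have hfin : {n : ℤ | n = 0}.Finite := by simp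
  refine hfin.subset fun n hn => ?_
  by_contra h0
  refine hn ?_
  have hn0 : (n : ℝ) ≠ 0 := by exact_mod_cast h0
  change ‖(1 + (a * (n : ℝ)) ^ 2)⁻¹‖ ≤ (a ^ 2)⁻¹ * (1 / (n : ℝ) ^ 2)
  rw [Real.norm_of_nonneg (by positivity), one_div, ← mul_inv, mul_pow]
  have : 0 < a ^ 2 * (n : ℝ) ^ 2 := by positivity
  gcongr
  linarith

namespace PhaseField

variable {d : ℕ} {P : PhaseField d} {v w : EuclideanSpace ℝ (Fin d) → ℝ}

/-- The wave vectors of the periodic box. -/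
noncomputable def freq (P : PhaseField d) (n : Fin d → ℤ) : EuclideanSpace ℝ (Fin d) :=
  WithLp.toLp 2 fun i => 2 * Real.pi / (P.hi i - P.lo i) * n i

/-- The product over the coordinates of 1 + kᵢ² is at most (1 + ‖k‖²)^d, so the sum is dominated by
a product of convergent one-dimensional sums. The exponent d reappears as the number of factors 1 -
Δ spent on summability. -/
theorem summable_freq (P : PhaseField d) :
    Summable fun n : Fin d → ℤ => ((1 + ‖P.freq n‖ ^ 2) ^ d)⁻¹ := by
  have h := summable_prod_apply (d := d)
    (f := fun i n => (1 + (2 * Real.pi / (P.hi i - P.lo i) * n) ^ 2)⁻¹)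
    (fun i n => by positivity) (fun i => summable_inv_one_add_sq (by
      have := P.lo_lt_hi i
      have : P.hi i - P.lo i ≠ 0 := by linarith
      positivity))
  refine Summable.of_nonneg_of_le (fun n => by positivity) (fun n => ?_) h
  rw [Finset.prod_inv_distrib]
  have h1 : ∀ i, 1 + (2 * Real.pi / (P.hi i - P.lo i) * n i) ^ 2 ≤ 1 + ‖P.freq n‖ ^ 2 := by
    intro i
    rw [EuclideanSpace.norm_sq_eq]
    have := Finset.single_le_sum (f := fun j => ‖(P.freq n).ofLp j‖ ^ 2)
      (fun j _ => by positivity) (Finset.mem_univ i)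
    simp only [Real.norm_eq_abs, sq_abs] at this ⊢
    simpa only [freq, add_le_add_iff_left] using this
  have h2 : ∏ i, (1 + (2 * Real.pi / (P.hi i - P.lo i) * n i) ^ 2) ≤ (1 + ‖P.freq n‖ ^ 2) ^ d := by
    calc _ ≤ ∏ _i : Fin d, (1 + ‖P.freq n‖ ^ 2) :=
          Finset.prod_le_prod (fun i _ => by positivity) fun i _ => h1 i
      _ = _ := by simp
  have h3 : 0 < ∏ i, (1 + (2 * Real.pi / (P.hi i - P.lo i) * (n i : ℝ)) ^ 2) :=
    Finset.prod_pos fun i _ => by positivity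
  gcongr

theorem SmoothPeriodic.apply_add_lattice (hv : P.SmoothPeriodic v) (m : Fin d → ℤ)
    (x : EuclideanSpace ℝ (Fin d)) :
    v (x + ∑ i, m i • EuclideanSpace.single i (P.hi i - P.lo i)) = v x := by
  classical
  have h : ∀ t : Finset (Fin d), Function.Periodic v
      (∑ i ∈ t, m i • EuclideanSpace.single i (P.hi i - P.lo i)) := by
    intro t
    induction t using Finset.induction_on with
    | empty => intro x; simp
    | insert a t ha ih =>
      rw [Finset.sum_insert ha]
      have h1 : Function.Periodic v (EuclideanSpace.single a (P.hi a - P.lo a)) := hv.2 a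
      exact (h1.zsmul _).add_period ih
  exact h _ x

/-- The affine-linear chart from the unit cube. -/
noncomputable def scale (P : PhaseField d) (t : Fin d → ℝ) : EuclideanSpace ℝ (Fin d) :=
  WithLp.toLp 2 fun i => (P.hi i - P.lo i) * t i

theorem continuous_scale (P : PhaseField d) : Continuous P.scale := by
  unfold scale
  fun_prop

theorem scale_surjective (P : PhaseField d) : Function.Surjective P.scale := fun x => by
  refine ⟨fun i => x i / (P.hi i - P.lo i), ?_⟩
  ext i
  have : P.hi i - P.lo i ≠ 0 := by linarith [P.lo_lt_hi i]
  simp only [scale]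
  field_simp

theorem scale_add (P : PhaseField d) (s t : Fin d → ℝ) :
    P.scale (s + t) = P.scale s + P.scale t := by
  ext i; simp [scale, mul_add]

/-- The function on the torus induced by a periodic function. -/
noncomputable def torusLift (P : PhaseField d) (v : EuclideanSpace ℝ (Fin d) → ℝ) :
    UnitAddTorus (Fin d) → ℂ :=
  fun q => (v (P.scale fun i => (q i).out) : ℂ)

/-- The representatives chosen in `torusLift` differ from t by integers, and after scaling these are
lattice vectors, under which v is invariant. -/
theorem torusLift_coe (hv : P.SmoothPeriodic v) (t : Fin d → ℝ) :
    P.torusLift v (fun i => (t i : UnitAddCircle)) = v (P.scale t) := by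
  have h : ∀ i, ∃ m : ℤ, Quotient.out (t i : UnitAddCircle) = t i + m := fun i => by
    have h1 : ((Quotient.out (t i : UnitAddCircle) - t i : ℝ) : UnitAddCircle) = 0 := by
      rw [AddCircle.coe_sub, sub_eq_zero]
      exact Quotient.out_eq _
    obtain ⟨m, hm⟩ := (AddCircle.coe_eq_zero_iff 1).1 h1
    exact ⟨m, by simp at hm; linarith⟩
  choose m hm using h
  unfold torusLift
  rw [← hv.apply_add_lattice m (P.scale t)]
  congr 2
  ext j
  simp only [scale, hm]
  simp [WithLp.ofLp_sum, Finset.sum_apply, Pi.single_apply]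
  ring

theorem exists_coe_eq (q : UnitAddTorus (Fin d)) :
    ∃ t : Fin d → ℝ, (fun i => (t i : UnitAddCircle)) = q :=
  ⟨fun i => (q i).out, funext fun _ => Quotient.out_eq _⟩

theorem continuous_torusLift (hv : P.SmoothPeriodic v) : Continuous (P.torusLift v) := by
  have hq : IsOpenQuotientMap (Pi.map fun (_ : Fin d) (t : ℝ) => (t : UnitAddCircle)) :=
    IsOpenQuotientMap.piMap fun _ => QuotientAddGroup.isOpenQuotientMap_mk
  rw [hq.isQuotientMap.continuous_iff]
  have : P.torusLift v ∘ (Pi.map fun (_ : Fin d) (t : ℝ) => (t : UnitAddCircle)) =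
      fun t => (v (P.scale t) : ℂ) := funext fun t => torusLift_coe hv t
  rw [this]
  exact Complex.continuous_ofReal.comp (hv.1.continuous.comp P.continuous_scale)

theorem SmoothPeriodic.exists_bound (hv : P.SmoothPeriodic v) : ∃ M, ∀ x, |v x| ≤ M := by
  obtain ⟨M, hM⟩ := isCompact_univ.exists_bound_of_continuousOn
    (continuous_torusLift hv).continuousOn
  refine ⟨M, fun x => ?_⟩
  obtain ⟨t, rfl⟩ := P.scale_surjective x
  have := hM (fun i => (t i : UnitAddCircle)) (Set.mem_univ _)
  rwa [torusLift_coe hv, Complex.norm_real] at this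

/-- The normalized Haar measure of the torus. -/
noncomputable def torusMeasure (d : ℕ) : Measure (UnitAddTorus (Fin d)) :=
  Measure.pi fun _ => AddCircle.haarAddCircle

instance : IsProbabilityMeasure (torusMeasure d) := by
  unfold torusMeasure; infer_instance

instance : (torusMeasure d).IsAddHaarMeasure := by
  unfold torusMeasure; infer_instance

/-- The Fourier coefficients of a periodic function. -/
noncomputable def fcoeff (P : PhaseField d) (v : EuclideanSpace ℝ (Fin d) → ℝ)
    (n : Fin d → ℤ) : ℂ :=
  UnitAddTorus.mFourierCoeff (P.torusLift v) n

theorem fcoeff_eq (P : PhaseField d) (v : EuclideanSpace ℝ (Fin d) → ℝ) (n : Fin d → ℤ) :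
    P.fcoeff v n =
      ∫ q, UnitAddTorus.mFourier (-n) q * P.torusLift v q ∂(torusMeasure d) := rfl

theorem integrable_torus {f : UnitAddTorus (Fin d) → ℂ} (hf : Continuous f) :
    Integrable f (torusMeasure d) := by
  obtain ⟨M, hM⟩ := isCompact_univ.exists_bound_of_continuousOn hf.continuousOn
  exact Integrable.of_bound hf.aestronglyMeasurable M
    (Eventually.of_forall fun q => hM q (Set.mem_univ _))

theorem norm_fcoeff_le {M : ℝ} (hM : ∀ x, |v x| ≤ M) (n : Fin d → ℤ) : ‖P.fcoeff v n‖ ≤ M := by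
  rw [fcoeff_eq]
  refine (norm_integral_le_of_norm_le_const (C := M) (Eventually.of_forall fun q => ?_)).trans ?_
  · rw [norm_mul, torusLift, Complex.norm_real]
    have h1 : ‖UnitAddTorus.mFourier (-n) q‖ ≤ 1 := by
      have := (UnitAddTorus.mFourier (-n)).norm_coe_le_norm q
      rwa [UnitAddTorus.mFourier_norm] at this
    exact (mul_le_of_le_one_left (norm_nonneg _) h1).trans (hM _)
  · simp

theorem fcoeff_add (hv : P.SmoothPeriodic v) (hw : P.SmoothPeriodic w) (n : Fin d → ℤ) :
    P.fcoeff (v + w) n = P.fcoeff v n + P.fcoeff w n := by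
  simp only [fcoeff_eq]
  rw [← integral_add]
  · simp [torusLift, mul_add]
  · exact integrable_torus ((map_continuous _).mul (continuous_torusLift hv))
  · exact integrable_torus ((map_continuous _).mul (continuous_torusLift hw))

theorem fcoeff_smul (r : ℝ) (v : EuclideanSpace ℝ (Fin d) → ℝ) (n : Fin d → ℤ) :
    P.fcoeff (r • v) n = r * P.fcoeff v n := by
  simp only [fcoeff_eq]
  rw [← integral_const_mul]
  congr 1
  ext q
  simp [torusLift]
  ring

theorem mFourier_add_apply (n : Fin d → ℤ) (x y : UnitAddTorus (Fin d)) :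
    UnitAddTorus.mFourier n (x + y) = UnitAddTorus.mFourier n x * UnitAddTorus.mFourier n y := by
  simp [UnitAddTorus.mFourier, fourier_apply, smul_add, AddCircle.toCircle_add,
    Finset.prod_mul_distrib]

theorem mFourier_coe (n : Fin d → ℤ) (t : Fin d → ℝ) :
    UnitAddTorus.mFourier n (fun i => (t i : UnitAddCircle)) =
      Complex.exp (Complex.I * (inner ℝ (P.freq n) (P.scale t) : ℝ)) := by
  simp only [UnitAddTorus.mFourier, ContinuousMap.coe_mk, fourier_coe_apply, ← Complex.exp_sum]
  congr 1
  simp only [freq, scale, PiLp.inner_apply, Complex.ofReal_sum, Finset.mul_sum]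
  refine Finset.sum_congr rfl fun i _ => ?_
  have : ((P.hi i - P.lo i : ℝ) : ℂ) ≠ 0 := by
    have := P.lo_lt_hi i
    exact_mod_cast (by linarith : P.hi i - P.lo i ≠ 0)
  simp
  push_cast at this
  field_simp

theorem SmoothPeriodic.translate (hv : P.SmoothPeriodic v) (a : EuclideanSpace ℝ (Fin d)) :
    P.SmoothPeriodic fun x => v (x + a) :=
  ⟨hv.1.comp (contDiff_id.add contDiff_const), fun i x => by
    change v (x + _ + a) = v (x + a)
    rw [add_right_comm, hv.2]⟩

/-- Invariance of Haar measure moves the translation onto the character, which contributes a phase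
factor. -/
theorem fcoeff_translate (hv : P.SmoothPeriodic v) (n : Fin d → ℤ) (t : Fin d → ℝ) :
    P.fcoeff (fun x => v (x + P.scale t)) n =
      Complex.exp (Complex.I * (inner ℝ (P.freq n) (P.scale t) : ℝ)) * P.fcoeff v n := by
  have hvt := hv.translate (P.scale t)
  rw [fcoeff_eq, fcoeff_eq, ← mFourier_coe]
  set a : UnitAddTorus (Fin d) := fun i => (t i : UnitAddCircle)
  have h1 : ∀ q, P.torusLift (fun x => v (x + P.scale t)) q = P.torusLift v (q + a) := by
    intro q
    obtain ⟨s, rfl⟩ := exists_coe_eq q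
    rw [torusLift_coe hvt, ← scale_add, ← torusLift_coe hv]
    rfl
  simp_rw [h1]
  rw [← integral_const_mul, ← integral_add_right_eq_self (μ := torusMeasure d)
    (fun q => UnitAddTorus.mFourier n a * (UnitAddTorus.mFourier (-n) q * P.torusLift v q)) a]
  congr 1
  ext q
  rw [mFourier_add_apply]
  have h2 : UnitAddTorus.mFourier n a * UnitAddTorus.mFourier (-n) a = 1 := by
    rw [← UnitAddTorus.mFourier_add, add_neg_cancel, UnitAddTorus.mFourier_zero]; rfl
  linear_combination (-UnitAddTorus.mFourier (-n) q * P.torusLift v (q + a)) * h2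

/-- The coefficient of the translate of v by h in direction i is computed in two ways:
differentiating under the integral at h = 0 gives the coefficient of the partial derivative,
differentiating the phase factor of `fcoeff_translate` gives the factor i kᵢ. No integration by
parts on the torus is needed. -/
theorem fcoeff_pd (hv : P.SmoothPeriodic v) (i : Fin d) (n : Fin d → ℤ) :
    P.fcoeff (pd i v) n = Complex.I * P.freq n i * P.fcoeff v n := by
  obtain ⟨M, hM⟩ := (hv.pd i).exists_bound
  let e : EuclideanSpace ℝ (Fin d) := EuclideanSpace.single i 1
  have hsmall : ∀ h : ℝ, P.SmoothPeriodic fun x => v (x + h • e) := fun h => hv.translate _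
  have hder : ∀ (x : EuclideanSpace ℝ (Fin d)) (h : ℝ),
      HasDerivAt (fun h : ℝ => v (x + h • e)) (pd i v (x + h • e)) h := fun x h => by
    have h1 : HasDerivAt (fun h : ℝ => x + h • e) e h := by
      simpa using ((hasDerivAt_id h).smul_const e).const_add x
    exact ((hv.1.differentiable (by simp)) (x + h • e)).hasFDerivAt.comp_hasDerivAt h h1
  have key := (hasDerivAt_integral_of_dominated_loc_of_deriv_le (μ := torusMeasure d)
    (F := fun (h : ℝ) q => UnitAddTorus.mFourier (-n) q * P.torusLift (fun x => v (x + h • e)) q)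
    (F' := fun (h : ℝ) q => UnitAddTorus.mFourier (-n) q *
      P.torusLift (fun x => pd i v (x + h • e)) q) (x₀ := 0) (bound := fun _ => M)
    (s := Set.univ) univ_mem
    (Eventually.of_forall fun h =>
      ((map_continuous _).mul (continuous_torusLift (hsmall h))).aestronglyMeasurable)
    (integrable_torus ((map_continuous _).mul (continuous_torusLift (hsmall 0))))
    (by
      simp only [zero_smul, add_zero]
      exact ((map_continuous _).mul (continuous_torusLift (hv.pd i))).aestronglyMeasurable)
    (Eventually.of_forall fun q h _ => by
      rw [norm_mul, torusLift, Complex.norm_real]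
      have h1 : ‖UnitAddTorus.mFourier (-n) q‖ ≤ 1 := by
        have := (UnitAddTorus.mFourier (-n)).norm_coe_le_norm q
        rwa [UnitAddTorus.mFourier_norm] at this
      exact (mul_le_of_le_one_left (norm_nonneg _) h1).trans (hM _))
    (integrable_const _)
    (Eventually.of_forall fun q h _ => by
      refine HasDerivAt.const_mul _ ?_
      exact (hder _ h).ofReal_comp)).2
  simp only [zero_smul, add_zero] at key
  have h2 : ∀ h : ℝ, (∫ q, UnitAddTorus.mFourier (-n) q *
      P.torusLift (fun x => v (x + h • e)) q ∂(torusMeasure d)) =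
      Complex.exp (Complex.I * (h * P.freq n i : ℝ)) * P.fcoeff v n := by
    intro h
    obtain ⟨t, ht⟩ := P.scale_surjective (h • e)
    rw [← ht, ← fcoeff_eq, fcoeff_translate hv, ht, inner_smul_right,
      EuclideanSpace.inner_single_right]
    simp
  simp_rw [h2] at key
  have h3 : HasDerivAt (fun h : ℝ => Complex.exp (Complex.I * (h * P.freq n i : ℝ)) * P.fcoeff v n)
      (Complex.exp (Complex.I * ((0 : ℝ) * P.freq n i : ℝ)) * (Complex.I * (1 * P.freq n i : ℝ))
        * P.fcoeff v n) 0 := by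
    refine HasDerivAt.mul_const ?_ _
    exact ((((hasDerivAt_id (0 : ℝ)).mul_const (P.freq n i)).ofReal_comp).const_mul _).cexp
  have h4 := key.unique h3
  rw [← fcoeff_eq] at h4
  rw [h4]
  simp

theorem fcoeff_sum {ι : Type*} (t : Finset ι) {f : ι → EuclideanSpace ℝ (Fin d) → ℝ}
    (hf : ∀ i ∈ t, P.SmoothPeriodic (f i)) (n : Fin d → ℤ) :
    P.fcoeff (∑ i ∈ t, f i) n = ∑ i ∈ t, P.fcoeff (f i) n := by
  classical
  induction t using Finset.induction_on with
  | empty =>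
    have := P.fcoeff_smul 0 0 n
    simpa using this
  | insert a t ha ih =>
    rw [Finset.sum_insert ha, Finset.sum_insert ha, fcoeff_add (hf a (by simp))
      (.sum fun i hi => hf i (by simp [hi])), ih fun i hi => hf i (by simp [hi])]

theorem fcoeff_lap (hv : P.SmoothPeriodic v) (n : Fin d → ℤ) :
    P.fcoeff (lap v) n = ((-‖P.freq n‖ ^ 2 : ℝ) : ℂ) * P.fcoeff v n := by
  rw [lap_eq_sum hv.1, fcoeff_sum _ fun i _ => (hv.pd i).pd i]
  simp_rw [fcoeff_pd (hv.pd _), fcoeff_pd hv]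
  have h : ∀ i, Complex.I * (P.freq n i : ℂ) * (Complex.I * (P.freq n i : ℂ) * P.fcoeff v n) =
      ((-(P.freq n i) ^ 2 : ℝ) : ℂ) * P.fcoeff v n := by
    intro i
    push_cast
    linear_combination (P.fcoeff v n * (P.freq n i : ℂ) ^ 2) * Complex.I_sq
  simp_rw [h, ← Finset.sum_mul, EuclideanSpace.norm_sq_eq, Real.norm_eq_abs, sq_abs]
  congr 1
  push_cast
  simp

theorem eq_tsum_wave (hv : P.SmoothPeriodic v) (hs : Summable fun n => ‖P.fcoeff v n‖) :
    v = fun x => ∑' n, wave (P.fcoeff v n) (P.freq n) x := by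
  ext x
  obtain ⟨t, rfl⟩ := P.scale_surjective x
  have h := UnitAddTorus.hasSum_mFourier_series_apply_of_summable
    (f := ⟨P.torusLift v, continuous_torusLift hv⟩) hs.of_norm (fun i => (t i : UnitAddCircle))
  have h2 := (Complex.hasSum_re h).tsum_eq
  simp only [ContinuousMap.coe_mk, torusLift_coe hv, Complex.ofReal_re] at h2
  rw [← h2]
  refine tsum_congr fun n => ?_
  rw [mFourier_coe (P := P)]
  rfl

end PhaseField

/-! ### Decay of Fourier coefficients and the implicit linear problem -/

namespace PhaseField

variable {d : ℕ} {P : PhaseField d} {u v w f : EuclideanSpace ℝ (Fin d) → ℝ} {θ : ℝ}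

/-- The operator `1 - Δ`. -/
noncomputable def bessel (v : EuclideanSpace ℝ (Fin d) → ℝ) : EuclideanSpace ℝ (Fin d) → ℝ :=
  v - lap v

theorem SmoothPeriodic.bessel (hv : P.SmoothPeriodic v) : P.SmoothPeriodic (bessel v) :=
  hv.sub hv.lap

theorem SmoothPeriodic.bessel_iterate (hv : P.SmoothPeriodic v) (m : ℕ) :
    P.SmoothPeriodic (PhaseField.bessel^[m] v) := by
  induction m with
  | zero => exact hv
  | succ m ih => rw [Function.iterate_succ_apply']; exact ih.bessel

theorem fcoeff_bessel (hv : P.SmoothPeriodic v) (n : Fin d → ℤ) :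
    P.fcoeff (bessel v) n = ((1 + ‖P.freq n‖ ^ 2 : ℝ) : ℂ) * P.fcoeff v n := by
  have h : bessel v = v + (-1 : ℝ) • lap v := by rw [neg_one_smul, ← sub_eq_add_neg, bessel]
  rw [h, fcoeff_add hv (hv.lap.smul _), fcoeff_smul, fcoeff_lap hv]
  push_cast
  ring

theorem fcoeff_bessel_iterate (hv : P.SmoothPeriodic v) (m : ℕ) (n : Fin d → ℤ) :
    P.fcoeff (bessel^[m] v) n = (((1 + ‖P.freq n‖ ^ 2) ^ m : ℝ) : ℂ) * P.fcoeff v n := by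
  induction m with
  | zero => simp
  | succ m ih =>
    rw [Function.iterate_succ_apply', fcoeff_bessel (hv.bessel_iterate m), ih, pow_succ]
    push_cast
    ring

/-- Each application of 1 - Δ multiplies a coefficient by 1 + ‖k‖². Of the d + j applications, j
dominate ‖k‖^j and the other d leave a summable weight, so a sup-norm bound on `bessel^[d + j] v`
controls the derivatives of order j. -/
theorem norm_fcoeff_mul_pow_le (hv : P.SmoothPeriodic v) (j : ℕ) {M : ℝ}
    (hM : ∀ x, |bessel^[d + j] v x| ≤ M) (n : Fin d → ℤ) :
    ‖P.fcoeff v n‖ * ‖P.freq n‖ ^ j ≤ M * ((1 + ‖P.freq n‖ ^ 2) ^ d)⁻¹ := by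
  have h1 := norm_fcoeff_le (P := P) hM n
  rw [fcoeff_bessel_iterate hv, norm_mul, Complex.norm_real, Real.norm_of_nonneg (by positivity),
    pow_add] at h1
  have h2 : ‖P.freq n‖ ^ j ≤ (1 + ‖P.freq n‖ ^ 2) ^ j := by
    gcongr
    nlinarith [sq_nonneg (‖P.freq n‖ - 1), sq_nonneg ‖P.freq n‖]
  rw [← div_eq_mul_inv, le_div_iff₀ (by positivity)]
  calc ‖P.fcoeff v n‖ * ‖P.freq n‖ ^ j * (1 + ‖P.freq n‖ ^ 2) ^ d
      ≤ ‖P.fcoeff v n‖ * (1 + ‖P.freq n‖ ^ 2) ^ j * (1 + ‖P.freq n‖ ^ 2) ^ d := by gcongr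
    _ = (1 + ‖P.freq n‖ ^ 2) ^ d * (1 + ‖P.freq n‖ ^ 2) ^ j * ‖P.fcoeff v n‖ := by ring
    _ ≤ M := h1

theorem summable_fcoeff_mul_pow (hv : P.SmoothPeriodic v) (j : ℕ) :
    Summable fun n => ‖P.fcoeff v n‖ * ‖P.freq n‖ ^ j := by
  obtain ⟨M, hM⟩ := (hv.bessel_iterate (d + j)).exists_bound
  exact Summable.of_nonneg_of_le (fun n => by positivity)
    (norm_fcoeff_mul_pow_le hv j hM) (P.summable_freq.mul_left M)

theorem eq_tsum_wave_fcoeff (hv : P.SmoothPeriodic v) :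
    v = fun x => ∑' n, wave (P.fcoeff v n) (P.freq n) x :=
  eq_tsum_wave hv (by simpa using summable_fcoeff_mul_pow hv 0)

/-- The differential order of the linear operator. -/
def diffOrder (P : PhaseField d) : ℕ :=
  match P.flow with
  | FlowType.allenCahn => 2
  | FlowType.cahnHilliard => 4

/-- The symbol of the linear operator `-L`. -/
noncomputable def symbol (P : PhaseField d) (n : Fin d → ℤ) : ℝ :=
  P.ε ^ 2 * ‖P.freq n‖ ^ P.diffOrder

theorem symbol_nonneg (P : PhaseField d) (n : Fin d → ℤ) : 0 ≤ P.symbol n := by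
  unfold symbol; positivity

theorem L_eq_of_allenCahn (h : P.flow = FlowType.allenCahn)
    (v : EuclideanSpace ℝ (Fin d) → ℝ) : P.L v = P.ε ^ 2 • lap v := by
  simp [L, G, h]

theorem L_eq_of_cahnHilliard (h : P.flow = FlowType.cahnHilliard) (hv : ContDiff ℝ ∞ v) :
    P.L v = (-P.ε ^ 2) • lap (lap v) := by
  simp only [L, G, h]
  rw [← neg_smul, lap_smul _ (contDiff_lap hv)]

theorem fcoeff_L (hv : P.SmoothPeriodic v) (n : Fin d → ℤ) :
    P.fcoeff (P.L v) n = ((-P.symbol n : ℝ) : ℂ) * P.fcoeff v n := by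
  cases h : P.flow
  · rw [L_eq_of_allenCahn h, fcoeff_smul, fcoeff_lap hv]
    simp only [symbol, diffOrder, h]
    push_cast
    ring
  · rw [L_eq_of_cahnHilliard h hv.1, fcoeff_smul, fcoeff_lap hv.lap, fcoeff_lap hv]
    simp only [symbol, diffOrder, h]
    push_cast
    ring

theorem L_tsum_wave {c : (Fin d → ℤ) → ℂ}
    (h : ∀ j : ℕ, Summable fun n => ‖c n‖ * ‖P.freq n‖ ^ j) :
    P.L (fun x => ∑' n, wave (c n) (P.freq n) x) =
      fun x => ∑' n, wave (((-P.symbol n : ℝ) : ℂ) * c n) (P.freq n) x := by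
  have h2 : ∀ j : ℕ, Summable fun n => ‖((-‖P.freq n‖ ^ 2 : ℝ) : ℂ) * c n‖ * ‖P.freq n‖ ^ j := by
    intro j
    refine (h (j + 2)).congr fun n => ?_
    rw [norm_mul, Complex.norm_real, norm_neg, norm_pow, norm_norm]
    ring
  cases hf : P.flow
  · rw [L_eq_of_allenCahn hf, lap_tsum_wave h]
    ext x
    rw [Pi.smul_apply, smul_eq_mul, ← tsum_mul_left]
    refine tsum_congr fun n => ?_
    rw [← wave_ofReal_mul, ← mul_assoc, ← Complex.ofReal_mul]
    simp [symbol, diffOrder, hf]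
  · rw [L_eq_of_cahnHilliard hf (contDiff_tsum_wave h), lap_tsum_wave h, lap_tsum_wave h2]
    ext x
    rw [Pi.smul_apply, smul_eq_mul, ← tsum_mul_left]
    refine tsum_congr fun n => ?_
    rw [← wave_ofReal_mul, ← mul_assoc, ← mul_assoc, ← Complex.ofReal_mul, ← Complex.ofReal_mul]
    congr 4
    simp only [symbol, diffOrder, hf]
    ring

theorem fcoeff_of_resolvent (hu : P.SmoothPeriodic u) (hf : P.SmoothPeriodic f) (hθ : 0 ≤ θ)
    (h : u = f + θ • P.L u) (n : Fin d → ℤ) :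
    P.fcoeff u n = (((1 + θ * P.symbol n)⁻¹ : ℝ) : ℂ) * P.fcoeff f n := by
  have h1 : P.fcoeff u n = P.fcoeff f n + θ * (((-P.symbol n : ℝ) : ℂ) * P.fcoeff u n) := by
    conv_lhs => rw [h]
    rw [fcoeff_add hf (hu.L.smul _), fcoeff_smul, fcoeff_L hu]
  have h2 : ((1 + θ * P.symbol n : ℝ) : ℂ) ≠ 0 := by
    have : 0 < 1 + θ * P.symbol n := by have := P.symbol_nonneg n; positivity
    exact_mod_cast this.ne'
  rw [Complex.ofReal_inv, eq_inv_mul_iff_mul_eq₀ h2]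
  push_cast at h1 ⊢
  linear_combination h1

/-- The implicit linear problem has a unique smooth periodic solution. -/
theorem existsUnique_resolvent (hf : P.SmoothPeriodic f) (hθ : 0 ≤ θ) :
    ∃! u, P.SmoothPeriodic u ∧ u = f + θ • P.L u := by
  refine existsUnique_of_exists_of_unique ?_ ?_
  -- In Fourier space the equation reads (1 + θσ) û = f̂ with σ ≥ 0 the symbol of -L. The series is
  -- real by construction, since `wave` takes real parts, so no symmetry of the coefficients has to
  -- be checked.
  · let c : (Fin d → ℤ) → ℂ := fun n => (((1 + θ * P.symbol n)⁻¹ : ℝ) : ℂ) * P.fcoeff f n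
    have hpos : ∀ n, 0 < 1 + θ * P.symbol n := fun n => by
      have := P.symbol_nonneg n; positivity
    have hc : ∀ n, ‖c n‖ ≤ ‖P.fcoeff f n‖ := fun n => by
      rw [norm_mul, Complex.norm_real, Real.norm_of_nonneg (inv_nonneg.2 (hpos n).le)]
      refine mul_le_of_le_one_left (norm_nonneg _) (inv_le_one_of_one_le₀ ?_)
      have := P.symbol_nonneg n
      have : 0 ≤ θ * P.symbol n := by positivity
      linarith
    have hcs : ∀ j : ℕ, Summable fun n => ‖c n‖ * ‖P.freq n‖ ^ j := fun j =>
      Summable.of_nonneg_of_le (fun n => by positivity)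
        (fun n => mul_le_mul_of_nonneg_right (hc n) (by positivity)) (summable_fcoeff_mul_pow hf j)
    refine ⟨fun x => ∑' n, wave (c n) (P.freq n) x, ⟨contDiff_tsum_wave hcs, fun i x => ?_⟩, ?_⟩
    · refine tsum_congr fun n => ?_
      obtain ⟨t, rfl⟩ := P.scale_surjective x
      have hs : EuclideanSpace.single i (P.hi i - P.lo i) = P.scale (Pi.single i 1) := by
        ext j
        by_cases hj : j = i
        · subst hj; simp [scale]
        · simp [scale, hj]
      rw [hs, ← scale_add]
      simp only [wave, phase]
      rw [← mFourier_coe, ← mFourier_coe]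
      congr 4
      ext j
      by_cases hj : j = i
      · subst hj; simp
      · simp [hj]
    · rw [L_tsum_wave hcs]
      conv_rhs => rw [eq_tsum_wave_fcoeff hf]
      ext x
      simp only [Pi.add_apply, Pi.smul_apply, smul_eq_mul]
      rw [← tsum_mul_left, ← Summable.tsum_add]
      · refine tsum_congr fun n => ?_
        rw [← wave_ofReal_mul, ← wave_add]
        congr 1
        have h2 : ((1 + θ * P.symbol n : ℝ) : ℂ) ≠ 0 := by exact_mod_cast (hpos n).ne'
        simp only [c]
        push_cast at h2 ⊢
        field_simp
        ring
      · refine Summable.of_norm_bounded (summable_fcoeff_mul_pow hf 0) fun n => ?_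
        simpa using abs_wave_le _ _ _
      · refine Summable.mul_left _ ?_
        refine Summable.of_norm_bounded ((hcs P.diffOrder).mul_left (P.ε ^ 2)) fun n => ?_
        refine (abs_wave_le _ _ _).trans (le_of_eq ?_)
        rw [norm_mul, Complex.norm_real, norm_neg, Real.norm_of_nonneg (P.symbol_nonneg n), symbol]
        ring
  · rintro u v ⟨hu, hu'⟩ ⟨hv, hv'⟩
    rw [eq_tsum_wave_fcoeff hu, eq_tsum_wave_fcoeff hv]
    simp_rw [fcoeff_of_resolvent hu hf hθ hu', fcoeff_of_resolvent hv hf hθ hv']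

/-- The bounds on the solution of the implicit linear problem do not depend on the step size. -/
theorem norm_iteratedFDeriv_resolvent_le (hu : P.SmoothPeriodic u) (hf : P.SmoothPeriodic f)
    (hθ : 0 ≤ θ) (h : u = f + θ • P.L u) (j : ℕ) {M : ℝ} (hM : ∀ x, |bessel^[d + j] f x| ≤ M)
    (x : EuclideanSpace ℝ (Fin d)) :
    ‖iteratedFDeriv ℝ j u x‖ ≤ M * ∑' n, ((1 + ‖P.freq n‖ ^ 2) ^ d)⁻¹ := by
  -- The multiplier (1 + θσ)⁻¹ lies in (0, 1] for every θ ≥ 0. This is where the unbounded operator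
  -- L causes no restriction on the step size.
  have hc : ∀ n, ‖P.fcoeff u n‖ ≤ ‖P.fcoeff f n‖ := fun n => by
    have := P.symbol_nonneg n
    have h1 : 0 ≤ θ * P.symbol n := by positivity
    rw [fcoeff_of_resolvent hu hf hθ h, norm_mul, Complex.norm_real,
      Real.norm_of_nonneg (by positivity)]
    exact mul_le_of_le_one_left (norm_nonneg _) (inv_le_one_of_one_le₀ (by linarith))
  have key := norm_iteratedFDeriv_tsum_wave_le (summable_fcoeff_mul_pow hu) j x
  rw [← eq_tsum_wave_fcoeff hu] at key
  refine key.trans ?_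
  rw [← tsum_mul_left]
  refine (summable_fcoeff_mul_pow hu j).tsum_le_tsum (fun n => ?_) (P.summable_freq.mul_left M)
  exact (mul_le_mul_of_nonneg_right (hc n) (by positivity)).trans
    (norm_fcoeff_mul_pow_le hf j hM n)

end PhaseField

/-! ### Families bounded with all derivatives, and classes closed under the operations of the model
-/

namespace PhaseField

variable {d : ℕ} {P : PhaseField d} {ι : Type*} {l : Filter ι}

/-- A family of smooth periodic functions all of whose derivatives are uniformly `O(g)`. -/
structure UnifO (P : PhaseField d) (l : Filter ι) (V : ι → EuclideanSpace ℝ (Fin d) → ℝ)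
    (g : ι → ℝ) : Prop where
  smooth : ∀ᶠ i in l, P.SmoothPeriodic (V i)
  bound : ∀ k : ℕ, ∃ M, ∀ᶠ i in l, ∀ x, ‖iteratedFDeriv ℝ k (V i) x‖ ≤ M * |g i|

namespace UnifO

variable {V W : ι → EuclideanSpace ℝ (Fin d) → ℝ} {g g' : ι → ℝ}

theorem congr (h : UnifO P l V g) (hVW : V =ᶠ[l] W) : UnifO P l W g := by
  refine ⟨?_, fun k => ?_⟩
  · filter_upwards [h.smooth, hVW] with i h1 h2
    rwa [← h2]
  · obtain ⟨M, hM⟩ := h.bound k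
    refine ⟨M, ?_⟩
    filter_upwards [hM, hVW] with i h1 h2
    rwa [← h2]

theorem comp_tendsto {ι' : Type*} {l' : Filter ι'} (h : UnifO P l V g) {k : ι' → ι}
    (hk : Tendsto k l' l) : UnifO P l' (fun i => V (k i)) (fun i => g (k i)) :=
  ⟨hk.eventually h.smooth, fun n => (h.bound n).imp fun _ hM => hk.eventually hM⟩

theorem const {c : ι → ℝ} (hc : c =O[l] g) : UnifO P l (fun i _ => c i) g := by
  refine ⟨Eventually.of_forall fun i => .const _, fun k => ?_⟩
  obtain ⟨C, hC⟩ := hc.bound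
  refine ⟨C, ?_⟩
  filter_upwards [hC] with i hi x
  rcases Nat.eq_zero_or_pos k with rfl | hk
  · simpa using hi
  · rw [iteratedFDeriv_const_of_ne hk.ne']
    simpa using (norm_nonneg _).trans hi

theorem add (hV : UnifO P l V g) (hW : UnifO P l W g) : UnifO P l (fun i => V i + W i) g := by
  refine ⟨?_, fun k => ?_⟩
  · filter_upwards [hV.smooth, hW.smooth] with i h1 h2 using h1.add h2
  · obtain ⟨M, hM⟩ := hV.bound k
    obtain ⟨M', hM'⟩ := hW.bound k
    refine ⟨M + M', ?_⟩
    filter_upwards [hV.smooth, hW.smooth, hM, hM'] with i h1 h2 h3 h4 x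
    rw [iteratedFDeriv_add_apply (h1.1.of_le (by exact_mod_cast le_top)).contDiffAt
      (h2.1.of_le (by exact_mod_cast le_top)).contDiffAt, add_mul]
    exact (norm_add_le _ _).trans (add_le_add (h3 x) (h4 x))

theorem mul (hV : UnifO P l V g) (hW : UnifO P l W g') :
    UnifO P l (fun i => V i * W i) (fun i => g i * g' i) := by
  refine ⟨?_, fun k => ?_⟩
  · filter_upwards [hV.smooth, hW.smooth] with i h1 h2 using h1.mul h2
  · choose M hM using hV.bound
    choose M' hM' using hW.bound
    refine ⟨∑ j ∈ Finset.range (k + 1), (k.choose j : ℝ) * M j * M' (k - j), ?_⟩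
    have h5 : ∀ᶠ i in l, ∀ j ∈ Finset.range (k + 1), ∀ x,
        ‖iteratedFDeriv ℝ j (V i) x‖ ≤ M j * |g i| :=
      (Filter.eventually_all_finset _).2 fun j _ => hM j
    have h6 : ∀ᶠ i in l, ∀ j ∈ Finset.range (k + 1), ∀ x,
        ‖iteratedFDeriv ℝ (k - j) (W i) x‖ ≤ M' (k - j) * |g' i| :=
      (Filter.eventually_all_finset _).2 fun j _ => hM' (k - j)
    filter_upwards [hV.smooth, hW.smooth, h5, h6] with i h1 h2 h3 h4 x
    refine (norm_iteratedFDeriv_mul_le h1.1 h2.1 x (by exact_mod_cast le_top)).trans ?_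
    rw [Finset.sum_mul]
    refine Finset.sum_le_sum fun j hj => ?_
    calc (k.choose j : ℝ) * ‖iteratedFDeriv ℝ j (V i) x‖ * ‖iteratedFDeriv ℝ (k - j) (W i) x‖
        ≤ (k.choose j : ℝ) * (M j * |g i|) * (M' (k - j) * |g' i|) := by
          gcongr
          · exact mul_nonneg (by positivity) ((norm_nonneg _).trans (h3 j hj x))
          · exact h3 j hj x
          · exact h4 j hj x
      _ = _ := by rw [abs_mul]; ring

theorem bdd_mul (hV : UnifO P l V fun _ => 1) (hW : UnifO P l W g) :
    UnifO P l (fun i => V i * W i) g := by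
  simpa using hV.mul hW

theorem smul {c : ι → ℝ} (hc : c =O[l] g) (hV : UnifO P l V g') :
    UnifO P l (fun i => c i • V i) (fun i => g i * g' i) := by
  refine ((const (P := P) hc).mul hV).congr (Eventually.of_forall fun i => ?_)
  ext x; simp

theorem const_smul (c : ℝ) (hV : UnifO P l V g) : UnifO P l (fun i => c • V i) g := by
  simpa using smul (c := fun _ => c) (isBigO_const_const c (one_ne_zero (α := ℝ)) l) hV

theorem sub (hV : UnifO P l V g) (hW : UnifO P l W g) : UnifO P l (fun i => V i - W i) g := by
  refine (hV.add (hW.const_smul (-1))).congr (Eventually.of_forall fun i => ?_)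
  simp [sub_eq_add_neg]

theorem zero : UnifO P l (fun _ => (0 : EuclideanSpace ℝ (Fin d) → ℝ)) g :=
  const (c := fun _ => 0) (isBigO_zero g l)

theorem sum {κ : Type*} {t : Finset κ} {F : κ → ι → EuclideanSpace ℝ (Fin d) → ℝ}
    (h : ∀ j ∈ t, UnifO P l (F j) g) : UnifO P l (fun i => ∑ j ∈ t, F j i) g := by
  classical
  induction t using Finset.induction_on with
  | empty => simpa using zero
  | insert a t ha ih =>
    simp_rw [Finset.sum_insert ha]
    exact (h a (by simp)).add (ih fun j hj => h j (by simp [hj]))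

theorem pd (hV : UnifO P l V g) (j : Fin d) : UnifO P l (fun i => PhaseField.pd j (V i)) g := by
  refine ⟨hV.smooth.mono fun i h => h.pd j, fun k => ?_⟩
  obtain ⟨M, hM⟩ := hV.bound (k + 1)
  refine ⟨M, ?_⟩
  filter_upwards [hV.smooth, hM] with i h1 h2 x
  have h3 : PhaseField.pd j (V i) = (ContinuousLinearMap.apply ℝ ℝ
      (EuclideanSpace.single j (1 : ℝ))) ∘ fderiv ℝ (V i) := by
    ext y; simp [PhaseField.pd]
  have h4 : ‖ContinuousLinearMap.apply ℝ ℝ (EuclideanSpace.single j (1 : ℝ))‖ ≤ 1 := by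
    refine ContinuousLinearMap.opNorm_le_bound _ zero_le_one fun T => ?_
    simpa using T.le_opNorm (EuclideanSpace.single j (1 : ℝ))
  rw [h3]
  refine (ContinuousLinearMap.norm_iteratedFDeriv_comp_left _
    (h1.1.fderiv_right (m := ∞) (by simp)).contDiffAt (by exact_mod_cast le_top)).trans ?_
  rw [norm_iteratedFDeriv_fderiv]
  exact (mul_le_of_le_one_left (norm_nonneg _) h4).trans (h2 x)

theorem lap (hV : UnifO P l V g) : UnifO P l (fun i => PhaseField.lap (V i)) g := by
  refine (sum (t := Finset.univ) fun j _ => (hV.pd j).pd j).congr ?_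
  filter_upwards [hV.smooth] with i hi
  rw [lap_eq_sum hi.1]

theorem exists_bound (hV : UnifO P l V g) : ∃ M, ∀ᶠ i in l, ∀ x, |V i x| ≤ M * |g i| := by
  obtain ⟨M, hM⟩ := hV.bound 0
  exact ⟨M, hM.mono fun i hi x => by simpa using hi x⟩

theorem eval (hV : UnifO P l V g) (x : EuclideanSpace ℝ (Fin d)) : (fun i => V i x) =O[l] g := by
  obtain ⟨M, hM⟩ := hV.exists_bound
  exact IsBigO.of_bound M (hM.mono fun i hi => hi x)

theorem integral (hV : UnifO P l V g) : (fun i => ∫ x in P.Ω, V i x) =O[l] g := by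
  obtain ⟨M, hM⟩ := hV.exists_bound
  refine IsBigO.of_bound (M * volume.real P.Ω) (hM.mono fun i hi => ?_)
  refine (norm_setIntegral_le_of_norm_le_const P.volume_Ω_lt_top fun x _ => hi x).trans (le_of_eq ?_)
  rw [Real.norm_eq_abs]; ring

/-- The values of both families stay in a fixed ball, where each derivative of Φ is bounded. The
rest is the standard bound for derivatives of a composition. -/
theorem comp₂ {Φ : ℝ × ℝ → ℝ} (hΦ : ContDiff ℝ ∞ Φ) (hV : UnifO P l V fun _ => 1)
    (hW : UnifO P l W fun _ => 1) : UnifO P l (fun i x => Φ (V i x, W i x)) fun _ => 1 := by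
  refine ⟨?_, fun k => ?_⟩
  · filter_upwards [hV.smooth, hW.smooth] with i h1 h2
    exact ⟨hΦ.comp (h1.1.prodMk h2.1), fun j x => by simp only [h1.2 j x, h2.2 j x]⟩
  · choose M hM using hV.bound
    choose M' hM' using hW.bound
    have hcpt : IsCompact (Metric.closedBall (0 : ℝ × ℝ) (max (M 0) (M' 0))) :=
      isCompact_closedBall _ _
    have hC : ∀ j : ℕ, ∃ C, ∀ z ∈ Metric.closedBall (0 : ℝ × ℝ) (max (M 0) (M' 0)),
        ‖iteratedFDeriv ℝ j Φ z‖ ≤ C := fun j =>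
      hcpt.exists_bound_of_continuousOn
        (hΦ.continuous_iteratedFDeriv (by exact_mod_cast le_top)).continuousOn
    choose C hC using hC
    let Cs := ∑ j ∈ Finset.range (k + 1), |C j|
    -- The composition estimate asks for bounds of the form D ^ j on the derivatives of the inner
    -- map. The summand 1 ensures D ≥ 1, so that a bound by D suffices for every j ≥ 1.
    let D := 1 + ∑ j ∈ Finset.range (k + 1), (|M j| + |M' j|)
    have h5 : ∀ᶠ i in l, ∀ j ∈ Finset.range (k + 1), ∀ x,
        ‖iteratedFDeriv ℝ j (V i) x‖ ≤ |M j| :=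
      (Filter.eventually_all_finset _).2 fun j _ => (hM j).mono fun i h x =>
        (h x).trans (by simpa using le_abs_self _)
    have h6 : ∀ᶠ i in l, ∀ j ∈ Finset.range (k + 1), ∀ x,
        ‖iteratedFDeriv ℝ j (W i) x‖ ≤ |M' j| :=
      (Filter.eventually_all_finset _).2 fun j _ => (hM' j).mono fun i h x =>
        (h x).trans (by simpa using le_abs_self _)
    have hD1 : 1 ≤ D := le_add_of_nonneg_right (Finset.sum_nonneg fun j _ => by positivity)
    refine ⟨k.factorial * Cs * D ^ k, ?_⟩
    filter_upwards [hV.smooth, hW.smooth, h5, h6, hM 0, hM' 0] with i h1 h2 h3 h4 h7 h8 x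
    rw [abs_one, mul_one]
    refine norm_iteratedFDeriv_comp_le (N := ∞) (g := Φ) (f := fun x => (V i x, W i x)) hΦ
      (h1.1.prodMk h2.1) (by exact_mod_cast le_top) x (fun j hj => ?_) fun j hj1 hj => ?_
    · have h9 : (V i x, W i x) ∈ Metric.closedBall (0 : ℝ × ℝ) (max (M 0) (M' 0)) := by
        rw [mem_closedBall_zero_iff, Prod.norm_def]
        have h10 := h7 x
        have h11 := h8 x
        simp only [norm_iteratedFDeriv_zero, abs_one, mul_one] at h10 h11
        exact max_le_max h10 h11
      refine (hC j _ h9).trans ((le_abs_self _).trans ?_)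
      exact Finset.single_le_sum (f := fun j => |C j|) (fun j _ => abs_nonneg _)
        (Finset.mem_range.2 (by omega))
    · have hj' : j ∈ Finset.range (k + 1) := Finset.mem_range.2 (by omega)
      have h12 : (fun x => (V i x, W i x)) =
          (ContinuousLinearMap.inl ℝ ℝ ℝ) ∘ V i + (ContinuousLinearMap.inr ℝ ℝ ℝ) ∘ W i := by
        ext y <;> simp
      have hs1 : ContDiff ℝ ∞ ((ContinuousLinearMap.inl ℝ ℝ ℝ) ∘ V i) :=
        (ContinuousLinearMap.inl ℝ ℝ ℝ).contDiff.comp h1.1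
      have hs2 : ContDiff ℝ ∞ ((ContinuousLinearMap.inr ℝ ℝ ℝ) ∘ W i) :=
        (ContinuousLinearMap.inr ℝ ℝ ℝ).contDiff.comp h2.1
      rw [h12, iteratedFDeriv_add_apply (hs1.of_le (by exact_mod_cast le_top)).contDiffAt
        (hs2.of_le (by exact_mod_cast le_top)).contDiffAt]
      have h13 := ContinuousLinearMap.norm_iteratedFDeriv_comp_left
        (ContinuousLinearMap.inl ℝ ℝ ℝ) (h1.1.contDiffAt (x := x)) (n := j) (by exact_mod_cast le_top)
      have h14 := ContinuousLinearMap.norm_iteratedFDeriv_comp_left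
        (ContinuousLinearMap.inr ℝ ℝ ℝ) (h2.1.contDiffAt (x := x)) (n := j) (by exact_mod_cast le_top)
      have h15 : ‖ContinuousLinearMap.inl ℝ ℝ ℝ‖ ≤ 1 := ContinuousLinearMap.norm_inl_le_one ℝ ℝ ℝ
      have h16 : ‖ContinuousLinearMap.inr ℝ ℝ ℝ‖ ≤ 1 := ContinuousLinearMap.norm_inr_le_one ℝ ℝ ℝ
      calc _ ≤ |M j| + |M' j| := (norm_add_le _ _).trans (add_le_add
              ((h13.trans (mul_le_of_le_one_left (norm_nonneg _) h15)).trans (h3 j hj' x))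
              ((h14.trans (mul_le_of_le_one_left (norm_nonneg _) h16)).trans (h4 j hj' x)))
        _ ≤ D := by
            have := Finset.single_le_sum (f := fun j => |M j| + |M' j|)
              (fun j _ => by positivity) hj'
            simp only [D]; linarith
        _ = D ^ 1 := (pow_one D).symm
        _ ≤ D ^ j := pow_le_pow_right₀ hD1 hj1

theorem comp {Φ : ℝ → ℝ} (hΦ : ContDiff ℝ ∞ Φ) (hV : UnifO P l V fun _ => 1) :
    UnifO P l (fun i x => Φ (V i x)) fun _ => 1 :=
  comp₂ (Φ := fun z => Φ z.1) (hΦ.comp contDiff_fst) hV hV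

theorem bessel_iterate (hV : UnifO P l V g) (m : ℕ) :
    UnifO P l (fun i => PhaseField.bessel^[m] (V i)) g := by
  induction m with
  | zero => exact hV
  | succ m ih =>
    simp_rw [Function.iterate_succ_apply']
    exact ih.sub ih.lap

/-- A bound on one derivative order of the solution uses more derivatives of the data. As `UnifO`
controls every order, this loss does no harm. -/
theorem resolvent (hV : UnifO P l V g) {θ : ι → ℝ} (hθ : ∀ᶠ i in l, 0 ≤ θ i)
    (hW : ∀ᶠ i in l, P.SmoothPeriodic (W i) ∧ W i = V i + θ i • P.L (W i)) : UnifO P l W g := by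
  refine ⟨hW.mono fun i h => h.1, fun k => ?_⟩
  obtain ⟨M, hM⟩ := (hV.bessel_iterate (d + k)).exists_bound
  refine ⟨M * ∑' n, ((1 + ‖P.freq n‖ ^ 2) ^ d)⁻¹, ?_⟩
  filter_upwards [hV.smooth, hθ, hW, hM] with i h1 h2 h3 h4 x
  refine (norm_iteratedFDeriv_resolvent_le h3.1 h1 h2 h3.2 k h4 x).trans (le_of_eq ?_)
  ring

end UnifO

/-- A class of families of functions that is closed under the operations from which the
phase-field model is built. -/
structure IsDiffAlgebra (P : PhaseField d)
    (𝒞 : (ι → EuclideanSpace ℝ (Fin d) → ℝ) → Prop) : Prop where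
  const : ∀ c : ℝ, 𝒞 fun _ _ => c
  add : ∀ {V W}, 𝒞 V → 𝒞 W → 𝒞 fun i => V i + W i
  mul : ∀ {V W}, 𝒞 V → 𝒞 W → 𝒞 fun i => V i * W i
  lap : ∀ {V}, 𝒞 V → 𝒞 fun i => lap (V i)
  comp : ∀ {V} {Φ : ℝ → ℝ}, ContDiff ℝ ∞ Φ → 𝒞 V → 𝒞 fun i x => Φ (V i x)
  integral : ∀ {V}, 𝒞 V → 𝒞 fun i _ => ∫ x in P.Ω, V i x

/-- The operator `N` with a smooth function `ρ` in place of the inverse square root. -/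
noncomputable def Nreg (P : PhaseField d) (ρ : ℝ → ℝ) (u : EuclideanSpace ℝ (Fin d) → ℝ) (r : ℝ) :
    EuclideanSpace ℝ (Fin d) → ℝ :=
  (r * ρ (P.potential u)) • P.G fun x => deriv P.F (u x)

/-- The functional `Ñ` with a smooth function `ρ` in place of the inverse square root. -/
noncomputable def Ntildereg (P : PhaseField d) (ρ : ℝ → ℝ) (u : EuclideanSpace ℝ (Fin d) → ℝ)
    (r : ℝ) : ℝ :=
  1 / 2 * ρ (P.potential u) * P.inner2 (fun x => deriv P.F (u x)) (P.L u + P.Nreg ρ u r)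

theorem Nreg_eq {ρ : ℝ → ℝ} {u : EuclideanSpace ℝ (Fin d) → ℝ} (hu : P.SmoothPeriodic u)
    (h : ρ (P.potential u) = 1 / √(P.potential u)) (r : ℝ) : P.Nreg ρ u r = P.N u r := by
  unfold Nreg N
  rw [G_smul _ (SmoothPeriodic.comp P.contDiff_deriv_F hu).1, h, mul_one_div]

theorem Ntildereg_eq {ρ : ℝ → ℝ} {u : EuclideanSpace ℝ (Fin d) → ℝ} (hu : P.SmoothPeriodic u)
    (h : ρ (P.potential u) = 1 / √(P.potential u)) (r : ℝ) :
    P.Ntildereg ρ u r = P.Ntilde u r := by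
  unfold Ntildereg Ntilde
  rw [Nreg_eq hu h, h, one_div_mul_one_div]

/-- The energy balance defect, divided by the step size, for given slopes. -/
noncomputable def energyDefect (P : PhaseField d) {s : ℕ} (τ : ℝ)
    (u : EuclideanSpace ℝ (Fin d) → ℝ) (r : ℝ) (U S : Fin s → EuclideanSpace ℝ (Fin d) → ℝ)
    (R σ : Fin s → ℝ) : ℝ :=
  ∑ i, (-P.ε ^ 2 * P.inner2 (u - U i) (lap (S i)) + 2 * (r - R i) * σ i)
    + τ * (-P.ε ^ 2 / 2 * P.inner2 (∑ i, S i) (lap (∑ i, S i)) + (∑ i, σ i) ^ 2)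

namespace IsDiffAlgebra

variable {𝒞 : (ι → EuclideanSpace ℝ (Fin d) → ℝ) → Prop} (h : IsDiffAlgebra P 𝒞)
  {V W : ι → EuclideanSpace ℝ (Fin d) → ℝ} {a b : ι → ℝ}

include h

theorem add' (ha : 𝒞 fun i _ => a i) (hb : 𝒞 fun i _ => b i) : 𝒞 fun i _ => a i + b i :=
  h.add ha hb

theorem mul' (ha : 𝒞 fun i _ => a i) (hb : 𝒞 fun i _ => b i) : 𝒞 fun i _ => a i * b i :=
  h.mul ha hb

theorem smul (ha : 𝒞 fun i _ => a i) (hV : 𝒞 V) : 𝒞 fun i => a i • V i :=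
  h.mul ha hV

theorem neg (hV : 𝒞 V) : 𝒞 fun i => -V i := by
  have := h.smul (h.const (-1)) hV
  simpa using this

theorem sub (hV : 𝒞 V) (hW : 𝒞 W) : 𝒞 fun i => V i - W i := by
  simp_rw [sub_eq_add_neg]
  exact h.add hV (h.neg hW)

theorem sub' (ha : 𝒞 fun i _ => a i) (hb : 𝒞 fun i _ => b i) : 𝒞 fun i _ => a i - b i :=
  h.sub ha hb

theorem sum {κ : Type*} (t : Finset κ) {F : κ → ι → EuclideanSpace ℝ (Fin d) → ℝ}
    (hF : ∀ j ∈ t, 𝒞 (F j)) : 𝒞 fun i => ∑ j ∈ t, F j i := by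
  classical
  induction t using Finset.induction_on with
  | empty => exact h.const 0
  | insert a t ha ih =>
    simp_rw [Finset.sum_insert ha]
    exact h.add (hF a (by simp)) (ih fun j hj => hF j (by simp [hj]))

theorem sum' {κ : Type*} (t : Finset κ) {F : κ → ι → ℝ}
    (hF : ∀ j ∈ t, 𝒞 fun i _ => F j i) : 𝒞 fun i _ => ∑ j ∈ t, F j i := by
  have := h.sum t hF
  convert this using 2
  ext x; simp

theorem inner2 (hV : 𝒞 V) (hW : 𝒞 W) : 𝒞 fun i _ => P.inner2 (V i) (W i) :=
  h.integral (h.mul hV hW)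

theorem G (hV : 𝒞 V) : 𝒞 fun i => P.G (V i) := by
  unfold PhaseField.G
  cases P.flow
  · exact h.neg hV
  · exact h.lap hV

theorem L (hV : 𝒞 V) : 𝒞 fun i => P.L (V i) :=
  h.G (h.neg (h.smul (h.const _) (h.lap hV)))

theorem potential (hV : 𝒞 V) : 𝒞 fun i _ => P.potential (V i) :=
  h.add' (h.integral (h.comp P.F_smooth hV)) (h.const _)

variable {ρ : ℝ → ℝ}

theorem Nreg (hρ : ContDiff ℝ ∞ ρ) (hV : 𝒞 V) (ha : 𝒞 fun i _ => a i) :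
    𝒞 fun i => P.Nreg ρ (V i) (a i) :=
  h.smul (h.mul' ha (h.comp hρ (h.potential hV))) (h.G (h.comp P.contDiff_deriv_F hV))

theorem Ntildereg (hρ : ContDiff ℝ ∞ ρ) (hV : 𝒞 V) (ha : 𝒞 fun i _ => a i) :
    𝒞 fun i _ => P.Ntildereg ρ (V i) (a i) :=
  h.mul' (h.mul' (h.const _) (h.comp hρ (h.potential hV)))
    (h.inner2 (h.comp P.contDiff_deriv_F hV) (h.add (h.L hV) (h.Nreg hρ hV ha)))

theorem energyDefect {s : ℕ} {τ r : ι → ℝ} {u : ι → EuclideanSpace ℝ (Fin d) → ℝ}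
    {U S : ι → Fin s → EuclideanSpace ℝ (Fin d) → ℝ} {R σ : ι → Fin s → ℝ}
    (hτ : 𝒞 fun i _ => τ i) (hr : 𝒞 fun i _ => r i) (hu : 𝒞 u)
    (hU : ∀ j, 𝒞 fun i => U i j) (hS : ∀ j, 𝒞 fun i => S i j)
    (hR : ∀ j, 𝒞 fun i _ => R i j) (hσ : ∀ j, 𝒞 fun i _ => σ i j) :
    𝒞 fun i _ => P.energyDefect (τ i) (u i) (r i) (U i) (S i) (R i) (σ i) := by
  have hsumS : 𝒞 fun i => ∑ j, S i j := h.sum _ fun j _ => hS j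
  have hsumσ : 𝒞 fun i _ => ∑ j, σ i j := h.sum' _ fun j _ => hσ j
  refine h.add' (h.sum' _ fun j _ => h.add' (h.mul' (h.const _) (h.inner2 (h.sub hu (hU j))
    (h.lap (hS j)))) (h.mul' (h.mul' (h.const 2) (h.sub' hr (hR j))) (hσ j)))
    (h.mul' hτ (h.add' (h.mul' (h.const _) (h.inner2 hsumS (h.lap hsumS))) ?_))
  simp_rw [sq]
  exact h.mul' hsumσ hsumσ

end IsDiffAlgebra

theorem isDiffAlgebra_bdd (P : PhaseField d) (l : Filter ι) :
    IsDiffAlgebra P fun V => UnifO P l V fun _ => 1 where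
  const c := .const (isBigO_const_const c (one_ne_zero (α := ℝ)) l)
  add := .add
  mul := .bdd_mul
  lap := .lap
  comp := .comp
  integral h := .const h.integral

/-- Pairs of bounded families that differ by `O(g)`. -/
structure UnifEq (P : PhaseField d) (l : Filter ι) (g : ι → ℝ)
    (V : ι × Bool → EuclideanSpace ℝ (Fin d) → ℝ) : Prop where
  left : UnifO P l (fun i => V (i, true)) fun _ => 1
  right : UnifO P l (fun i => V (i, false)) fun _ => 1
  diff : UnifO P l (fun i => V (i, true) - V (i, false)) g

theorem UnifO.of_bounds {V W D : ι → EuclideanSpace ℝ (Fin d) → ℝ} {g : ι → ℝ}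
    (h : UnifO P l D g) (hD : ∀ i, D i = V i - W i) : UnifO P l (fun i => V i - W i) g :=
  h.congr (Eventually.of_forall hD)

/-- Closure under this class says that every operation of the model is Lipschitz on bounded
families, with derivatives lost freely. Products are split as V(W - W') + W'(V - V'), and for
compositions Hadamard's lemma factors Φ(V) - Φ(V') through V - V'. The class serves to compare
stages with the initial value (g = τ) and with interpolants (g = τ^(p+1)). -/
theorem isDiffAlgebra_unifEq (P : PhaseField d) (l : Filter ι) (g : ι → ℝ) :
    IsDiffAlgebra P (UnifEq P l g) where
  const c := ⟨(isDiffAlgebra_bdd P l).const c, (isDiffAlgebra_bdd P l).const c,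
    UnifO.zero.of_bounds fun i => by ext; simp⟩
  add hV hW := ⟨hV.left.add hW.left, hV.right.add hW.right,
    (hV.diff.add hW.diff).of_bounds fun i => by abel⟩
  mul hV hW := ⟨hV.left.bdd_mul hW.left, hV.right.bdd_mul hW.right,
    ((hV.left.bdd_mul hW.diff).add (hW.right.bdd_mul hV.diff)).of_bounds fun i => by ring⟩
  lap hV := ⟨hV.left.lap, hV.right.lap, hV.diff.lap.congr (by
    filter_upwards [hV.left.smooth, hV.right.smooth] with i h1 h2
    have h3 := lap_add h1.1 (h2.smul (-1)).1
    rw [lap_smul _ h2.1] at h3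
    simpa [sub_eq_add_neg] using h3)⟩
  comp {V Φ} hΦ hV := by
    obtain ⟨H, hH, hH'⟩ := ContDiff.exists_hadamard (Φ := fun z => Φ z.2) (hΦ.comp contDiff_snd)
    refine ⟨hV.left.comp hΦ, hV.right.comp hΦ,
      ((UnifO.comp₂ hH hV.right hV.left).bdd_mul hV.diff).of_bounds fun i => ?_⟩
    ext x
    have := hH' (V (i, false) x) (V (i, true) x)
    simp only [Pi.mul_apply, Pi.sub_apply]
    linarith
  integral {V} hV := by
    refine ⟨.const hV.left.integral, .const hV.right.integral,
      (UnifO.const hV.diff.integral).congr ?_⟩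
    filter_upwards [hV.left.smooth, hV.right.smooth] with i h1 h2
    ext x
    simp only [Pi.sub_apply]
    exact integral_sub (P.integrableOn_Ω h1.1.continuous) (P.integrableOn_Ω h2.1.continuous)

/-! ### Uniform expansions in powers of the step size -/

/-- Families over step sizes and parameters with a uniform expansion of length `n` in powers of
the step size. -/
def Expansion (P : PhaseField d) {Z : Type*} (l : Filter (ℝ × Z)) :
    ℕ → (ℝ × Z → EuclideanSpace ℝ (Fin d) → ℝ) → Prop
  | 0, V => UnifO P l V fun _ => 1
  | n + 1, V => ∃ (c : Z → EuclideanSpace ℝ (Fin d) → ℝ)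
      (W : ℝ × Z → EuclideanSpace ℝ (Fin d) → ℝ),
      UnifO P l (fun i => c i.2) (fun _ => 1) ∧ Expansion P l n W ∧
        ∀ᶠ i in l, V i = c i.2 + i.1 • W i

namespace Expansion

variable {Z : Type*} {l : Filter (ℝ × Z)} {V W : ℝ × Z → EuclideanSpace ℝ (Fin d) → ℝ} {n : ℕ}

theorem congr (h : Expansion P l n V) (hVW : V =ᶠ[l] W) : Expansion P l n W := by
  cases n with
  | zero => exact UnifO.congr h hVW
  | succ n =>
    obtain ⟨c, W', hc, hW', he⟩ := h
    refine ⟨c, W', hc, hW', ?_⟩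
    filter_upwards [he, hVW] with i h1 h2
    rw [← h2, h1]

theorem of_param {c : Z → EuclideanSpace ℝ (Fin d) → ℝ}
    (hc : UnifO P l (fun i => c i.2) fun _ => 1) (n : ℕ) : Expansion P l n fun i => c i.2 := by
  induction n generalizing c with
  | zero => exact hc
  | succ n ih => exact ⟨c, fun _ => 0, hc, ih (c := fun _ => 0) .zero, by simp⟩

variable (hl : (fun i : ℝ × Z => i.1) =O[l] fun _ => (1 : ℝ))

theorem smul_fst (h : Expansion P l n V) : Expansion P l (n + 1) fun i => i.1 • V i :=
  ⟨fun _ => 0, V, .zero, h, by simp⟩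

include hl

theorem of_succ (h : Expansion P l (n + 1) V) : Expansion P l n V := by
  induction n generalizing V with
  | zero =>
    obtain ⟨c, W, hc, hW, he⟩ := h
    refine UnifO.congr (hc.add ?_) (EventuallyEq.symm he)
    simpa using UnifO.smul hl hW
  | succ n ih =>
    obtain ⟨c, W, hc, hW, he⟩ := h
    exact ⟨c, W, hc, ih hW, he⟩

theorem unifO (h : Expansion P l n V) : UnifO P l V fun _ => 1 := by
  induction n with
  | zero => exact h
  | succ n ih => exact ih (h.of_succ hl)

omit hl in
theorem add (hV : Expansion P l n V) (hW : Expansion P l n W) :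
    Expansion P l n fun i => V i + W i := by
  induction n generalizing V W with
  | zero => exact UnifO.add hV hW
  | succ n ih =>
    obtain ⟨c, V', hc, hV', he⟩ := hV
    obtain ⟨c', W', hc', hW', he'⟩ := hW
    refine ⟨fun z => c z + c' z, fun i => V' i + W' i, hc.add hc', ih hV' hW', ?_⟩
    filter_upwards [he, he'] with i h1 h2
    rw [h1, h2, smul_add]; abel

theorem mul (hV : Expansion P l n V) (hW : Expansion P l n W) :
    Expansion P l n fun i => V i * W i := by
  induction n generalizing V W with
  | zero => exact UnifO.bdd_mul hV hW
  | succ n ih =>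
    have hW0 := hW.of_succ hl
    obtain ⟨c, V', hc, hV', he⟩ := hV
    obtain ⟨c', W', hc', hW', he'⟩ := hW
    refine ⟨fun z => c z * c' z, fun i => c i.2 * W' i + V' i * W i, hc.bdd_mul hc',
      (ih (of_param hc n) hW').add (ih hV' hW0), ?_⟩
    filter_upwards [he, he'] with i h1 h2
    rw [h1, add_mul]
    nth_rewrite 1 [h2]
    ext x
    simp only [Pi.add_apply, Pi.mul_apply, Pi.smul_apply, smul_eq_mul]
    ring

theorem linear {A : (EuclideanSpace ℝ (Fin d) → ℝ) → EuclideanSpace ℝ (Fin d) → ℝ}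
    (hA : ∀ {v w}, P.SmoothPeriodic v → P.SmoothPeriodic w → ∀ t : ℝ,
      A (v + t • w) = A v + t • A w)
    (hA' : ∀ {V : ℝ × Z → EuclideanSpace ℝ (Fin d) → ℝ}, UnifO P l V (fun _ => 1) →
      UnifO P l (fun i => A (V i)) fun _ => 1)
    (hV : Expansion P l n V) : Expansion P l n fun i => A (V i) := by
  induction n generalizing V with
  | zero => exact hA' hV
  | succ n ih =>
    obtain ⟨c, W, hc, hW, he⟩ := hV
    refine ⟨fun z => A (c z), fun i => A (W i), hA' hc, ih hW, ?_⟩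
    filter_upwards [he, hc.smooth, (hW.unifO hl).smooth] with i h1 h2 h3
    rw [h1, hA h2 h3]

/-- If V = c + τW, Hadamard's lemma gives Φ(c, V) = Φ(c, c) + τ W H(c, V). The factor H(c, V) has
the same shape as Φ(c, V), which makes the induction on the length possible. This is why Φ is
allowed to depend on the leading coefficient c as well. -/
theorem comp_hadamard {c : Z → EuclideanSpace ℝ (Fin d) → ℝ}
    (hc : UnifO P l (fun i => c i.2) fun _ => 1) (hW : Expansion P l n W)
    (he : ∀ᶠ i in l, V i = c i.2 + i.1 • W i) {Φ : ℝ × ℝ → ℝ} (hΦ : ContDiff ℝ ∞ Φ) :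
    Expansion P l (n + 1) fun i x => Φ (c i.2 x, V i x) := by
  have hV : UnifO P l V fun _ => 1 :=
    unifO hl (n := n + 1) ⟨c, W, hc, hW, he⟩
  induction n generalizing Φ with
  | zero =>
    obtain ⟨H, hH, hH'⟩ := hΦ.exists_hadamard
    refine ⟨fun z x => Φ (c z x, c z x), fun i => W i * fun x => H (c i.2 x, V i x),
      UnifO.comp₂ hΦ hc hc, UnifO.bdd_mul hW (UnifO.comp₂ hH hc hV), ?_⟩
    filter_upwards [he] with i h1
    ext x
    rw [hH', h1]
    simp only [Pi.add_apply, Pi.mul_apply, Pi.smul_apply, smul_eq_mul]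
    ring
  | succ n ih =>
    obtain ⟨H, hH, hH'⟩ := hΦ.exists_hadamard
    refine ⟨fun z x => Φ (c z x, c z x), fun i => W i * fun x => H (c i.2 x, V i x),
      UnifO.comp₂ hΦ hc hc, mul hl hW (ih (hW.of_succ hl) hH), ?_⟩
    filter_upwards [he] with i h1
    ext x
    rw [hH', h1]
    simp only [Pi.add_apply, Pi.mul_apply, Pi.smul_apply, smul_eq_mul]
    ring

theorem isDiffAlgebra (P : PhaseField d) (n : ℕ) : IsDiffAlgebra P (Expansion P l n) where
  const c := of_param (c := fun _ _ => c) ((isDiffAlgebra_bdd P l).const c) n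
  add := add
  mul := mul hl
  lap := linear hl (fun hv hw t => by rw [lap_add hv.1 (hw.smul t).1, lap_smul t hw.1]) .lap
  comp {V Φ} hΦ hV := by
    cases n with
    | zero => exact UnifO.comp hΦ hV
    | succ n =>
      obtain ⟨c, W, hc, hW, he⟩ := hV
      exact comp_hadamard hl hc hW he (Φ := fun z => Φ z.2) (hΦ.comp contDiff_snd)
  integral := by
    refine linear hl (A := fun v _ => ∫ x in P.Ω, v x) (fun {v w} hv hw t => ?_)
      fun h => .const h.integral
    ext x
    simp only [Pi.add_apply, Pi.smul_apply, smul_eq_mul]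
    rw [integral_add (P.integrableOn_Ω hv.1.continuous)
      ((P.integrableOn_Ω hw.1.continuous).const_mul t), integral_const_mul]

theorem fst (n : ℕ) : Expansion P l n fun i _ => i.1 := by
  cases n with
  | zero => exact .const hl
  | succ n => exact ⟨fun _ _ => 0, fun _ _ => 1, (isDiffAlgebra_bdd P l).const 0,
      (isDiffAlgebra hl P n).const 1, Eventually.of_forall fun i => by ext; simp⟩

end Expansion

end PhaseField

/-! ### Existence, uniqueness, bounds and expansions of the stages -/

/-- A triangular system has exactly one solution if each of its equations can be solved uniquely
for its own unknown. -/
theorem existsUnique_of_triangular {X : Type*} [Nonempty X] {s : ℕ}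
    {Rel : Fin s → (Fin s → X) → Prop}
    (hdep : ∀ i S S', (∀ j ≤ i, S j = S' j) → Rel i S → Rel i S')
    (hex : ∀ i S, (∀ j < i, Rel j S) → ∃! x, Rel i (Function.update S i x)) :
    ∃! S, ∀ i, Rel i S := by
  refine existsUnique_of_exists_of_unique ?_ ?_
  · have h : ∀ m ≤ s, ∃ S : Fin s → X, ∀ i : Fin s, (i : ℕ) < m → Rel i S := by
      intro m
      induction m with
      | zero => exact fun _ => ⟨fun _ => Classical.arbitrary X, by simp⟩
      | succ m ih =>
        intro hm
        obtain ⟨S, hS⟩ := ih (by omega)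
        let i : Fin s := ⟨m, hm⟩
        obtain ⟨x, hx, -⟩ := hex i S fun j hj => hS j hj
        refine ⟨Function.update S i x, fun j hj => ?_⟩
        rcases (Nat.lt_succ_iff_lt_or_eq.1 hj) with h | h
        · refine hdep j S _ (fun k hk => ?_) (hS j h)
          have : k ≠ i := fun hki => by
            subst hki
            have : m ≤ (j : ℕ) := hk
            omega
          rw [Function.update_of_ne this]
        · have : j = i := Fin.ext h
          rw [this]; exact hx
    obtain ⟨S, hS⟩ := h s le_rfl
    exact ⟨S, fun i => hS i i.2⟩
  · intro S S' hS hS'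
    ext i
    induction i using WellFoundedLT.induction with
    | ind i ih =>
      refine (hex i S fun j _ => hS j).unique ?_ ?_
      · simpa using hS i
      · refine hdep i S' _ (fun j hj => ?_) (hS' i)
        rcases hj.lt_or_eq with h | rfl
        · rw [Function.update_of_ne h.ne, ih j h]
        · simp

theorem Fin.sum_eq_sum_Iio_add {M : Type*} [AddCommMonoid M] {s : ℕ} (i : Fin s) {g : Fin s → M}
    (hg : ∀ j, i < j → g j = 0) : ∑ j, g j = ∑ j ∈ Finset.Iio i, g j + g i := by
  rw [add_comm, ← Finset.sum_insert (by simp)]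
  symm
  refine Finset.sum_subset (Finset.subset_univ _) fun j _ hj => hg j ?_
  by_contra h
  refine hj ?_
  simpa [← le_iff_eq_or_lt] using not_lt.1 h

/-- A smooth function that agrees with the inverse square root away from zero. -/
theorem exists_contDiff_eq_inv_sqrt {δ : ℝ} (hδ : 0 < δ) :
    ∃ ρ : ℝ → ℝ, ContDiff ℝ ∞ ρ ∧ ∀ q, δ ≤ q → ρ q = 1 / √q := by
  -- The cutoff vanishes for q ≤ δ/2, which removes the singularity at zero, and equals one for q ≥
  -- δ.
  refine ⟨fun q => Real.smoothTransition (2 * q / δ - 1) * (√q)⁻¹, ?_, fun q hq => ?_⟩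
  · refine contDiff_iff_contDiffAt.2 fun q => ?_
    rcases lt_or_ge 0 q with h | h
    · refine ContDiffAt.mul ?_ ?_
      · exact (Real.smoothTransition.contDiff (n := ⊤)).contDiffAt.comp q (by fun_prop)
      · exact (contDiffAt_id.sqrt h.ne').inv (Real.sqrt_pos.2 h).ne'
    · refine (contDiffAt_const (c := (0 : ℝ))).congr_of_eventuallyEq ?_
      filter_upwards [Iio_mem_nhds (show q < δ / 2 by linarith)] with x hx
      rw [Real.smoothTransition.zero_of_nonpos, zero_mul]
      have : x < δ / 2 := hx
      have : 2 * x / δ ≤ 1 := by rw [div_le_one hδ]; linarith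
      linarith
  · have : 2 ≤ 2 * q / δ := by rw [le_div_iff₀ hδ]; linarith
    change Real.smoothTransition (2 * q / δ - 1) * (√q)⁻¹ = 1 / √q
    rw [Real.smoothTransition.one_of_one_le (by linarith), one_mul, one_div]

namespace PhaseField

variable {d s : ℕ} {P : PhaseField d} {T : IMEXTableau s}

/-- The implicit part couples a stage to itself only through the linear term τ aᵢᵢ L, so the stages
are found in order, each from one resolvent problem with θ = τ aᵢᵢ ≥ 0. No smallness of τ and no
positivity of the potential enter, since square root and division are total. -/
theorem existsUnique_isStages (P : PhaseField d) (hdiag : ∀ i, 0 ≤ T.A i i) {τ : ℝ} (hτ : 0 ≤ τ)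
    {u : EuclideanSpace ℝ (Fin d) → ℝ} (hu : P.SmoothPeriodic u) (r : ℝ) :
    ∃! S : (Fin s → EuclideanSpace ℝ (Fin d) → ℝ) × (Fin s → ℝ),
      P.IsStages T τ u r S.1 S.2 := by
  let Rel : Fin s → (Fin s → (EuclideanSpace ℝ (Fin d) → ℝ) × ℝ) → Prop := fun i S =>
    P.SmoothPeriodic (S i).1 ∧
    (S i).1 = u + τ • ∑ j, T.A i j • P.L (S j).1 + τ • ∑ j, T.Abar i j • P.N (S j).1 (S j).2 ∧
    (S i).2 = r + τ * ∑ j, T.Abar i j * P.Ntilde (S j).1 (S j).2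
  have key : ∃! S, ∀ i, Rel i S := by
    refine existsUnique_of_triangular ?_ ?_
    · rintro i S S' hSS ⟨h1, h2, h3⟩
      have e1 : ∀ j, T.A i j • P.L (S j).1 = T.A i j • P.L (S' j).1 := fun j => by
        rcases le_or_gt j i with hj | hj
        · rw [hSS j hj]
        · simp [T.A_lower i j hj]
      have e2 : ∀ j, T.Abar i j • P.N (S j).1 (S j).2 = T.Abar i j • P.N (S' j).1 (S' j).2 :=
        fun j => by
          rcases le_or_gt j i with hj | hj
          · rw [hSS j hj]
          · simp [T.Abar_strictLower i j hj.le]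
      have e3 : ∀ j, T.Abar i j * P.Ntilde (S j).1 (S j).2 =
          T.Abar i j * P.Ntilde (S' j).1 (S' j).2 := fun j => by
        rcases le_or_gt j i with hj | hj
        · rw [hSS j hj]
        · simp [T.Abar_strictLower i j hj.le]
      simp only [e1, e2, e3, hSS i le_rfl] at h1 h2 h3
      exact ⟨h1, h2, h3⟩
    · intro i S hS
      let f := u + τ • ∑ j ∈ Finset.Iio i, T.A i j • P.L (S j).1
        + τ • ∑ j ∈ Finset.Iio i, T.Abar i j • P.N (S j).1 (S j).2
      let q := r + τ * ∑ j ∈ Finset.Iio i, T.Abar i j * P.Ntilde (S j).1 (S j).2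
      have hf : P.SmoothPeriodic f := by
        refine (hu.add (SmoothPeriodic.smul _ (.sum fun j hj => ?_))).add
          (SmoothPeriodic.smul _ (.sum fun j hj => ?_))
        · exact (hS j (Finset.mem_Iio.1 hj)).1.L.smul _
        · exact ((hS j (Finset.mem_Iio.1 hj)).1.N _).smul _
      -- Once the earlier stages are fixed, the function component solves a resolvent equation with
      -- known data f, and the scalar component is the known number q.
      have hiff : ∀ x, Rel i (Function.update S i x) ↔
          (P.SmoothPeriodic x.1 ∧ x.1 = f + (τ * T.A i i) • P.L x.1) ∧ x.2 = q := by
        intro x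
        have hne : ∀ j ∈ Finset.Iio i, Function.update S i x j = S j := fun j hj =>
          Function.update_of_ne (Finset.mem_Iio.1 hj).ne _ _
        have e1 : ∑ j ∈ Finset.Iio i, T.A i j • P.L (Function.update S i x j).1 =
            ∑ j ∈ Finset.Iio i, T.A i j • P.L (S j).1 :=
          Finset.sum_congr rfl fun j hj => by rw [hne j hj]
        have e2 : ∑ j ∈ Finset.Iio i, T.Abar i j • P.N (Function.update S i x j).1
            (Function.update S i x j).2 =
            ∑ j ∈ Finset.Iio i, T.Abar i j • P.N (S j).1 (S j).2 :=
          Finset.sum_congr rfl fun j hj => by rw [hne j hj]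
        have e3 : ∑ j ∈ Finset.Iio i, T.Abar i j * P.Ntilde (Function.update S i x j).1
            (Function.update S i x j).2 =
            ∑ j ∈ Finset.Iio i, T.Abar i j * P.Ntilde (S j).1 (S j).2 :=
          Finset.sum_congr rfl fun j hj => by rw [hne j hj]
        simp only [Rel]
        rw [Fin.sum_eq_sum_Iio_add i (g := fun j => T.A i j • P.L (Function.update S i x j).1)
            fun j hj => by simp [T.A_lower i j hj],
          Fin.sum_eq_sum_Iio_add i (g := fun j => T.Abar i j • P.N (Function.update S i x j).1
            (Function.update S i x j).2) fun j hj => by simp [T.Abar_strictLower i j hj.le],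
          Fin.sum_eq_sum_Iio_add i (g := fun j => T.Abar i j * P.Ntilde (Function.update S i x j).1
            (Function.update S i x j).2) fun j hj => by simp [T.Abar_strictLower i j hj.le],
          e1, e2, e3]
        simp only [Function.update_self, T.Abar_strictLower i i le_rfl, zero_smul, zero_mul,
          add_zero, smul_add, smul_smul, f, q]
        rw [and_assoc, add_right_comm u _ (τ • _), ← add_assoc, add_right_comm u (τ • _) (τ • _)]
      obtain ⟨v, hv, hv'⟩ := existsUnique_resolvent hf (mul_nonneg hτ (hdiag i))
      refine ⟨(v, q), (hiff _).2 ⟨hv, rfl⟩, fun y hy => ?_⟩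
      obtain ⟨h1, h2⟩ := (hiff _).1 hy
      exact Prod.ext (hv' _ h1) h2
  obtain ⟨S, hS, hS'⟩ := key
  refine ⟨(fun i => (S i).1, fun i => (S i).2), ⟨fun i => (hS i).1, fun i => (hS i).2.1,
    fun i => (hS i).2.2⟩, ?_⟩
  rintro ⟨U, R⟩ h
  have := hS' (fun i => (U i, R i)) fun i => ⟨h.smooth i, h.U_eq i, h.R_eq i⟩
  rw [← this]

section Families

variable {ι : Type*} {l : Filter ι} {τ r : ι → ℝ} {u : ι → EuclideanSpace ℝ (Fin d) → ℝ}
  {U : ι → Fin s → EuclideanSpace ℝ (Fin d) → ℝ} {R : ι → Fin s → ℝ} {δ : ℝ} {ρ : ℝ → ℝ}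

theorem isBigO_one_of_tendsto (hτ : Tendsto τ l (𝓝[>] 0)) : τ =O[l] fun _ => (1 : ℝ) :=
  (hτ.mono_right nhdsWithin_le_nhds).isBigO_one ℝ

theorem UnifO.isBigO {c : ι → ℝ} {g : ι → ℝ} (h : UnifO P l (fun i _ => c i) g) : c =O[l] g :=
  h.eval 0

theorem UnifEq.of_left_right {V W : ι → EuclideanSpace ℝ (Fin d) → ℝ} {g : ι → ℝ}
    (hV : UnifO P l V fun _ => 1) (hW : UnifO P l W fun _ => 1)
    (h : UnifO P l (fun i => V i - W i) g) :
    UnifEq P l g fun z => cond z.2 (V z.1) (W z.1) :=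
  ⟨hV, hW, h⟩

theorem UnifEq.of_const {a b : ι → ℝ} {g : ι → ℝ}
    (ha : a =O[l] fun _ => (1 : ℝ)) (hb : b =O[l] fun _ => (1 : ℝ))
    (h : (fun i => a i - b i) =O[l] g) :
    UnifEq P l g fun z _ => cond z.2 (a z.1) (b z.1) :=
  ⟨.const ha, .const hb, .const h⟩

/-- A family of steps with bounded stages, written with a regularized inverse square root. -/
structure BoundedStages (P : PhaseField d) (T : IMEXTableau s) (l : Filter ι) (τ : ι → ℝ)
    (u : ι → EuclideanSpace ℝ (Fin d) → ℝ) (r : ι → ℝ)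
    (U : ι → Fin s → EuclideanSpace ℝ (Fin d) → ℝ) (R : ι → Fin s → ℝ) (ρ : ℝ → ℝ) : Prop where
  smooth_rho : ContDiff ℝ ∞ ρ
  tau : Tendsto τ l (𝓝[>] 0)
  u_bdd : UnifO P l u fun _ => 1
  r_bdd : r =O[l] fun _ => (1 : ℝ)
  U_bdd : ∀ j, UnifO P l (fun i => U i j) fun _ => 1
  R_bdd : ∀ j, (fun i => R i j) =O[l] fun _ => (1 : ℝ)
  U_eq : ∀ᶠ i in l, ∀ j, U i j = u i + τ i • (∑ k, T.A j k • P.L (U i k)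
    + ∑ k, T.Abar j k • P.Nreg ρ (U i k) (R i k))
  R_eq : ∀ᶠ i in l, ∀ j, R i j = r i + τ i * ∑ k, T.Abar j k * P.Ntildereg ρ (U i k) (R i k)

/-- The three claims are proved together by induction on the stage. The lower bound on the potential
at earlier stages lets the regularized operators replace the original ones, whence the data of the
current resolvent problem are bounded. The resolvent passes this bound on to the stage, and the
stage is then so close to u that at least half of the lower bound δ survives. -/
theorem stage_bounds (hdiag : ∀ i, 0 ≤ T.A i i) (hδ : 0 < δ) (hρ : ContDiff ℝ ∞ ρ)
    (hρ' : ∀ q, δ / 2 ≤ q → ρ q = 1 / √q) (hτ : Tendsto τ l (𝓝[>] 0))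
    (hu : UnifO P l u fun _ => 1) (hr : r =O[l] fun _ => (1 : ℝ))
    (hpot : ∀ᶠ i in l, δ ≤ P.potential (u i))
    (hS : ∀ᶠ i in l, P.IsStages T (τ i) (u i) (r i) (U i) (R i)) (j : Fin s) :
    UnifO P l (fun i => U i j) (fun _ => 1) ∧ ((fun i => R i j) =O[l] fun _ => (1 : ℝ)) ∧
      ∀ᶠ i in l, δ / 2 ≤ P.potential (U i j) := by
  have hτ1 := isBigO_one_of_tendsto hτ
  have hτpos : ∀ᶠ i in l, 0 < τ i := hτ.eventually self_mem_nhdsWithin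
  have hb := isDiffAlgebra_bdd P l
  induction j using WellFoundedLT.induction with
  | ind j ih =>
    have hN : UnifO P l (fun i => ∑ k ∈ Finset.Iio j, T.Abar j k • P.Nreg ρ (U i k) (R i k))
        fun _ => 1 := hb.sum _ fun k hk => hb.smul (hb.const _) (hb.Nreg hρ
          (ih k (Finset.mem_Iio.1 hk)).1 (.const (ih k (Finset.mem_Iio.1 hk)).2.1))
    have hL : UnifO P l (fun i => ∑ k ∈ Finset.Iio j, T.A j k • P.L (U i k)) fun _ => 1 :=
      hb.sum _ fun k hk => hb.smul (hb.const _) (hb.L (ih k (Finset.mem_Iio.1 hk)).1)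
    have hNt : UnifO P l (fun i _ => ∑ k ∈ Finset.Iio j,
        T.Abar j k * P.Ntildereg ρ (U i k) (R i k)) fun _ => 1 :=
      hb.sum' _ fun k hk => hb.mul' (hb.const _) (hb.Ntildereg hρ
        (ih k (Finset.mem_Iio.1 hk)).1 (.const (ih k (Finset.mem_Iio.1 hk)).2.1))
    have hpos : ∀ᶠ i in l, ∀ k ∈ Finset.Iio j, δ / 2 ≤ P.potential (U i k) :=
      (Filter.eventually_all_finset _).2 fun k hk => (ih k (Finset.mem_Iio.1 hk)).2.2
    have hUeq : ∀ᶠ i in l, U i j = u i + τ i • (∑ k ∈ Finset.Iio j, T.A j k • P.L (U i k)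
        + ∑ k ∈ Finset.Iio j, T.Abar j k • P.Nreg ρ (U i k) (R i k))
        + (τ i * T.A j j) • P.L (U i j) := by
      filter_upwards [hS, hpos] with i h1 h2
      have h3 := h1.U_eq j
      rw [Fin.sum_eq_sum_Iio_add j (g := fun k => T.A j k • P.L (U i k))
          fun k hk => by simp [T.A_lower j k hk],
        Fin.sum_eq_sum_Iio_add j (g := fun k => T.Abar j k • P.N (U i k) (R i k))
          fun k hk => by simp [T.Abar_strictLower j k hk.le], T.Abar_strictLower j j le_rfl,
        zero_smul, add_zero] at h3
      have e : ∑ k ∈ Finset.Iio j, T.Abar j k • P.Nreg ρ (U i k) (R i k) =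
          ∑ k ∈ Finset.Iio j, T.Abar j k • P.N (U i k) (R i k) :=
        Finset.sum_congr rfl fun k hk => by rw [Nreg_eq (h1.smooth k) (hρ' _ (h2 k hk))]
      conv_lhs => rw [h3]
      rw [e]
      simp only [smul_add, mul_smul]
      abel
    have hReq : ∀ᶠ i in l, R i j = r i + τ i * ∑ k ∈ Finset.Iio j,
        T.Abar j k * P.Ntildereg ρ (U i k) (R i k) := by
      filter_upwards [hS, hpos] with i h1 h2
      have h3 := h1.R_eq j
      rw [Fin.sum_eq_sum_Iio_add j (g := fun k => T.Abar j k * P.Ntilde (U i k) (R i k))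
          fun k hk => by simp [T.Abar_strictLower j k hk.le], T.Abar_strictLower j j le_rfl,
        zero_mul, add_zero] at h3
      have e : ∑ k ∈ Finset.Iio j, T.Abar j k * P.Ntildereg ρ (U i k) (R i k) =
          ∑ k ∈ Finset.Iio j, T.Abar j k * P.Ntilde (U i k) (R i k) :=
        Finset.sum_congr rfl fun k hk => by rw [Ntildereg_eq (h1.smooth k) (hρ' _ (h2 k hk))]
      rw [h3, e]
    have hτb : UnifO P l (fun i _ => τ i) fun _ => 1 := .const hτ1
    have hU : UnifO P l (fun i => U i j) fun _ => 1 := by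
      refine UnifO.resolvent (hb.add hu (hb.smul hτb (hb.add hL hN)))
        (θ := fun i => τ i * T.A j j) ?_ ?_
      · filter_upwards [hτpos] with i hi using mul_nonneg hi.le (hdiag j)
      · filter_upwards [hS, hUeq] with i h1 h2 using ⟨h1.smooth j, h2⟩
    have hR : UnifO P l (fun i _ => R i j) fun _ => 1 := by
      refine (hb.add' (.const hr) (hb.mul' hτb hNt)).congr ?_
      filter_upwards [hReq] with i hi
      rw [← hi]
    refine ⟨hU, hR.isBigO, ?_⟩
    -- Knowing that all derivatives of the current stage are bounded, the implicit term τ aⱼⱼ L(Uⱼ)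
    -- may be treated like an explicit one.
    have hdiff : UnifO P l (fun i => U i j - u i) τ := by
      have h1 := UnifO.smul (isBigO_refl τ l)
        (hb.add (hb.add hL hN) (hb.smul (hb.const (T.A j j)) (hb.L hU)))
      simp only [mul_one] at h1
      refine h1.congr ?_
      filter_upwards [hUeq] with i hi
      conv_rhs => rw [hi]
      simp only [smul_add, mul_smul]
      abel
    have hpd := ((isDiffAlgebra_unifEq P l τ).potential (.of_left_right hU hu hdiff)).diff
    have hlim : Tendsto (fun i => P.potential (U i j) - P.potential (u i)) l (𝓝 0) :=
      (UnifO.isBigO (P := P) hpd).trans_tendsto (hτ.mono_right nhdsWithin_le_nhds)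
    filter_upwards [hpot, hlim.eventually (Ioi_mem_nhds (show -(δ / 2) < 0 by linarith))]
      with i h1 h2
    have : -(δ / 2) < P.potential (U i j) - P.potential (u i) := h2
    linarith

theorem boundedStages (hdiag : ∀ i, 0 ≤ T.A i i) (hδ : 0 < δ) (hρ : ContDiff ℝ ∞ ρ)
    (hρ' : ∀ q, δ / 2 ≤ q → ρ q = 1 / √q) (hτ : Tendsto τ l (𝓝[>] 0))
    (hu : UnifO P l u fun _ => 1) (hr : r =O[l] fun _ => (1 : ℝ))
    (hpot : ∀ᶠ i in l, δ ≤ P.potential (u i))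
    (hS : ∀ᶠ i in l, P.IsStages T (τ i) (u i) (r i) (U i) (R i)) :
    P.BoundedStages T l τ u r U R ρ := by
  have h := stage_bounds hdiag hδ hρ hρ' hτ hu hr hpot hS
  have hpos : ∀ᶠ i in l, ∀ j, δ / 2 ≤ P.potential (U i j) := eventually_all.2 fun j => (h j).2.2
  refine ⟨hρ, hτ, hu, hr, fun j => (h j).1, fun j => (h j).2.1, ?_, ?_⟩
  · filter_upwards [hS, hpos] with i h1 h2 j
    nth_rewrite 1 [h1.U_eq j]
    have e : ∑ k, T.Abar j k • P.Nreg ρ (U i k) (R i k) =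
        ∑ k, T.Abar j k • P.N (U i k) (R i k) :=
      Finset.sum_congr rfl fun k _ => by rw [Nreg_eq (h1.smooth k) (hρ' _ (h2 k))]
    rw [e, smul_add, add_assoc]
  · filter_upwards [hS, hpos] with i h1 h2 j
    have e : ∑ k, T.Abar j k * P.Ntildereg ρ (U i k) (R i k) =
        ∑ k, T.Abar j k * P.Ntilde (U i k) (R i k) :=
      Finset.sum_congr rfl fun k _ => by rw [Ntildereg_eq (h1.smooth k) (hρ' _ (h2 k))]
    rw [h1.R_eq j, e]

namespace BoundedStages

theorem Nreg_bdd (h : P.BoundedStages T l τ u r U R ρ) (j : Fin s) :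
    UnifO P l (fun i => P.Nreg ρ (U i j) (R i j)) fun _ => 1 :=
  (isDiffAlgebra_bdd P l).Nreg h.smooth_rho (h.U_bdd j) (.const (h.R_bdd j))

theorem Ntildereg_bdd (h : P.BoundedStages T l τ u r U R ρ) (j : Fin s) :
    UnifO P l (fun i _ => P.Ntildereg ρ (U i j) (R i j)) fun _ => 1 :=
  (isDiffAlgebra_bdd P l).Ntildereg h.smooth_rho (h.U_bdd j) (.const (h.R_bdd j))

theorem U_sub (h : P.BoundedStages T l τ u r U R ρ) (j : Fin s) :
    UnifO P l (fun i => U i j - u i) τ := by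
  have hb := isDiffAlgebra_bdd P l
  have h1 := UnifO.smul (isBigO_refl τ l) (hb.add
    (hb.sum Finset.univ fun k _ => hb.smul (hb.const (T.A j k)) (hb.L (h.U_bdd k)))
    (hb.sum Finset.univ fun k _ => hb.smul (hb.const (T.Abar j k)) (h.Nreg_bdd k)))
  simp only [mul_one] at h1
  refine h1.congr ?_
  filter_upwards [h.U_eq] with i hi
  nth_rewrite 1 [hi j]
  rw [add_sub_cancel_left]

theorem R_sub (h : P.BoundedStages T l τ u r U R ρ) (j : Fin s) :
    (fun i => R i j - r i) =O[l] τ := by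
  have hb := isDiffAlgebra_bdd P l
  have h1 := (hb.sum' Finset.univ fun k _ =>
    hb.mul' (hb.const (T.Abar j k)) (h.Ntildereg_bdd k)).isBigO
  have h2 := (isBigO_refl τ l).mul h1
  simp only [mul_one] at h2
  refine h2.congr' ?_ EventuallyEq.rfl
  filter_upwards [h.R_eq] with i hi
  rw [hi j, add_sub_cancel_left]

theorem comp_tendsto {ι' : Type*} {l' : Filter ι'} (h : P.BoundedStages T l τ u r U R ρ)
    {k : ι' → ι} (hk : Tendsto k l' l) : P.BoundedStages T l' (fun i => τ (k i))
      (fun i => u (k i)) (fun i => r (k i)) (fun i => U (k i)) (fun i => R (k i)) ρ where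
  smooth_rho := h.smooth_rho
  tau := h.tau.comp hk
  u_bdd := h.u_bdd.comp_tendsto hk
  r_bdd := h.r_bdd.comp_tendsto hk
  U_bdd j := (h.U_bdd j).comp_tendsto hk
  R_bdd j := (h.R_bdd j).comp_tendsto hk
  U_eq := hk.eventually h.U_eq
  R_eq := hk.eventually h.R_eq

end BoundedStages

end Families

/-- The stages have uniform expansions of arbitrary length in powers of the step size. -/
theorem BoundedStages.expansion {Z : Type*} {l : Filter (ℝ × Z)}
    {u : Z → EuclideanSpace ℝ (Fin d) → ℝ} {r : Z → ℝ}
    {U : ℝ × Z → Fin s → EuclideanSpace ℝ (Fin d) → ℝ} {R : ℝ × Z → Fin s → ℝ} {ρ : ℝ → ℝ}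
    (h : P.BoundedStages T l (fun i => i.1) (fun i => u i.2) (fun i => r i.2) U R ρ) (n : ℕ) :
    (∀ j, Expansion P l n fun i => U i j) ∧ ∀ j, Expansion P l n fun i _ => R i j := by
  have hl := isBigO_one_of_tendsto h.tau
  induction n with
  | zero => exact ⟨h.U_bdd, fun j => .const (h.R_bdd j)⟩
  | succ n ih =>
    have ha := Expansion.isDiffAlgebra hl P n
    have ha1 := Expansion.isDiffAlgebra hl P (n + 1)
    refine ⟨fun j => ?_, fun j => ?_⟩
    -- Expansions of length n on the right-hand side of the stage equation become expansions of
    -- length n + 1 of the stage because of the prefactor τ. The implicit term needs no separate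
    -- treatment, as the boundedness that starts the induction is already known.
    · refine (ha1.add (Expansion.of_param h.u_bdd (n + 1)) (Expansion.smul_fst
        (ha.add (ha.sum Finset.univ fun k _ => ha.smul (ha.const (T.A j k)) (ha.L (ih.1 k)))
        (ha.sum Finset.univ fun k _ => ha.smul (ha.const (T.Abar j k))
          (ha.Nreg h.smooth_rho (ih.1 k) (ih.2 k)))))).congr ?_
      filter_upwards [h.U_eq] with i hi
      exact (hi j).symm
    · refine (ha1.add (Expansion.of_param (c := fun z _ => r z) (.const h.r_bdd) (n + 1))
        (Expansion.smul_fst (ha.sum' Finset.univ fun k _ => ha.mul' (ha.const (T.Abar j k))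
          (ha.Ntildereg h.smooth_rho (ih.1 k) (ih.2 k))))).congr ?_
      filter_upwards [h.R_eq] with i hi
      ext x
      exact (hi j).symm

end PhaseField

/-! ### Interpolation and finite-dimensional models -/

/-- A finite-dimensional space of functions admits interpolation points with a nodal basis. -/
theorem Submodule.exists_interpolation {α : Type*} (S : Submodule ℝ (α → ℝ))
    [FiniteDimensional ℝ S] : ∃ (m : ℕ) (x : Fin m → α) (e : Fin m → α → ℝ),
      (∀ k, e k ∈ S) ∧ ∀ v ∈ S, v = ∑ k, v (x k) • e k := by
  classical
  let ev : α → Module.Dual ℝ S := fun a => (LinearMap.proj a).comp S.subtype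
  -- A function in S on which every point evaluation vanishes is zero, so the evaluations span the
  -- dual. A basis can be selected among them, and its dual basis in S is the nodal basis.
  have hspan : ⊤ ≤ Submodule.span ℝ (Set.range ev) := by
    rw [← Subspace.dualCoannihilator_dualAnnihilator_eq (W := Submodule.span ℝ (Set.range ev)),
      top_le_iff, ← Submodule.dualAnnihilator_bot]
    congr 1
    rw [eq_bot_iff]
    intro v hv
    rw [Submodule.mem_bot]
    ext a
    exact (Submodule.mem_dualCoannihilator _).1 hv (ev a) (Submodule.subset_span ⟨a, rfl⟩)
  let b := Module.Basis.ofSpan hspan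
  have hb : ∀ i, ∃ a, ev a = b i := fun i =>
    Module.Basis.ofSpan_subset hspan (Set.mem_range_self i)
  have : Fintype _ := FiniteDimensional.fintypeBasisIndex b
  choose x hx using hb
  let e := fun i => (Module.evalEquiv ℝ S).symm (b.dualBasis i)
  have he : ∀ i j, ev (x i) (e j) = if i = j then 1 else 0 := fun i j => by
    have h1 : Module.evalEquiv ℝ S (e j) (b i) = b.dualBasis j (b i) := by simp [e]
    rw [hx]
    rw [b.dualBasis_apply_self] at h1
    simpa [eq_comm] using h1
  have hv : ∀ v : S, v = ∑ i, (v : α → ℝ) (x i) • e i := fun v => by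
    have h2 : ∀ φ : Module.Dual ℝ S, φ v = φ (∑ i, (v : α → ℝ) (x i) • e i) := by
      intro φ
      have h3 : Module.evalEquiv ℝ S v =
          Module.evalEquiv ℝ S (∑ i, (v : α → ℝ) (x i) • e i) := by
        refine b.ext fun i => ?_
        simp only [Module.evalEquiv_apply, Module.Dual.eval_apply]
        rw [← hx i, map_sum]
        simp only [map_smul, he]
        simp [ev]
      simpa using LinearMap.congr_fun h3 φ
    exact (Module.forall_dual_apply_eq_zero_iff ℝ _).1 (fun φ => by
      rw [map_sub, h2 φ, sub_self]) |> sub_eq_zero.1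
  let σ := Fintype.equivFin (↑((linearIndepOn_empty ℝ id).extend (Set.empty_subset (Set.range ev))))
  refine ⟨_, fun k => x (σ.symm k), fun k => (e (σ.symm k) : α → ℝ), fun k => (e _).2,
    fun v hvS => ?_⟩
  have h4 := congrArg Subtype.val (hv ⟨v, hvS⟩)
  rw [σ.symm.sum_comp fun i => v (x i) • (e i : α → ℝ)]
  simpa using h4

namespace PhaseField

variable {d s : ℕ} {P : PhaseField d} {T : IMEXTableau s}

/-- The trivial resolvent equation with θ = 0 already contains the global bounds on the derivatives
of a smooth periodic function. -/
theorem UnifO.of_smoothPeriodic {ι : Type*} {l : Filter ι} {v : EuclideanSpace ℝ (Fin d) → ℝ}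
    (hv : P.SmoothPeriodic v) : UnifO P l (fun _ => v) fun _ => 1 := by
  refine ⟨Eventually.of_forall fun _ => hv, fun k => ?_⟩
  obtain ⟨M, hM⟩ := (hv.bessel_iterate (d + k)).exists_bound
  exact ⟨_, Eventually.of_forall fun i x =>
    (norm_iteratedFDeriv_resolvent_le hv hv le_rfl (by simp) k hM x).trans
      (le_of_eq (by rw [abs_one, mul_one]))⟩

/-- Families of functions that are jointly smooth in the parameter and the point. -/
theorem isDiffAlgebra_contDiff (P : PhaseField d) (W : Type) [NormedAddCommGroup W]
    [NormedSpace ℝ W] [ProperSpace W] :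
    IsDiffAlgebra P fun V : W → EuclideanSpace ℝ (Fin d) → ℝ =>
      ContDiff ℝ ∞ fun z : W × EuclideanSpace ℝ (Fin d) => V z.1 z.2 where
  const c := contDiff_const
  add := ContDiff.add
  mul := ContDiff.mul
  comp hΦ hV := hΦ.comp hV
  integral {V} hV := (hV.setIntegral_param volume P.isBounded_Ω).comp contDiff_fst
  lap {V} hV := by
    have hpd : ∀ {V : W → EuclideanSpace ℝ (Fin d) → ℝ} (i : Fin d),
        (ContDiff ℝ ∞ fun z : W × EuclideanSpace ℝ (Fin d) => V z.1 z.2) →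
        ContDiff ℝ ∞ fun z : W × EuclideanSpace ℝ (Fin d) => pd i (V z.1) z.2 := by
      intro V i hV
      have h1 : ContDiff ℝ ∞ fun z : W × EuclideanSpace ℝ (Fin d) =>
          fderiv ℝ (V z.1) z.2 := by
        refine ContDiff.fderiv (m := ∞)
          (f := fun (z : W × EuclideanSpace ℝ (Fin d)) x => V z.1 x) ?_ contDiff_snd (by simp)
        exact hV.comp ((contDiff_fst.comp contDiff_fst).prodMk contDiff_snd)
      exact h1.clm_apply contDiff_const
    have h2 : ∀ y, ContDiff ℝ ∞ (V y) := fun y => hV.comp (contDiff_const.prodMk contDiff_id)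
    simp_rw [fun y => lap_eq_sum (h2 y), Finset.sum_apply]
    exact ContDiff.sum fun i _ => hpd (V := fun y => pd i (V y)) i (hpd i hV)

namespace Expansion

variable {Z : Type*} {l : Filter (ℝ × Z)} {V : ℝ × Z → EuclideanSpace ℝ (Fin d) → ℝ} {n : ℕ}
  {z : Z}

/-- For a fixed parameter, an expansion is a Taylor polynomial with a remainder. -/
theorem exists_taylor (h : Expansion P l n V) (hz : Tendsto (fun τ : ℝ => (τ, z)) (𝓝[>] 0) l) :
    ∃ c : ℕ → EuclideanSpace ℝ (Fin d) → ℝ, (∀ k, P.SmoothPeriodic (c k)) ∧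
      UnifO P (𝓝[>] 0) (fun τ => V (τ, z) - ∑ k ∈ Finset.range n, τ ^ k • c k)
        fun τ => τ ^ n := by
  induction n generalizing V with
  | zero => exact ⟨fun _ _ => 0, fun k => .const 0, by simpa using UnifO.comp_tendsto h hz⟩
  | succ n ih =>
    obtain ⟨c, W, hc, hW, he⟩ := h
    obtain ⟨c', hc', hr⟩ := ih hW
    obtain ⟨_, hcz⟩ := (hz.eventually hc.smooth).exists
    refine ⟨fun k => Nat.casesOn k (c z) c', fun k => ?_, ?_⟩
    · cases k with
      | zero => exact hcz
      | succ k => exact hc' k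
    · have h1 := UnifO.smul (isBigO_refl (fun τ : ℝ => τ) (𝓝[>] 0)) hr
      simp_rw [← pow_succ'] at h1
      refine h1.congr ?_
      filter_upwards [hz.eventually he] with τ hτ
      rw [hτ, Finset.sum_range_succ']
      change _ = c z + τ • W (τ, z) - (∑ k ∈ Finset.range n, τ ^ (k + 1) • c' k + τ ^ 0 • c z)
      simp only [pow_zero, one_smul, pow_succ', mul_smul, smul_sub, Finset.smul_sum]
      abel

/-- For a fixed parameter, finitely many expansions are reproduced by interpolation up to the
order of the expansions. -/
theorem exists_interpolation {κ : Type*} [Finite κ] {V : κ → ℝ × Z → EuclideanSpace ℝ (Fin d) → ℝ}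
    (h : ∀ j, Expansion P l n (V j)) (hz : Tendsto (fun τ : ℝ => (τ, z)) (𝓝[>] 0) l) :
    ∃ (m : ℕ) (x : Fin m → EuclideanSpace ℝ (Fin d)) (e : Fin m → EuclideanSpace ℝ (Fin d) → ℝ),
      (∀ k, P.SmoothPeriodic (e k)) ∧ ∀ j, UnifO P (𝓝[>] 0)
        (fun τ => V j (τ, z) - ∑ k, V j (τ, z) (x k) • e k) fun τ => τ ^ n := by
  choose c hc hr using fun j => (h j).exists_taylor hz
  -- Interpolation is exact on the span of the Taylor coefficients. Hence it reproduces the Taylor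
  -- polynomials, and its error is that of the remainders and their nodal values.
  let S := Submodule.span ℝ (Set.range fun q : κ × Fin n => c q.1 q.2)
  have hS : ∀ v ∈ S, P.SmoothPeriodic v := by
    intro v hv
    induction hv using Submodule.span_induction with
    | mem v hv => obtain ⟨q, rfl⟩ := hv; exact hc _ _
    | zero => exact .const 0
    | add v w _ _ hv hw => exact hv.add hw
    | smul a v _ hv => exact hv.smul a
  have : FiniteDimensional ℝ S := FiniteDimensional.span_of_finite ℝ (Set.finite_range _)
  obtain ⟨m, x, e, he, hx⟩ := S.exists_interpolation
  refine ⟨m, x, e, fun k => hS _ (he k), fun j => ?_⟩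
  have hw : ∀ τ : ℝ, ∑ k ∈ Finset.range n, τ ^ k • c j k ∈ S := fun τ =>
    S.sum_mem fun k hk => S.smul_mem _ (Submodule.subset_span
      ⟨(j, ⟨k, Finset.mem_range.1 hk⟩), rfl⟩)
  have h1 : UnifO P (𝓝[>] 0) (fun τ : ℝ => ∑ k, (V j (τ, z) -
      ∑ k ∈ Finset.range n, τ ^ k • c j k) (x k) • e k) fun τ => τ ^ n :=
    UnifO.sum fun k _ => by
      simpa using UnifO.smul ((hr j).eval (x k)) (UnifO.of_smoothPeriodic (hS _ (he k)))
  refine ((hr j).sub h1).congr (Eventually.of_forall fun τ => ?_)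
  simp only [Pi.sub_apply, sub_smul, Finset.sum_sub_distrib]
  rw [← hx _ (hw τ)]
  abel

/-- A pointwise estimate of a quantity with a uniform expansion is uniform. -/
theorem isBigO_of_pointwise {K : Set Z} (h : Expansion P (𝓝[>] (0 : ℝ) ×ˢ 𝓟 K) n V)
    (x : EuclideanSpace ℝ (Fin d))
    (hz : ∀ z ∈ K, (fun τ => V (τ, z) x) =O[𝓝[>] 0] fun τ : ℝ => τ ^ n) :
    (fun i => V i x) =O[𝓝[>] (0 : ℝ) ×ˢ 𝓟 K] fun i => i.1 ^ n := by
  have hl : (fun i : ℝ × Z => i.1) =O[𝓝[>] (0 : ℝ) ×ˢ 𝓟 K] fun _ => (1 : ℝ) :=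
    isBigO_one_of_tendsto tendsto_fst
  induction n generalizing V with
  | zero => simpa using UnifO.eval h x
  | succ n ih =>
    obtain ⟨c, W, hc, hW, he⟩ := h
    have hK : ∀ z ∈ K, Tendsto (fun τ : ℝ => (τ, z)) (𝓝[>] 0) (𝓝[>] (0 : ℝ) ×ˢ 𝓟 K) :=
      fun z hzK => tendsto_id.prodMk (tendsto_principal.2 (Eventually.of_forall fun _ => hzK))
    have hτ0 : Tendsto (fun τ : ℝ => τ) (𝓝[>] 0) (𝓝 0) := nhdsWithin_le_nhds
    -- The leading coefficient is the limit of V as τ → 0 with z fixed, and the pointwise estimate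
    -- makes this limit zero. One factor τ can then be divided out.
    have hc0 : ∀ z ∈ K, c z x = 0 := fun z hzK => by
      have h1 : Tendsto (fun τ : ℝ => V (τ, z) x) (𝓝[>] 0) (𝓝 0) :=
        (hz z hzK).trans_tendsto (by simpa using hτ0.pow (n + 1))
      have h2 : (fun τ : ℝ => τ * W (τ, z) x) =O[𝓝[>] 0] fun τ : ℝ => τ * 1 :=
        (isBigO_refl _ _).mul (((hW.unifO hl).eval x).comp_tendsto (hK z hzK))
      have h3 : Tendsto (fun τ : ℝ => τ * W (τ, z) x) (𝓝[>] 0) (𝓝 0) :=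
        h2.trans_tendsto (by simpa using hτ0)
      refine tendsto_nhds_unique (tendsto_const_nhds (f := 𝓝[>] (0 : ℝ))) ((h1.sub h3).congr' ?_) |>.trans
        (sub_self 0)
      filter_upwards [(hK z hzK).eventually he] with τ hτ
      rw [hτ]; simp
    have hW' := ih hW fun z hzK => by
      have h1 := (isBigO_refl (fun τ : ℝ => τ⁻¹) (𝓝[>] 0)).mul (hz z hzK)
      refine h1.congr' ?_ ?_
      · filter_upwards [(hK z hzK).eventually he, self_mem_nhdsWithin] with τ hτ hpos
        have : τ ≠ 0 := ne_of_gt hpos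
        rw [hτ]
        simp [hc0 z hzK, this]
      · filter_upwards [self_mem_nhdsWithin] with τ hpos
        have : τ ≠ 0 := ne_of_gt hpos
        rw [pow_succ', inv_mul_cancel_left₀ this]
    have hKe : ∀ᶠ i in 𝓝[>] (0 : ℝ) ×ˢ 𝓟 K, i.2 ∈ K :=
      tendsto_snd.eventually (mem_principal_self K)
    refine ((isBigO_refl (fun i : ℝ × Z => i.1) _).mul hW').congr' ?_
      (Eventually.of_forall fun i => (pow_succ' _ _).symm)
    filter_upwards [he, hKe] with i h1 h2
    rw [h1]
    simp [hc0 _ h2]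

end Expansion

end PhaseField

namespace PhaseField

variable {d s m p : ℕ} {P : PhaseField d} {T : IMEXTableau s} {ρ : ℝ → ℝ}
  {x : Fin m → EuclideanSpace ℝ (Fin d)} {e : Fin m → EuclideanSpace ℝ (Fin d) → ℝ}

/-- The function with prescribed nodal values. -/
noncomputable def nodal (e : Fin m → EuclideanSpace ℝ (Fin d) → ℝ) :
    (Fin m → ℝ) →ₗ[ℝ] EuclideanSpace ℝ (Fin d) → ℝ :=
  Fintype.linearCombination ℝ e

theorem nodal_apply (c : Fin m → ℝ) : nodal e c = ∑ k, c k • e k := rfl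

theorem SmoothPeriodic.nodal (he : ∀ k, P.SmoothPeriodic (e k)) (c : Fin m → ℝ) :
    P.SmoothPeriodic (nodal e c) :=
  SmoothPeriodic.sum (t := Finset.univ) (f := fun k => c k • e k) fun k _ => (he k).smul _

theorem contDiff_nodal (he : ∀ k, P.SmoothPeriodic (e k)) :
    ContDiff ℝ ∞ fun z : ((Fin m → ℝ) × ℝ) × EuclideanSpace ℝ (Fin d) => nodal e z.1.1 z.2 := by
  simp only [nodal_apply, Finset.sum_apply, Pi.smul_apply, smul_eq_mul]
  refine ContDiff.sum fun k _ => ContDiff.mul ?_ ((he k).1.comp contDiff_snd)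
  exact (contDiff_apply ℝ ℝ k).comp (contDiff_fst.comp contDiff_fst)

theorem UnifO.nodal {ι : Type*} {l : Filter ι} {V : ι → EuclideanSpace ℝ (Fin d) → ℝ} {g : ι → ℝ}
    (he : ∀ k, P.SmoothPeriodic (e k)) (hV : UnifO P l V g) :
    UnifO P l (fun i => PhaseField.nodal e fun k => V i (x k)) g :=
  UnifO.sum (t := Finset.univ) (F := fun k i => V i (x k) • e k) fun k _ => by
    simpa using UnifO.smul (hV.eval (x k)) (UnifO.of_smoothPeriodic (he k))

theorem UnifEq.diag {ι : Type*} {l : Filter ι} {V : ι → EuclideanSpace ℝ (Fin d) → ℝ} {g : ι → ℝ}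
    (hV : UnifO P l V fun _ => 1) : UnifEq P l g fun z => V z.1 :=
  ⟨hV, hV, UnifO.zero.congr (Eventually.of_forall fun _ => (sub_self _).symm)⟩

/-- The second member of the pair is replaced by its interpolant, at the price of the interpolation
error of the first member only. Thus reproduction has to be known for the true quantities and not
for those of the model. -/
theorem UnifEq.nodal {ι : Type*} {l : Filter ι} {V : ι × Bool → EuclideanSpace ℝ (Fin d) → ℝ}
    {g : ι → ℝ} (he : ∀ k, P.SmoothPeriodic (e k)) (hV : UnifEq P l g V)
    (h : UnifO P l (fun i => V (i, true) - PhaseField.nodal e fun k => V (i, true) (x k)) g) :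
    UnifEq P l g fun z => cond z.2 (V (z.1, true))
      (PhaseField.nodal e fun k => V (z.1, false) (x k)) := by
  refine ⟨hV.left, hV.right.nodal he, (h.add (hV.diff.nodal (x := x) he)).congr
    (Eventually.of_forall fun i => ?_)⟩
  have : (fun k => (V (i, true) - V (i, false)) (x k)) =
    (fun k => V (i, true) (x k)) - fun k => V (i, false) (x k) := rfl
  simp only [this, map_sub, cond_true, cond_false]
  abel

/-- The implicit part of the finite-dimensional model of the flow in nodal coordinates. -/
noncomputable def modelImplicit (P : PhaseField d) (x : Fin m → EuclideanSpace ℝ (Fin d))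
    (e : Fin m → EuclideanSpace ℝ (Fin d) → ℝ) (y : (Fin m → ℝ) × ℝ) : (Fin m → ℝ) × ℝ :=
  (fun k => P.L (nodal e y.1) (x k), 0)

/-- The explicit part of the finite-dimensional model of the flow in nodal coordinates. -/
noncomputable def modelExplicit (P : PhaseField d) (ρ : ℝ → ℝ)
    (x : Fin m → EuclideanSpace ℝ (Fin d))
    (e : Fin m → EuclideanSpace ℝ (Fin d) → ℝ) (y : (Fin m → ℝ) × ℝ) : (Fin m → ℝ) × ℝ :=
  (fun k => P.Nreg ρ (nodal e y.1) y.2 (x k), P.Ntildereg ρ (nodal e y.1) y.2)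

theorem contDiff_modelImplicit (he : ∀ k, P.SmoothPeriodic (e k)) :
    ContDiff ℝ ∞ (P.modelImplicit x e) := by
  have h := (isDiffAlgebra_contDiff P ((Fin m → ℝ) × ℝ)).L (V := fun y => nodal e y.1)
    (contDiff_nodal he)
  exact (contDiff_pi.2 fun k => h.comp (contDiff_id.prodMk contDiff_const)).prodMk contDiff_const

theorem contDiff_modelExplicit (hρ : ContDiff ℝ ∞ ρ) (he : ∀ k, P.SmoothPeriodic (e k)) :
    ContDiff ℝ ∞ (P.modelExplicit ρ x e) := by
  have hc := isDiffAlgebra_contDiff P ((Fin m → ℝ) × ℝ)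
  have hr : ContDiff ℝ ∞ fun z : ((Fin m → ℝ) × ℝ) × EuclideanSpace ℝ (Fin d) => z.1.2 :=
    contDiff_snd.comp contDiff_fst
  have h1 := hc.Nreg (V := fun y => nodal e y.1) (a := fun y => y.2) hρ (contDiff_nodal he) hr
  have h2 := hc.Ntildereg (V := fun y => nodal e y.1) (a := fun y => y.2) hρ (contDiff_nodal he) hr
  exact (contDiff_pi.2 fun k => h1.comp (contDiff_id.prodMk contDiff_const)).prodMk
    (h2.comp (contDiff_id.prodMk (contDiff_const (c := 0))))

/-- Half of this form on the diagonal is the modified energy up to the constant C₀. Its symmetry,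
inherited from Green's identity, is what the energy balance for ordinary differential equations
requires. -/
theorem exists_modelForm (he : ∀ k, P.SmoothPeriodic (e k)) :
    ∃ B : ((Fin m → ℝ) × ℝ) →L[ℝ] ((Fin m → ℝ) × ℝ) →L[ℝ] ℝ, ∀ y y',
      B y y' = -P.ε ^ 2 * P.inner2 (nodal e y.1) (lap (nodal e y'.1)) + 2 * y.2 * y'.2 := by
  have hs := SmoothPeriodic.nodal he
  let q : ((Fin m → ℝ) × ℝ) → ((Fin m → ℝ) × ℝ) → ℝ := fun y y' =>
    -P.ε ^ 2 * P.inner2 (nodal e y.1) (lap (nodal e y'.1)) + 2 * y.2 * y'.2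
  have hadd : ∀ y₁ y₂ y', q (y₁ + y₂) y' = q y₁ y' + q y₂ y' := fun y₁ y₂ y' => by
    simp only [q, Prod.fst_add, Prod.snd_add, map_add]
    rw [inner2_add_left (hs _) (hs _) (hs _).lap]
    ring
  have hsmul : ∀ (c : ℝ) y y', q (c • y) y' = c • q y y' := fun c y y' => by
    simp only [q, Prod.smul_fst, Prod.smul_snd, map_smul]
    rw [inner2_smul_left]
    simp only [smul_eq_mul]
    ring
  have hcomm : ∀ y y', q y y' = q y' y := fun y y' => by
    simp only [q]
    rw [inner2_lap_comm (hs _) (hs _)]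
    ring
  exact ⟨(LinearMap.mk₂ ℝ q hadd hsmul (fun y y₁ y₂ => by simp only [hcomm y, hadd])
    fun c y y' => by simp only [hcomm y, hsmul]).toContinuousBilinearMap, fun y y' => rfl⟩

theorem balanceDefect_model {B : ((Fin m → ℝ) × ℝ) →L[ℝ] ((Fin m → ℝ) × ℝ) →L[ℝ] ℝ}
    (hB : ∀ y y', B y y' =
      -P.ε ^ 2 * P.inner2 (nodal e y.1) (lap (nodal e y'.1)) + 2 * y.2 * y'.2)
    (y₀ : (Fin m → ℝ) × ℝ) (τ : ℝ) (Y : Fin s → (Fin m → ℝ) × ℝ) :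
    T.balanceDefect (P.modelImplicit x e) (P.modelExplicit ρ x e) B y₀ τ Y =
      P.energyDefect τ (nodal e y₀.1) y₀.2 (fun i => nodal e (Y i).1)
        (fun i => nodal e fun k => (T.b i • P.L (nodal e (Y i).1)
          + T.bbar i • P.Nreg ρ (nodal e (Y i).1) (Y i).2) (x k))
        (fun i => (Y i).2) (fun i => T.bbar i * P.Ntildereg ρ (nodal e (Y i).1) (Y i).2) := by
  have hinc : ∀ i, T.increment (P.modelImplicit x e) (P.modelExplicit ρ x e) Y i =
      (fun k => (T.b i • P.L (nodal e (Y i).1)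
          + T.bbar i • P.Nreg ρ (nodal e (Y i).1) (Y i).2) (x k),
        T.bbar i * P.Ntildereg ρ (nodal e (Y i).1) (Y i).2) := fun i => by
    ext <;> simp [IMEXTableau.increment, modelImplicit, modelExplicit]
  unfold IMEXTableau.balanceDefect energyDefect
  simp only [hB, hinc]
  simp only [Prod.fst_sum, Prod.snd_sum, map_sum, Prod.fst_sub, Prod.snd_sub, map_sub]
  ring

/-- The energy balance of a single family of steps whose stages are reproduced by interpolation
up to the order of the method. -/
theorem BoundedStages.isBigO_energyDefect_of_interpolation (hT : T.HasOrder p)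
    {u : EuclideanSpace ℝ (Fin d) → ℝ} {r : ℝ} {U : ℝ → Fin s → EuclideanSpace ℝ (Fin d) → ℝ}
    {R : ℝ → Fin s → ℝ}
    (h : P.BoundedStages T (𝓝[>] 0) (fun τ => τ) (fun _ => u) (fun _ => r) U R ρ)
    (he : ∀ k, P.SmoothPeriodic (e k))
    (hu : UnifO P (𝓝[>] 0) (fun _ => u - nodal e fun k => u (x k)) fun τ : ℝ => τ ^ (p + 1))
    (hU : ∀ j, UnifO P (𝓝[>] 0) (fun τ => U τ j - nodal e fun k => U τ j (x k))
      fun τ : ℝ => τ ^ (p + 1))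
    (hL : ∀ j, UnifO P (𝓝[>] 0) (fun τ => P.L (U τ j) - nodal e fun k => P.L (U τ j) (x k))
      fun τ : ℝ => τ ^ (p + 1))
    (hN : ∀ j, UnifO P (𝓝[>] 0) (fun τ => P.Nreg ρ (U τ j) (R τ j)
      - nodal e fun k => P.Nreg ρ (U τ j) (R τ j) (x k)) fun τ : ℝ => τ ^ (p + 1)) :
    (fun τ => τ * P.energyDefect τ u r (U τ)
      (fun i => T.b i • P.L (U τ i) + T.bbar i • P.Nreg ρ (U τ i) (R τ i)) (R τ)
      (fun i => T.bbar i * P.Ntildereg ρ (U τ i) (R τ i))) =O[𝓝[>] 0]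
      fun τ : ℝ => τ ^ (p + 1) := by
  set g : ℝ → ℝ := fun τ => τ ^ (p + 1)
  have hc := isDiffAlgebra_unifEq P (𝓝[>] (0 : ℝ)) g
  have hτ1 := isBigO_one_of_tendsto h.tau
  have hτ0 : Tendsto (fun τ : ℝ => τ) (𝓝[>] 0) (𝓝 0) := nhdsWithin_le_nhds
  let y₀ : (Fin m → ℝ) × ℝ := (fun k => u (x k), r)
  let Y : ℝ → Fin s → (Fin m → ℝ) × ℝ := fun τ j => (fun k => U τ j (x k), R τ j)
  -- In each of these pairs the first member belongs to the phase-field step and the second to the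
  -- model in nodal coordinates. The operations of the model propagate the O(τ^(p+1)) difference
  -- from stages to slopes and to the defect.
  have cu := (UnifEq.diag h.u_bdd).nodal he hu
  have cU := fun j => (UnifEq.diag (h.U_bdd j)).nodal he (hU j)
  have cR := fun j => UnifEq.diag (P := P) (g := g) (.const (h.R_bdd j))
  have cr := UnifEq.diag (P := P) (g := g) (.const h.r_bdd)
  have cτ := UnifEq.diag (P := P) (g := g) (.const hτ1)
  have cL := fun j => hc.L (cU j)
  have cN := fun j => hc.Nreg h.smooth_rho (cU j) (cR j)
  have cNt := fun j => hc.Ntildereg h.smooth_rho (cU j) (cR j)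
  -- The slopes of the model are interpolants of L and N at the interpolated stages. This is where L
  -- and N at the true stages must themselves be reproduced by interpolation.
  have cS := fun j => (hc.add (hc.smul (hc.const (T.b j)) (cL j))
    (hc.smul (hc.const (T.bbar j)) (cN j))).nodal (x := x) he (by
      refine (((hL j).const_smul (T.b j)).add ((hN j).const_smul (T.bbar j))).congr
        (Eventually.of_forall fun τ => ?_)
      have : (fun k => (T.b j • P.L (U τ j) + T.bbar j • P.Nreg ρ (U τ j) (R τ j)) (x k)) =
          T.b j • (fun k => P.L (U τ j) (x k))
            + T.bbar j • fun k => P.Nreg ρ (U τ j) (R τ j) (x k) := rfl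
      simp only [cond_true]
      rw [this, map_add, map_smul, map_smul, smul_sub, smul_sub]
      abel)
  have cσ := fun j => hc.mul' (hc.const (T.bbar j)) (cNt j)
  obtain ⟨B, hB⟩ := exists_modelForm (e := e) he
  have hBc : ∀ v w, B v w = B w v := fun v w => by
    rw [hB, hB, inner2_lap_comm (.nodal he _) (.nodal he _)]
    ring
  have hdiff : (fun τ => P.energyDefect τ u r (U τ)
      (fun i => T.b i • P.L (U τ i) + T.bbar i • P.Nreg ρ (U τ i) (R τ i)) (R τ)
      (fun i => T.bbar i * P.Ntildereg ρ (U τ i) (R τ i)) - T.balanceDefect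
        (P.modelImplicit x e) (P.modelExplicit ρ x e) B y₀ τ (Y τ)) =O[𝓝[>] 0] g := by
    simp_rw [balanceDefect_model hB]
    exact (hc.energyDefect cτ cr cu cU cS cR cσ).diff.eval 0
  have hlim : ∀ j, Tendsto (fun τ => Y τ j) (𝓝[>] 0) (𝓝 y₀) := fun j => by
    refine (tendsto_pi_nhds.2 fun k => ?_).prodMk_nhds ?_
    · have := ((h.U_sub j).eval (x k)).trans_tendsto hτ0
      simpa using this.add_const (u (x k))
    · simpa using ((h.R_sub j).trans_tendsto hτ0).add_const r
  -- At each node the true stage equation holds exactly, so the residual in the model is τ times the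
  -- difference between true and model slopes.
  have hres : ∀ j, (fun τ => Y τ j - (y₀ + τ • ∑ k, T.A j k • P.modelImplicit x e (Y τ k)
      + τ • ∑ k, T.Abar j k • P.modelExplicit ρ x e (Y τ k))) =O[𝓝[>] 0] g := fun j => by
    refine IsBigO.prod_left ?_ ?_
    · refine isBigO_pi.2 fun q => ?_
      have h1 := (hc.smul cτ (hc.add
        (hc.sum Finset.univ fun k _ => hc.smul (hc.const (T.A j k)) (cL k))
        (hc.sum Finset.univ fun k _ => hc.smul (hc.const (T.Abar j k)) (cN k)))).diff.eval (x q)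
      refine h1.congr' ?_ EventuallyEq.rfl
      filter_upwards [h.U_eq] with τ hτ
      have h2 := congrFun (hτ j) (x q)
      simp only [cond_true, cond_false, Pi.add_apply, Pi.sub_apply, Pi.smul_apply,
        Finset.sum_apply, smul_eq_mul] at h2 ⊢
      simp only [Y, y₀, modelImplicit, modelExplicit, Prod.fst_add, Prod.smul_fst,
        Prod.fst_sum, Pi.add_apply, Pi.smul_apply, Finset.sum_apply, smul_eq_mul]
      rw [h2]
      ring
    · have h1 := (hc.mul' cτ (hc.sum' Finset.univ fun k _ =>
        hc.mul' (hc.const (T.Abar j k)) (cNt k))).diff.eval 0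
      refine h1.congr' ?_ EventuallyEq.rfl
      filter_upwards [h.R_eq] with τ hτ
      have h2 := hτ j
      simp only [cond_true, cond_false, Pi.sub_apply] at h2 ⊢
      simp only [Y, y₀, modelImplicit, modelExplicit, Prod.snd_add, Prod.smul_snd,
        Prod.snd_sum, smul_eq_mul, mul_zero, Finset.sum_const_zero, add_zero]
      rw [h2]
      ring
  have h3 := hT.isBigO_balanceDefect_of_approx (contDiff_modelImplicit he)
    (contDiff_modelExplicit h.smooth_rho he) hBc hres hlim
  refine (((hτ1.mul hdiff).congr_right fun τ => one_mul _).add h3).congr_left fun τ => ?_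
  ring

/-- The energy balance of the steps from a single initial value. -/
theorem BoundedStages.isBigO_energyDefect (hT : T.HasOrder p) {Z : Type*} {l : Filter (ℝ × Z)}
    {u : Z → EuclideanSpace ℝ (Fin d) → ℝ} {r : Z → ℝ}
    {U : ℝ × Z → Fin s → EuclideanSpace ℝ (Fin d) → ℝ} {R : ℝ × Z → Fin s → ℝ}
    (h : P.BoundedStages T l (fun i => i.1) (fun i => u i.2) (fun i => r i.2) U R ρ) {z : Z}
    (hz : Tendsto (fun τ : ℝ => (τ, z)) (𝓝[>] 0) l) :
    (fun τ => τ * P.energyDefect τ (u z) (r z) (U (τ, z))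
      (fun i => T.b i • P.L (U (τ, z) i) + T.bbar i • P.Nreg ρ (U (τ, z) i) (R (τ, z) i))
      (R (τ, z)) (fun i => T.bbar i * P.Ntildereg ρ (U (τ, z) i) (R (τ, z) i))) =O[𝓝[>] 0]
      fun τ : ℝ => τ ^ (p + 1) := by
  have ha := Expansion.isDiffAlgebra (isBigO_one_of_tendsto h.tau) P (p + 1)
  obtain ⟨hU, hR⟩ := h.expansion (p + 1)
  -- All the families are interpolated at once, so that a single nodal space serves u, the stages
  -- and both kinds of slopes.
  obtain ⟨m, x, e, he, hi⟩ := Expansion.exists_interpolation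
    (V := Sum.elim (fun _ : Unit => fun i : ℝ × Z => u i.2) (Sum.elim (fun j i => U i j)
      (Sum.elim (fun j i => P.L (U i j)) fun j i => P.Nreg ρ (U i j) (R i j)))) (n := p + 1)
    (by
      rintro (_ | j | j | j)
      exacts [.of_param h.u_bdd _, hU j, ha.L (hU j), ha.Nreg h.smooth_rho (hU j) (hR j)]) hz
  exact (h.comp_tendsto hz).isBigO_energyDefect_of_interpolation hT he (hi (.inl ()))
    (fun j => hi (.inr (.inl j))) (fun j => hi (.inr (.inr (.inl j))))
    fun j => hi (.inr (.inr (.inr j)))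

end PhaseField

/-! ### The relaxation polynomial and the uniform estimates -/

namespace PhaseField

variable {d s p : ℕ} {P : PhaseField d} {T : IMEXTableau s}

theorem inner2_sub_left {v w z : EuclideanSpace ℝ (Fin d) → ℝ} (hv : P.SmoothPeriodic v)
    (hw : P.SmoothPeriodic w) (hz : P.SmoothPeriodic z) :
    P.inner2 (v - w) z = P.inner2 v z - P.inner2 w z := by
  have h := inner2_add_left hv (hw.smul (-1)) hz
  rw [inner2_smul_left, neg_one_smul, ← sub_eq_add_neg] at h
  linarith

theorem inner2_sum_left {κ : Type*} (t : Finset κ) {v : κ → EuclideanSpace ℝ (Fin d) → ℝ}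
    {z : EuclideanSpace ℝ (Fin d) → ℝ} (hv : ∀ j ∈ t, P.SmoothPeriodic (v j))
    (hz : P.SmoothPeriodic z) : P.inner2 (∑ j ∈ t, v j) z = ∑ j ∈ t, P.inner2 (v j) z := by
  unfold inner2
  rw [← integral_finsetSum _ fun j hj => (hv j hj).integrable_mul hz]
  simp [Finset.sum_mul]

theorem gradSq_add_smul {v w : EuclideanSpace ℝ (Fin d) → ℝ} (hv : P.SmoothPeriodic v)
    (hw : P.SmoothPeriodic w) (c : ℝ) :
    P.gradSq (v + c • w) = P.gradSq v - 2 * c * P.inner2 v (lap w) + c ^ 2 * P.gradSq w := by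
  have hcw := hw.smul c
  rw [gradSq_eq (hv.add hcw), gradSq_eq hv, gradSq_eq hw,
    inner2_add_left hv hcw (hv.add hcw).lap, inner2_lap_comm hv (hv.add hcw),
    inner2_lap_comm hcw (hv.add hcw), inner2_add_left hv hcw hv.lap,
    inner2_add_left hv hcw hcw.lap, lap_smul c hw.1, inner2_smul_left, inner2_smul_left,
    inner2_comm P w (lap v), ← inner2_comm P w (lap v), inner2_lap_comm hw hv,
    inner2_comm P v (c • lap w), inner2_comm P w (c • lap w), inner2_smul_left, inner2_smul_left,
    inner2_comm P v (lap w), inner2_comm P w (lap w)]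
  ring

section Step

variable {τ r : ℝ} {u : EuclideanSpace ℝ (Fin d) → ℝ}
  {U : Fin s → EuclideanSpace ℝ (Fin d) → ℝ} {R : Fin s → ℝ}

theorem SmoothPeriodic.slope (hU : ∀ i, P.SmoothPeriodic (U i)) (i : Fin s) :
    P.SmoothPeriodic (P.slope T U R i) :=
  ((hU i).L.smul _).add (((hU i).N _).smul _)

theorem relaxDenom_eq (hU : ∀ i, P.SmoothPeriodic (U i)) : P.relaxDenom T U R =
    -P.ε ^ 2 / 2 * P.inner2 (∑ i, P.slope T U R i) (lap (∑ i, P.slope T U R i))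
      + (∑ i, P.slopeR T U R i) ^ 2 := by
  rw [relaxDenom, gradSq_eq (.sum fun i _ => .slope hU i)]
  ring

/-- The energy balance is a quadratic polynomial in the relaxation coefficient. -/
theorem relaxFun_eq (hu : P.SmoothPeriodic u) (hU : ∀ i, P.SmoothPeriodic (U i)) (γ : ℝ) :
    P.relaxFun T τ u r U R γ =
      γ * (τ * P.energyDefect τ u r U (P.slope T U R) R (P.slopeR T U R)
        - τ ^ 2 * P.relaxDenom T U R) + γ ^ 2 * (τ ^ 2 * P.relaxDenom T U R) := by
  have hS := SmoothPeriodic.slope (T := T) (R := R) hU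
  have hSS : P.SmoothPeriodic (∑ i, P.slope T U R i) := .sum fun i _ => hS i
  have h1 : P.inner2 u (lap (∑ i, P.slope T U R i)) =
      ∑ i, P.inner2 u (lap (P.slope T U R i)) := by
    rw [inner2_lap_comm hu hSS, inner2_sum_left _ (fun i _ => hS i) hu.lap]
    exact Finset.sum_congr rfl fun i _ => inner2_lap_comm (hS i) hu
  unfold relaxFun energyDefect energy updateU updateR
  rw [← relaxDenom_eq hU, gradSq_add_smul hu hSS, h1]
  unfold relaxDenom
  simp only [fun i => inner2_sub_left hu (hU i) (hS i).lap, mul_sub, sub_mul,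
    Finset.sum_add_distrib, Finset.sum_sub_distrib, mul_assoc, ← Finset.mul_sum]
  ring

theorem relaxCoeff_sub_one (hτ : τ ≠ 0) (hU : ∀ i, P.SmoothPeriodic (U i))
    (hD : P.relaxDenom T U R ≠ 0) : P.relaxCoeff T τ u r U R - 1 =
      -(τ * P.energyDefect τ u r U (P.slope T U R) R (P.slopeR T U R))
        / (τ ^ 2 * P.relaxDenom T U R) := by
  rw [relaxCoeff, if_pos hD, energyDefect, ← relaxDenom_eq hU]
  have h1 : ∀ i, P.ε ^ 2 * P.inner2 (u - U i) (lap (P.slope T U R i))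
      - 2 * (r - R i) * P.slopeR T U R i =
      -(-P.ε ^ 2 * P.inner2 (u - U i) (lap (P.slope T U R i))
        + 2 * (r - R i) * P.slopeR T U R i) := fun i => by ring
  simp only [h1, Finset.sum_neg_distrib]
  field_simp
  ring

/-- This is the elementary end of the argument for one step: the coefficients of the polynomial G
are read off and the two estimates on ℰ and D are inserted. The constant is the sum of those needed
for the separate claims; 2C₁/g₀ is the one for γₙ, where D ≥ g₀/2. -/
theorem relaxation_estimates (hp : 2 ≤ p) (hτ : 0 < τ) (hτ1 : τ ≤ 1) (hu : P.SmoothPeriodic u)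
    (hU : ∀ i, P.SmoothPeriodic (U i)) {C₁ C₂ g₀ : ℝ} (hC₁ : 0 ≤ C₁) (hC₂ : 0 ≤ C₂) (hg₀ : 0 < g₀)
    (hE : |τ * P.energyDefect τ u r U (P.slope T U R) R (P.slopeR T U R)| ≤ C₁ * τ ^ (p + 1))
    (hD : |P.relaxDenom T U R - P.leading u r| ≤ C₂ * τ) (hg : C₂ * τ ≤ g₀ / 2) :
    |P.relaxFun T τ u r U R 1| ≤ (C₁ + C₂ + 2 * C₁ / g₀) * τ ^ (p + 1) ∧
      Differentiable ℝ (P.relaxFun T τ u r U R) ∧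
      |deriv (P.relaxFun T τ u r U R) 0 + P.leading u r * τ ^ 2|
        ≤ (C₁ + C₂ + 2 * C₁ / g₀) * τ ^ 3 ∧
      |deriv (P.relaxFun T τ u r U R) 1 - P.leading u r * τ ^ 2|
        ≤ (C₁ + C₂ + 2 * C₁ / g₀) * τ ^ 3 ∧
      (g₀ ≤ P.leading u r ∨ P.relaxDenom T U R = 0 →
        |P.relaxCoeff T τ u r U R - 1| ≤ (C₁ + C₂ + 2 * C₁ / g₀) * τ ^ (p - 1)) := by
  have hfun := funext (relaxFun_eq (T := T) (τ := τ) (r := r) (R := R) hu hU)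
  have hcoeff := relaxCoeff_sub_one (T := T) (u := u) (r := r) (R := R) hτ.ne' hU
  set E := τ * P.energyDefect τ u r U (P.slope T U R) R (P.slopeR T U R)
  set D := P.relaxDenom T U R
  set g := P.leading u r
  have hder : ∀ γ, HasDerivAt (P.relaxFun T τ u r U R)
      ((E - τ ^ 2 * D) + 2 * γ * (τ ^ 2 * D)) γ := fun γ => by
    rw [hfun]
    refine (((hasDerivAt_id γ).mul_const (E - τ ^ 2 * D)).add
      ((hasDerivAt_pow 2 γ).mul_const (τ ^ 2 * D))).congr_deriv ?_
    simp
  have hC : 0 ≤ 2 * C₁ / g₀ := by positivity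
  -- Here p ≥ 2 and τ ≤ 1 turn τ^(p+1) into at most τ³.
  have hE3 : |E| ≤ C₁ * τ ^ 3 := hE.trans
    (mul_le_mul_of_nonneg_left (pow_le_pow_of_le_one hτ.le hτ1 (by omega)) hC₁)
  have hD3 : |τ ^ 2 * (D - g)| ≤ C₂ * τ ^ 3 := by
    rw [abs_mul, abs_of_nonneg (by positivity)]
    calc τ ^ 2 * |D - g| ≤ τ ^ 2 * (C₂ * τ) := by gcongr
      _ = _ := by ring
  have h3 : (C₁ + C₂) * τ ^ 3 ≤ (C₁ + C₂ + 2 * C₁ / g₀) * τ ^ 3 :=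
    mul_le_mul_of_nonneg_right (by linarith) (by positivity)
  refine ⟨?_, fun γ => (hder γ).differentiableAt, ?_, ?_, fun h => ?_⟩
  · rw [hfun]
    calc _ = |E| := by congr 1; ring
      _ ≤ C₁ * τ ^ (p + 1) := hE
      _ ≤ _ := by gcongr; linarith
  · rw [(hder 0).deriv]
    calc _ = |E - τ ^ 2 * (D - g)| := by congr 1; ring
      _ ≤ |E| + |τ ^ 2 * (D - g)| := abs_sub _ _
      _ ≤ _ := by linarith
  · rw [(hder 1).deriv]
    calc _ = |E + τ ^ 2 * (D - g)| := by congr 1; ring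
      _ ≤ |E| + |τ ^ 2 * (D - g)| := abs_add_le _ _
      _ ≤ _ := by linarith
  · by_cases hD0 : D = 0
    · have : P.relaxCoeff T τ u r U R = 1 := if_neg (not_not.2 hD0)
      rw [this, sub_self, abs_zero]
      positivity
    · have hgD : g₀ / 2 ≤ D := by
        have := (abs_le.1 hD).1
        have := h.resolve_right hD0
        linarith
      have hDpos : 0 < D := by linarith
      rw [hcoeff hD0, abs_div, abs_neg, abs_of_pos (show 0 < τ ^ 2 * D by positivity),
        div_le_iff₀ (by positivity)]
      have hpow : τ ^ (p + 1) = τ ^ (p - 1) * τ ^ 2 := by rw [← pow_add]; congr 1; omega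
      calc |E| ≤ C₁ * τ ^ (p + 1) := hE
        _ = 2 * C₁ / g₀ * τ ^ (p - 1) * (τ ^ 2 * (g₀ / 2)) := by rw [hpow]; field_simp
        _ ≤ (C₁ + C₂ + 2 * C₁ / g₀) * τ ^ (p - 1) * (τ ^ 2 * D) := by
          gcongr; linarith

end Step

/-- The denominator of the relaxation coefficient is the leading coefficient up to `O(τ)`. -/
theorem BoundedStages.isBigO_relaxDenom {ι : Type*} {l : Filter ι} {τ r : ι → ℝ}
    {u : ι → EuclideanSpace ℝ (Fin d) → ℝ} {U : ι → Fin s → EuclideanSpace ℝ (Fin d) → ℝ}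
    {R : ι → Fin s → ℝ} {ρ : ℝ → ℝ} (h : P.BoundedStages T l τ u r U R ρ)
    (hb : ∑ i, T.b i = 1) (hbbar : ∑ i, T.bbar i = 1) :
    (fun i => (-P.ε ^ 2 / 2 * P.inner2
        (∑ j, (T.b j • P.L (U i j) + T.bbar j • P.Nreg ρ (U i j) (R i j)))
        (lap (∑ j, (T.b j • P.L (U i j) + T.bbar j • P.Nreg ρ (U i j) (R i j))))
      + (∑ j, T.bbar j * P.Ntildereg ρ (U i j) (R i j)) ^ 2)
      - (-P.ε ^ 2 / 2 * P.inner2 (P.L (u i) + P.Nreg ρ (u i) (r i))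
          (lap (P.L (u i) + P.Nreg ρ (u i) (r i)))
        + P.Ntildereg ρ (u i) (r i) ^ 2)) =O[l] τ := by
  have hc := isDiffAlgebra_unifEq P l τ
  -- The stages are paired with the initial value, from which they differ by O(τ). With every stage
  -- replaced by (u, r), the weighted sums collapse to L(u) + N(u, r) and Ñ(u, r) because the
  -- weights sum to one.
  have cU := fun j => UnifEq.of_left_right (h.U_bdd j) h.u_bdd (h.U_sub j)
  have cR := fun j => UnifEq.of_const (P := P) (h.R_bdd j) h.r_bdd (h.R_sub j)
  have cS := hc.sum Finset.univ fun j _ => hc.add (hc.smul (hc.const (T.b j)) (hc.L (cU j)))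
    (hc.smul (hc.const (T.bbar j)) (hc.Nreg h.smooth_rho (cU j) (cR j)))
  have cσ := hc.sum' Finset.univ fun j _ => hc.mul' (hc.const (T.bbar j))
    (hc.Ntildereg h.smooth_rho (cU j) (cR j))
  have h1 := (hc.add' (hc.mul' (hc.const (-P.ε ^ 2 / 2)) (hc.inner2 cS (hc.lap cS)))
    (hc.mul' cσ cσ)).diff.eval 0
  refine h1.congr_left fun i => ?_
  simp only [cond_true, cond_false, Pi.sub_apply, Finset.sum_add_distrib, ← Finset.sum_smul,
    ← Finset.sum_mul, hb, hbbar, one_smul, one_mul, sq]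

/-- The energy balance of the steps, uniformly in the initial values. -/
theorem BoundedStages.isBigO_energyDefect_uniform (hT : T.HasOrder p) {Z : Type*} {K : Set Z}
    {u : Z → EuclideanSpace ℝ (Fin d) → ℝ} {r : Z → ℝ}
    {U : ℝ × Z → Fin s → EuclideanSpace ℝ (Fin d) → ℝ} {R : ℝ × Z → Fin s → ℝ} {ρ : ℝ → ℝ}
    (h : P.BoundedStages T (𝓝[>] 0 ×ˢ 𝓟 K) (fun i => i.1) (fun i => u i.2) (fun i => r i.2)
      U R ρ) :
    (fun i => i.1 * P.energyDefect i.1 (u i.2) (r i.2) (U i)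
      (fun j => T.b j • P.L (U i j) + T.bbar j • P.Nreg ρ (U i j) (R i j))
      (R i) (fun j => T.bbar j * P.Ntildereg ρ (U i j) (R i j))) =O[𝓝[>] 0 ×ˢ 𝓟 K]
      fun i => i.1 ^ (p + 1) := by
  have hl := isBigO_one_of_tendsto h.tau
  have ha := Expansion.isDiffAlgebra hl P (p + 1)
  obtain ⟨hU, hR⟩ := h.expansion (p + 1)
  have hτ := Expansion.fst (P := P) hl (p + 1)
  have hr : Expansion P (𝓝[>] 0 ×ˢ 𝓟 K) (p + 1) fun i _ => r i.2 :=
    .of_param (c := fun z _ => r z) (.const h.r_bdd) (p + 1)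
  have hS := fun j => ha.add (ha.smul (ha.const (T.b j)) (ha.L (hU j)))
    (ha.smul (ha.const (T.bbar j)) (ha.Nreg h.smooth_rho (hU j) (hR j)))
  have hσ := fun j => ha.mul' (ha.const (T.bbar j)) (ha.Ntildereg h.smooth_rho (hU j) (hR j))
  -- The defect is a number, viewed as a function constant in space and evaluated at the origin. Its
  -- uniform expansion turns the estimate for each single initial value into one uniform over K.
  refine Expansion.isBigO_of_pointwise (ha.mul' hτ (ha.energyDefect hτ hr
    (.of_param h.u_bdd (p + 1)) hU hS hR hσ)) 0 fun z hz => ?_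
  exact h.isBigO_energyDefect hT
    (tendsto_id.prodMk (tendsto_principal.2 (Eventually.of_forall fun _ => hz)))

end PhaseField

/-- The step size and the initial value together form one index, with the filter τ → 0⁺ times the
principal filter of K. A statement that holds eventually along this filter holds for all small τ
uniformly over K. -/
theorem mainTheorem2 {s d : ℕ} (T : IMEXTableau s) (hdiag : ∀ i, 0 ≤ T.A i i)
    (p : ℕ) (hp : 2 ≤ p) (hT : T.HasOrder p) (P : PhaseField d)
    (K : Set ((EuclideanSpace ℝ (Fin d) → ℝ) × ℝ))
    (hK : ∀ z ∈ K, P.SmoothPeriodic z.1)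
    (hKu : ∀ k : ℕ, ∃ M : ℝ, ∀ z ∈ K, ∀ x, ‖iteratedFDeriv ℝ k z.1 x‖ ≤ M)
    (hKr : ∃ M : ℝ, ∀ z ∈ K, |z.2| ≤ M)
    (hKpos : ∃ δ : ℝ, 0 < δ ∧ ∀ z ∈ K, δ ≤ P.potential z.1)
    (g₀ : ℝ) (hg₀ : 0 < g₀) :
    ∃ τ₀ : ℝ, 0 < τ₀ ∧ ∃ C : ℝ, ∀ τ : ℝ, 0 < τ → τ < τ₀ → ∀ u r, (u, r) ∈ K →
      (∃! S : (Fin s → EuclideanSpace ℝ (Fin d) → ℝ) × (Fin s → ℝ),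
        P.IsStages T τ u r S.1 S.2) ∧
      ∀ U R, P.IsStages T τ u r U R →
        (∀ i, 0 < P.potential (U i)) ∧
        |P.relaxFun T τ u r U R 1| ≤ C * τ ^ (p + 1) ∧
        Differentiable ℝ (P.relaxFun T τ u r U R) ∧
        |deriv (P.relaxFun T τ u r U R) 0 + P.leading u r * τ ^ 2| ≤ C * τ ^ 3 ∧
        |deriv (P.relaxFun T τ u r U R) 1 - P.leading u r * τ ^ 2| ≤ C * τ ^ 3 ∧
        (g₀ ≤ P.leading u r ∨ P.relaxDenom T U R = 0 →
          |P.relaxCoeff T τ u r U R - 1| ≤ C * τ ^ (p - 1)) := by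
  obtain ⟨δ, hδ, hKδ⟩ := hKpos
  obtain ⟨Mr, hMr⟩ := hKr
  -- The threshold is δ/2 and not δ, since the potential at the stages is only known to stay above
  -- δ/2.
  obtain ⟨ρ, hρ, hρ'⟩ := exists_contDiff_eq_inv_sqrt (half_pos hδ)
  obtain ⟨hb, hbbar⟩ := hT.sum_b (by omega)
  set l : Filter (ℝ × ((EuclideanSpace ℝ (Fin d) → ℝ) × ℝ)) := 𝓝[>] (0 : ℝ) ×ˢ 𝓟 K with hl
  have hτl : Tendsto (fun i : ℝ × ((EuclideanSpace ℝ (Fin d) → ℝ) × ℝ) => i.1) l (𝓝[>] 0) :=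
    tendsto_fst
  have hKl : ∀ᶠ i in l, i.2 ∈ K := tendsto_snd.eventually (mem_principal_self K)
  have hτpos : ∀ᶠ i in l, 0 < i.1 := hτl.eventually self_mem_nhdsWithin
  -- One family of stages is chosen over all indices, with value 0 where τ ≤ 0 or (u, r) ∉ K, which
  -- the filter never sees.
  have hex : ∀ i : ℝ × ((EuclideanSpace ℝ (Fin d) → ℝ) × ℝ),
      ∃ S : (Fin s → EuclideanSpace ℝ (Fin d) → ℝ) × (Fin s → ℝ),
        0 < i.1 → i.2 ∈ K → P.IsStages T i.1 i.2.1 i.2.2 S.1 S.2 := fun i => by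
    by_cases h : 0 < i.1 ∧ i.2 ∈ K
    · obtain ⟨S, hS, -⟩ := P.existsUnique_isStages hdiag h.1.le (hK _ h.2) i.2.2
      exact ⟨S, fun _ _ => hS⟩
    · exact ⟨0, fun h1 h2 => (h ⟨h1, h2⟩).elim⟩
  choose S hS using hex
  have hSl : ∀ᶠ i in l, P.IsStages T i.1 i.2.1 i.2.2 (S i).1 (S i).2 := by
    filter_upwards [hτpos, hKl] with i h1 h2 using hS i h1 h2
  have hu : P.UnifO l (fun i => i.2.1) fun _ => 1 := by
    refine ⟨hKl.mono fun i hi => hK _ hi, fun k => ?_⟩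
    obtain ⟨M, hM⟩ := hKu k
    exact ⟨M, hKl.mono fun i hi x => by simpa using hM _ hi x⟩
  have hr : (fun i : ℝ × ((EuclideanSpace ℝ (Fin d) → ℝ) × ℝ) => i.2.2) =O[l] fun _ => (1 : ℝ) :=
    IsBigO.of_bound Mr (hKl.mono fun i hi => by simpa using hMr _ hi)
  have hpot : ∀ᶠ i in l, δ ≤ P.potential i.2.1 := hKl.mono fun i hi => hKδ _ hi
  have hstage := PhaseField.stage_bounds hdiag hδ hρ hρ' hτl hu hr hpot hSl
  have hpos : ∀ᶠ i in l, ∀ j, δ / 2 ≤ P.potential ((S i).1 j) :=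
    eventually_all.2 fun j => (hstage j).2.2
  have hB := PhaseField.boundedStages hdiag hδ hρ hρ' hτl hu hr hpot hSl
  have hE := PhaseField.BoundedStages.isBigO_energyDefect_uniform hT (u := Prod.fst)
    (r := Prod.snd) hB
  have hD := hB.isBigO_relaxDenom hb hbbar
  obtain ⟨C₁, hC₁, hE⟩ := hE.exists_nonneg
  obtain ⟨C₂, hC₂, hD⟩ := hD.exists_nonneg
  have hsmall : ∀ᶠ i in l, i.1 ≤ 1 ∧ C₂ * i.1 ≤ g₀ / 2 := by
    have h0 : Tendsto (fun i : ℝ × ((EuclideanSpace ℝ (Fin d) → ℝ) × ℝ) => i.1) l (𝓝 0) :=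
      hτl.mono_right nhdsWithin_le_nhds
    have h1 := h0.const_mul C₂
    rw [mul_zero] at h1
    exact (h0.eventually (Iic_mem_nhds one_pos)).and (h1.eventually (Iic_mem_nhds (half_pos hg₀)))
  have hmain : ∀ᶠ i in l, (∀ j, 0 < P.potential ((S i).1 j)) ∧ i.1 ≤ 1 ∧ C₂ * i.1 ≤ g₀ / 2 ∧
      |i.1 * P.energyDefect i.1 i.2.1 i.2.2 (S i).1 (P.slope T (S i).1 (S i).2) (S i).2
        (P.slopeR T (S i).1 (S i).2)| ≤ C₁ * i.1 ^ (p + 1) ∧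
      |P.relaxDenom T (S i).1 (S i).2 - P.leading i.2.1 i.2.2| ≤ C₂ * i.1 := by
    filter_upwards [hE.bound, hD.bound, hsmall, hpos, hSl, hKl, hτpos] with i h1 h2 h3 h4 h5 h6 h7
    have e1 : ∀ j, T.b j • P.L ((S i).1 j) + T.bbar j • P.Nreg ρ ((S i).1 j) ((S i).2 j) =
        P.slope T (S i).1 (S i).2 j := fun j => by
      rw [PhaseField.Nreg_eq (h5.smooth j) (hρ' _ (h4 j)), PhaseField.slope]
    have e2 : ∀ j, T.bbar j * P.Ntildereg ρ ((S i).1 j) ((S i).2 j) =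
        P.slopeR T (S i).1 (S i).2 j := fun j => by
      rw [PhaseField.Ntildereg_eq (h5.smooth j) (hρ' _ (h4 j)), PhaseField.slopeR]
    have h8 : ρ (P.potential i.2.1) = 1 / √(P.potential i.2.1) :=
      hρ' _ ((half_le_self hδ.le).trans (hKδ _ h6))
    have e3 : P.leading i.2.1 i.2.2 = -P.ε ^ 2 / 2 * P.inner2
        (P.L i.2.1 + P.Nreg ρ i.2.1 i.2.2) (PhaseField.lap (P.L i.2.1 + P.Nreg ρ i.2.1 i.2.2))
        + P.Ntildereg ρ i.2.1 i.2.2 ^ 2 := by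
      rw [PhaseField.Nreg_eq (hK _ h6) h8, PhaseField.Ntildereg_eq (hK _ h6) h8,
        PhaseField.leading, PhaseField.gradSq_eq ((hK _ h6).L.add ((hK _ h6).N _))]
      ring
    simp only [e1, e2, ← e3] at h1 h2
    rw [← PhaseField.relaxDenom_eq h5.smooth] at h2
    rw [Real.norm_eq_abs, Real.norm_eq_abs, abs_of_pos (pow_pos h7 _)] at h1
    rw [Real.norm_eq_abs, Real.norm_eq_abs, abs_of_pos h7] at h2
    exact ⟨fun j => (half_pos hδ).trans_le (h4 j), h3.1, h3.2, h1, h2⟩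
  rw [hl, eventually_prod_principal_iff] at hmain
  obtain ⟨τ₀, hτ₀, hsub⟩ := mem_nhdsGT_iff_exists_Ioo_subset.1 hmain
  refine ⟨τ₀, hτ₀, C₁ + C₂ + 2 * C₁ / g₀, fun τ h1 h2 u r hur => ?_⟩
  have hun := P.existsUnique_isStages hdiag h1.le (hK _ hur) r
  refine ⟨hun, fun U R hUR => ?_⟩
  obtain ⟨h3, h4, h5, h6, h7⟩ := hsub ⟨h1, h2⟩ (u, r) hur
  -- Uniqueness transfers the estimates from the chosen family to the given stages.
  have he : S (τ, (u, r)) = (U, R) := hun.unique (hS (τ, (u, r)) h1 hur) hUR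
  rw [he] at h3 h6 h7
  exact ⟨h3, PhaseField.relaxation_estimates hp h1 h4 (hK _ hur) hUR.smooth hC₁ hC₂ hg₀ h6 h7 h5⟩
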